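/- **Setting.** Let $\nu,R,a>0$, $\Omega=\{x\in\mathbb R^3: r<R,\ |z|<a\}$ with cylindrical coordinates $(r,\varphi,z)$, and let $S=\partial\Omega$. For $0<\varepsilon<r_0<2r_0<R$ put $\Omega_\varepsilon=\{x\in\Omega: r>\varepsilon\}$, $\Omega_\varepsilon^t=\Omega_\varepsilon\times(0,t)$. For a set $G\subset\mathbb R^3$ and $G^t=G\times(0,t)$ let $\|w\|_{V_2^0(G^t)}=\|w\|_{L_\infty(0,t;L_2(G))}+\|\nabla w\|_{L_2(G^t)}$ (for a vector field, $\nabla$ is the full Cartesian gradient). Fix a smooth profile $Z:\mathbb R\to\mathbb R$ with $Z(s)=1$ for $s\le1$, $Z(s)=0$ for $s\ge2$, and let $\zeta_1(r)=Z(r/r_0)$. Let $T>0$ and let $v=(v_r,v_\varphi,v_z)$, $p$ (all depending on $r,z,t$ only, $v$ of class $C^3$ and $p$ of class $C^2$ up to the boundary) be an axially symmetric solution in $\Omega_\varepsilon\times(0,T)$ of $$v_{r,t}+v\cdot\nabla v_r-\tfrac{v_\varphi^2}{r}-\nu\Delta v_r+\nu\tfrac{v_r}{r^2}=-p_{,r}+f_r,\qquad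 v_{\varphi,t}+v\cdot\nabla v_\varphi+\tfrac{v_r}{r}v_\varphi-\nu\Delta v_\varphi+\nu\tfrac{v_\varphi}{r^2}=f_\varphi,$$ $$v_{z,t}+v\cdot\nabla v_z-\nu\Delta v_z=-p_{,z}+f_z,\qquad v_{r,r}+v_{z,z}=-\tfrac{v_r}{r},$$ where $v\cdot\nabla=v_r\partial_r+v_z\partial_z$, $\Delta w=\frac1r(rw_{,r})_{,r}+w_{,zz}$, with the slip conditions $v_r=0$, $v_{z,r}=0$, $v_{\varphi,r}=v_\varphi/r$ for $r\in\{\varepsilon,R\}$ and $v_z=0$, $v_{r,z}=0$, $v_{\varphi,z}=0$ for $z=\pm a$. Put $\chi=v_{r,z}-v_{z,r}$, $F=f_{r,z}-f_{z,r}$, $u=rv_\varphi$. Continue $\chi$ by $0$ to $r\le\varepsilon$, and suppose that $(v_r,v_z)$ is given in $\Omega_\varepsilon$ by $v_r=\psi_{,z}/r$, $v_z=-\psi_{,r}/r$, where $\psi$ solves $$\Big(\frac{\psi_{,z}}r\Big)_{,z}+\Big(\frac{\psi_{,r}}r\Big)_{,r}=\chi\ \text{ in }\Omega,\qquad \psi=0\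 \text{ on }S,$$ with $\psi=r^2\eta$, $\eta(\cdot,\cdot,t)$ of class $C^2$ up to the boundary. Let $\tilde\chi=\chi\zeta_1^2$, $\tilde F=F\zeta_1^2$, $\tilde f_\varphi=f_\varphi\zeta_1$, $\tilde v_\varphi=v_\varphi\zeta_1$, and denote the value at $t=0$ by $(0)$. **Lemma 4.5.** There are a constant $c>0$ and a positive increasing (i.e. non-decreasing) function $\sigma\mapsto c(\sigma)$, depending only on $\nu,R,a$ and the profile $Z$ (not on $\varepsilon$, $r_0$, $T$ or the solution), such that the following holds for all $\varepsilon,r_0,T$ and all solutions as above. Assume $$\frac{\tilde\chi(0)}r\in L_2(\Omega_\varepsilon),\quad \frac{\tilde F}r\in L_2(\Omega_\varepsilon^T),\quad \frac{\tilde f_\varphi}{\sqrt r}\in L_{20/11}(\Omega_\varepsilon^T),\quad \frac{\tilde v_\varphi(0)}{\sqrt r}\in L_4(\Omega_\varepsilon),$$ let $d_5,d_6\ge0$ satisfy $\|v\|_{V_2^0(\Omega_\varepsilon^T)}^2\le d_5^2$ and $\|u\|_{L_\infty(\Omega_\varepsilon^T)}\le d_6$, and assume $$\|u\|_{L_\infty(\{x\in\Omega_\varepsilon:\,r<2r_0\}\times(0,T))}\le\sqrt[4]{\tfrac58}\;\nu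 .$$ Then for every $t\in(0,T]$ $$\Big\|\frac{\tilde\chi}r\Big\|_{V_2^0(\Omega_\varepsilon^t)}^2\le c(1/r_0)\,d_5\,\|\chi\|^2_{L_{20/7}(\{x\in\Omega:\,r_0<r<2r_0\}\times(0,t))}+cA^2,$$ where $$A^2=c(1/r_0)d_5^2\big[1+(1+d_6)d_6^2\big]+\Big\|\frac{\tilde\chi(0)}r\Big\|_{L_2(\Omega_\varepsilon)}^2+\Big\|\frac{\tilde F}r\Big\|_{L_2(\Omega_\varepsilon^t)}^2+\Big\|\frac{\tilde f_\varphi}{\sqrt r}\Big\|_{L_{20/11}(\Omega_\varepsilon^t)}^4+\Big\|\frac{\tilde v_\varphi(0)}{\sqrt r}\Big\|_{L_4(\Omega_\varepsilon)}^4 .$$ -/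

import Mathlib

open MeasureTheory Set
open scoped ENNReal

noncomputable section

namespace AxiNS

/-- An axially symmetric scalar quantity, as a function of the cylindrical coordinates `r`, `z`
and of the time `t` (in this order). -/
abbrev Field := ℝ → ℝ → ℝ → ℝ

/-- Partial derivative with respect to `r`. -/
def dr (g : Field) : Field := fun r z t => deriv (fun s => g s z t) r

/-- Partial derivative with respect to `z`. -/
def dz (g : Field) : Field := fun r z t => deriv (fun s => g r s t) z

/-- Partial derivative with respect to `t`. -/
def dt (g : Field) : Field := fun r z t => deriv (fun s => g r z s) t

/-- The Laplacian of an axially symmetric function, `(1/r) (r g_r)_r + g_zz`. -/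
def lap (g : Field) : Field := fun r z t =>
  1 / r * dr (fun r z t => r * dr g r z t) r z t + dz (dz g) r z t

/-- The derivative along the flow, `v · ∇ g = v_r g_r + v_z g_z`. -/
def adv (vr vz g : Field) : Field := fun r z t => vr r z t * dr g r z t + vz r z t * dz g r z t

/-- `g` is of class `C^n` in `(r, z, t)`, up to the boundary of any box: only the values on the
box where `g` is used matter, and there `g` is the restriction of a `C^n` function on `ℝ³`. -/
def IsSmooth (n : ℕ∞) (g : Field) : Prop :=
  ContDiff ℝ n (fun q : ℝ × ℝ × ℝ => g q.1 q.2.1 q.2.2)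

/-- The azimuthal component `χ = v_{r,z} - v_{z,r}` of the vorticity.  Applied to `(f_r, f_z)` it
gives `F = f_{r,z} - f_{z,r}`. -/
def rot (vr vz : Field) : Field := fun r z t => dz vr r z t - dr vz r z t

/-- A field multiplied by a function of `r`. -/
def cut (ζ : ℝ → ℝ) (g : Field) : Field := fun r z t => g r z t * ζ r

/-! ### Measures and norms -/

/-- Lebesgue measure `dx = 2 π r dr dz` on `{x ∈ ℝ³ : r₁ < r < r₂, |z| < a}`, for functions that
depend on `(r, z)` only. -/
def cylMeasure (r₁ r₂ a : ℝ) : Measure (ℝ × ℝ) :=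
  (volume.restrict (Ioo r₁ r₂ ×ˢ Ioo (-a) a)).withDensity
    (fun x => ENNReal.ofReal (2 * Real.pi * x.1))

/-- The measure `dx dt` on `{r₁ < r < r₂, |z| < a} × (0, t)`. -/
def cylTimeMeasure (r₁ r₂ a t : ℝ) : Measure ((ℝ × ℝ) × ℝ) :=
  (cylMeasure r₁ r₂ a).prod (volume.restrict (Ioo 0 t))

/-- The norm in `L_p` of `{r₁ < r < r₂, |z| < a}` of the time slice `g(·, s)`. -/
def normX (p : ℝ≥0∞) (r₁ r₂ a : ℝ) (g : Field) (s : ℝ) : ℝ≥0∞ :=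
  eLpNorm (fun x : ℝ × ℝ => g x.1 x.2 s) p (cylMeasure r₁ r₂ a)

/-- The norm in `L_p` of `{r₁ < r < r₂, |z| < a} × (0, t)`. -/
def normXT (p : ℝ≥0∞) (r₁ r₂ a t : ℝ) (g : Field) : ℝ≥0∞ :=
  eLpNorm (fun q : (ℝ × ℝ) × ℝ => g q.1.1 q.1.2 q.2) p (cylTimeMeasure r₁ r₂ a t)

/-- `|∇ g|` for an axially symmetric scalar function. -/
def gradAbs (g : Field) : Field := fun r z t => Real.sqrt (dr g r z t ^ 2 + dz g r z t ^ 2)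

/-- The Euclidean length `|v|` of the vector field with cylindrical components `v_r, v_φ, v_z`. -/
def vecAbs (vr vφ vz : Field) : Field := fun r z t =>
  Real.sqrt (vr r z t ^ 2 + vφ r z t ^ 2 + vz r z t ^ 2)

/-- The Euclidean length of the full (Cartesian) gradient of the axially symmetric vector field
with cylindrical components `v_r, v_φ, v_z`; differentiating `e_r`, `e_φ` in the angle produces
the terms `v_r² / r²` and `v_φ² / r²`. -/
def vecGradAbs (vr vφ vz : Field) : Field := fun r z t =>
  Real.sqrt (gradAbs vr r z t ^ 2 + gradAbs vφ r z t ^ 2 + gradAbs vz r z t ^ 2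
    + vr r z t ^ 2 / r ^ 2 + vφ r z t ^ 2 / r ^ 2)

/-- The norm `‖g‖_{L_∞(0,t;L_2)} + ‖∇ g‖_{L_2(0,t;L_2)}` of `V_2^0` over
`{r₁ < r < r₂, |z| < a} × (0, t)`, for a scalar function. -/
def normV (r₁ r₂ a t : ℝ) (g : Field) : ℝ≥0∞ :=
  essSup (fun s => normX 2 r₁ r₂ a g s) (volume.restrict (Ioo 0 t))
    + normXT 2 r₁ r₂ a t (gradAbs g)

/-- The norm of `V_2^0` for a vector field in cylindrical components. -/
def vecNormV (r₁ r₂ a t : ℝ) (vr vφ vz : Field) : ℝ≥0∞ :=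
  essSup (fun s => normX 2 r₁ r₂ a (vecAbs vr vφ vz) s) (volume.restrict (Ioo 0 t))
    + normXT 2 r₁ r₂ a t (vecGradAbs vr vφ vz)

/-! ### The equations -/

/-- `(v, p)`, with force `f`, is a (sufficiently smooth) axially symmetric solution of the
Navier-Stokes equations with slip boundary conditions in `Ω_ε × (0, T)`, where
`Ω_ε = {ε < r < R, |z| < a}`. -/
structure IsSolution (ν R a T ε : ℝ) (vr vφ vz p fr fφ fz : Field) : Prop where
  smooth_r : IsSmooth 3 vr
  smooth_φ : IsSmooth 3 vφ
  smooth_z : IsSmooth 3 vz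
  smooth_p : IsSmooth 2 p
  momentum_r : ∀ r ∈ Ioo ε R, ∀ z ∈ Ioo (-a) a, ∀ t ∈ Ioo 0 T,
    dt vr r z t + adv vr vz vr r z t - vφ r z t ^ 2 / r - ν * lap vr r z t + ν * vr r z t / r ^ 2
      = - dr p r z t + fr r z t
  momentum_φ : ∀ r ∈ Ioo ε R, ∀ z ∈ Ioo (-a) a, ∀ t ∈ Ioo 0 T,
    dt vφ r z t + adv vr vz vφ r z t + vr r z t / r * vφ r z t - ν * lap vφ r z t
      + ν * vφ r z t / r ^ 2 = fφ r z t
  momentum_z : ∀ r ∈ Ioo ε R, ∀ z ∈ Ioo (-a) a, ∀ t ∈ Ioo 0 T,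
    dt vz r z t + adv vr vz vz r z t - ν * lap vz r z t = - dz p r z t + fz r z t
  div_free : ∀ r ∈ Ioo ε R, ∀ z ∈ Ioo (-a) a, ∀ t ∈ Ioo 0 T,
    dr vr r z t + dz vz r z t = - (vr r z t / r)
  -- slip conditions on the lateral walls `r = R` and `r = ε`
  bc_lateral : ∀ r, r = R ∨ r = ε → ∀ z ∈ Ioo (-a) a, ∀ t ∈ Ioo 0 T,
    vr r z t = 0 ∧ dr vz r z t = 0 ∧ dr vφ r z t = vφ r z t / r
  -- slip conditions on the bottom and the top `z = ± a`
  bc_flat : ∀ r ∈ Ioo ε R, ∀ z, z = -a ∨ z = a → ∀ t ∈ Ioo 0 T,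
    vz r z t = 0 ∧ dz vr r z t = 0 ∧ dz vφ r z t = 0

/-- `χ` continued by `0` to `r ≤ ε`. -/
def rotExt (ε : ℝ) (vr vz : Field) : Field := fun r z t => if r ≤ ε then 0 else rot vr vz r z t

/-- `ψ` is the stream function of `(v_r, v_z)`: it generates the velocity in `Ω_ε` and solves, in
the whole cylinder `Ω = {r < R, |z| < a}`, the elliptic problem whose right-hand side is `χ`,
continued by `0` to `r ≤ ε`.  Regularity on the axis is expressed by `ψ = r² η`, `η` of class
`C²` in `(r, z)` up to the boundary. -/
structure IsStreamFunction (R a T ε : ℝ) (vr vz ψ : Field) : Prop where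
  regular : ∀ t ∈ Ioo 0 T, ∃ η : ℝ → ℝ → ℝ, ContDiff ℝ 2 (fun x : ℝ × ℝ => η x.1 x.2) ∧
    ∀ r z, ψ r z t = r ^ 2 * η r z
  velocity : ∀ r ∈ Ioo ε R, ∀ z ∈ Ioo (-a) a, ∀ t ∈ Ioo 0 T,
    vr r z t = dz ψ r z t / r ∧ vz r z t = - (dr ψ r z t / r)
  elliptic : ∀ r ∈ Ioo 0 R, ∀ z ∈ Ioo (-a) a, ∀ t ∈ Ioo 0 T,
    dz (fun r z t => dz ψ r z t / r) r z t + dr (fun r z t => dr ψ r z t / r) r z t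
      = rotExt ε vr vz r z t
  boundary : ∀ t ∈ Ioo 0 T, (∀ z ∈ Icc (-a) a, ψ R z t = 0) ∧
    ∀ r ∈ Icc 0 R, ψ r (-a) t = 0 ∧ ψ r a t = 0

/-! ### Localized weighted quantities -/

/-- A profile of the cut-off function near the axis: smooth, `1` up to `1` and `0` from `2` on. -/
structure IsProfile (Z : ℝ → ℝ) : Prop where
  smooth : ContDiff ℝ (⊤ : ℕ∞) Z
  one : ∀ s ≤ 1, Z s = 1
  zero : ∀ s, 2 ≤ s → Z s = 0

/-- The cut-off function `ζ₁(r) = Z(r / r₀)`: it is `1` for `r ≤ r₀` and `0` for `r ≥ 2 r₀`. -/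
def cutoff (Z : ℝ → ℝ) (r₀ : ℝ) : ℝ → ℝ := fun r => Z (r / r₀)

/-- `χ̃ / r` with `χ̃ = χ ζ₁²`. -/
def chiOverR (ζ : ℝ → ℝ) (vr vz : Field) : Field :=
  cut (fun r => ζ r ^ 2 / r) (rot vr vz)

/-- `F̃ / r` with `F̃ = F ζ₁²` and `F = f_{r,z} - f_{z,r}`. -/
def forceOverR (ζ : ℝ → ℝ) (fr fz : Field) : Field :=
  cut (fun r => ζ r ^ 2 / r) (rot fr fz)

/-- `g̃ / √r` with `g̃ = g ζ₁`; used for `g = f_φ` and `g = v_φ`. -/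
def overSqrtR (ζ : ℝ → ℝ) (g : Field) : Field :=
  cut (fun r => ζ r / Real.sqrt r) g

/-- The swirl `u = r v_φ`. -/
def swirl (vφ : Field) : Field := fun r z t => r * vφ r z t

/-- The quantity `A²` over `Ω_ε × (0, t)`; `k` stands for the constant `c(1/r₀)` in it. -/
def Asq (k d₅ d₆ R a t ε : ℝ) (ζ : ℝ → ℝ) (vr vφ vz fr fφ fz : Field) : ℝ≥0∞ :=
  ENNReal.ofReal (k * d₅ ^ 2 * (1 + (1 + d₆) * d₆ ^ 2))
    + normX 2 ε R a (chiOverR ζ vr vz) 0 ^ 2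
    + normXT 2 ε R a t (forceOverR ζ fr fz) ^ 2
    + normXT (20 / 11) ε R a t (overSqrtR ζ fφ) ^ 4
    + normX 4 ε R a (overSqrtR ζ vφ) 0 ^ 4

end AxiNS

end

noncomputable section

namespace AxiNS

/-! Write `ζ = ζ₁`, `u = r v_φ`, and let `g = χ ζ² / r`, `w = v_φ² ζ² / r`, `W = v_r ζ² / r`. The
proof is a loop of three inequalities between `g`, `w` and `W`; smallness of `u` near the axis makes
the product of their constants small enough for the loop to close.

Vorticity (`vorticity_energy`, `vorticity_estimate`). The equation of `χ` is tested with `χ ζ⁴ /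
r²`. The weight cancels the stretching term `v_r χ / r`. The swirl source `2 v_φ v_{φ,z} / r`,
integrated by parts in `z`, becomes the product of `w / r` and `g_z`, so Young's inequality bounds
the dissipation of `g` by `‖w / r‖² / (2ν)` plus data. The force is absorbed by Poincaré's
inequality in `z`, since `g` vanishes at `z = ± a`; this keeps the constants independent of `T`.

Swirl (`swirl_energy`, `swirl_estimate`). The equation of `v_φ` is tested with `v_φ³ ζ⁴ / r²`. This
yields the dissipation `‖∇w‖² + ‖w / r‖²` and one dangerous term, `-(3/2) ∫ u² (W / r²) (w / r) dx`.
With `u² ≤ (4/5) ν²` it costs `(9/5) ν³ ‖W / r²‖² + (ν/5) ‖w / r‖²`.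

Radial velocity (`elliptic_estimate`, `radial_estimate`). `W` solves `W_zz + W_rr + 3 W_r / r = g_z
+` cut-off terms. Multiplying by `W_r` and using Hardy's inequality gives `‖W / r²‖ ≤ ‖g_z‖ / 3` up
to cut-off terms. This needs `W_r = 0` at `r = ε`, hence `v_z = 0` there, which is not among the
slip conditions. It follows from the stream function: `v_r = 0` makes `ψ` vanish on `r = ε`, the
continued `χ` is zero inside, so `ψ` is zero for `r < ε` and its normal derivative vanishes at `r =
ε` (`vz_eq_zero_inner`).

`closing_arith` combines the three estimates, evaluating the swirl energy at the time of its
maximum.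

All terms with `ζ'` live where `r ≥ r₀`, so powers of `1 / r` become powers of `1 / r₀`. With `v_φ =
u / r` and the bound on `u` they reduce to quantities controlled by the energy `d₅²`, except the
convective one, `|v_r| χ²` on the annulus: Hölder's inequality and an `L_{10/3}` bound of `v_r` give
`d₅ ‖χ‖²_{20/7}` (`convective_bound`). The same interpolation inequality, `integral_box_rpow_le`,
treats the azimuthal force. It is uniform in `ε` because it uses only vanishing at `r = R` and the
term `f² / r²` of the dissipation.

Throughout, `1 / r` is replaced by the continuous function `recip ε`, equal to it for `r ≥ ε`, so
that all integrands are continuous and integrability is immediate; the norms are translated only at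
the end. -/

/-! ### Integrals of continuous functions over a box -/

/-- Lebesgue measure on the rectangle `(ε, R) × (-a, a)` of the `(r, z)` plane. -/
def rect (ε R a : ℝ) : Measure (ℝ × ℝ) :=
  (volume.restrict (Ioo ε R)).prod (volume.restrict (Ioo (-a) a))

/-- Lebesgue measure on `(ε, R) × (-a, a) × (0, s)`. -/
def box (ε R a s : ℝ) : Measure ((ℝ × ℝ) × ℝ) := (rect ε R a).prod (volume.restrict (Ioo 0 s))

section Box

variable {ε R a s : ℝ}

lemma rect_eq : rect ε R a = volume.restrict (Ioo ε R ×ˢ Ioo (-a) a) := by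
  rw [rect, Measure.prod_restrict, Measure.volume_eq_prod]

lemma box_eq : box ε R a s = volume.restrict ((Ioo ε R ×ˢ Ioo (-a) a) ×ˢ Ioo 0 s) := by
  rw [box, rect_eq, Measure.prod_restrict, Measure.volume_eq_prod (ℝ × ℝ) ℝ]

instance : SFinite (rect ε R a) := by rw [rect]; infer_instance

lemma integrable_rect {f : ℝ × ℝ → ℝ} (hf : Continuous f) : Integrable f (rect ε R a) := by
  rw [rect_eq]
  exact (hf.continuousOn.integrableOn_compact (isCompact_Icc.prod isCompact_Icc)).mono_set
    (prod_mono Ioo_subset_Icc_self Ioo_subset_Icc_self)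

lemma integrable_box {f : (ℝ × ℝ) × ℝ → ℝ} (hf : Continuous f) : Integrable f (box ε R a s) := by
  rw [box_eq]
  exact (hf.continuousOn.integrableOn_compact
    ((isCompact_Icc.prod isCompact_Icc).prod isCompact_Icc)).mono_set
    (prod_mono (prod_mono Ioo_subset_Icc_self Ioo_subset_Icc_self) Ioo_subset_Icc_self)

lemma ae_rect : ∀ᵐ x ∂rect ε R a, x.1 ∈ Ioo ε R ∧ x.2 ∈ Ioo (-a) a := by
  rw [rect_eq]
  exact ae_restrict_mem (measurableSet_Ioo.prod measurableSet_Ioo)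

lemma ae_box : ∀ᵐ p ∂box ε R a s, p.1.1 ∈ Ioo ε R ∧ p.1.2 ∈ Ioo (-a) a ∧ p.2 ∈ Ioo 0 s := by
  rw [box_eq]
  filter_upwards [ae_restrict_mem ((measurableSet_Ioo.prod measurableSet_Ioo).prod
    measurableSet_Ioo)] with p hp
  exact ⟨hp.1.1, hp.1.2, hp.2⟩

lemma integral_box_mono {f g : (ℝ × ℝ) × ℝ → ℝ} (hf : Continuous f) (hg : Continuous g)
    (h : ∀ r ∈ Ioo ε R, ∀ z ∈ Ioo (-a) a, ∀ t ∈ Ioo 0 s, f ((r, z), t) ≤ g ((r, z), t)) :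
    ∫ p, f p ∂box ε R a s ≤ ∫ p, g p ∂box ε R a s := by
  refine integral_mono_ae (integrable_box hf) (integrable_box hg) ?_
  filter_upwards [ae_box] with p hp using h _ hp.1 _ hp.2.1 _ hp.2.2

lemma integral_box_congr {f g : (ℝ × ℝ) × ℝ → ℝ}
    (h : ∀ r ∈ Ioo ε R, ∀ z ∈ Ioo (-a) a, ∀ t ∈ Ioo 0 s, f ((r, z), t) = g ((r, z), t)) :
    ∫ p, f p ∂box ε R a s = ∫ p, g p ∂box ε R a s := by
  refine integral_congr_ae ?_
  filter_upwards [ae_box] with p hp using h _ hp.1 _ hp.2.1 _ hp.2.2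

lemma integral_box_nonneg {f : (ℝ × ℝ) × ℝ → ℝ}
    (h : ∀ r ∈ Ioo ε R, ∀ z ∈ Ioo (-a) a, ∀ t ∈ Ioo 0 s, 0 ≤ f ((r, z), t)) :
    0 ≤ ∫ p, f p ∂box ε R a s := by
  refine integral_nonneg_of_ae ?_
  filter_upwards [ae_box] with p hp using h _ hp.1 _ hp.2.1 _ hp.2.2

lemma box_mono {s t : ℝ} (h : s ≤ t) : box ε R a s ≤ box ε R a t := by
  rw [box_eq, box_eq]
  exact Measure.restrict_mono (prod_mono le_rfl (Ioo_subset_Ioo_right h)) le_rfl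

lemma integral_box_mono_time {s t : ℝ} (hst : s ≤ t) {f : (ℝ × ℝ) × ℝ → ℝ} (hf : Continuous f)
    (h : ∀ r ∈ Ioo ε R, ∀ z ∈ Ioo (-a) a, ∀ τ ∈ Ioo 0 t, 0 ≤ f ((r, z), τ)) :
    ∫ p, f p ∂box ε R a s ≤ ∫ p, f p ∂box ε R a t := by
  refine integral_mono_measure (box_mono hst) ?_ (integrable_box hf)
  filter_upwards [ae_box] with p hp using h _ hp.1 _ hp.2.1 _ hp.2.2

lemma setIntegral_Ioo_deriv {b c : ℝ} (hbc : b ≤ c) {f f' : ℝ → ℝ}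
    (hf : ∀ x ∈ Icc b c, HasDerivAt f (f' x) x) (hc : Continuous f') :
    ∫ x in Ioo b c, f' x = f c - f b := by
  rw [← integral_Ioc_eq_integral_Ioo, ← intervalIntegral.integral_of_le hbc]
  refine intervalIntegral.integral_eq_sub_of_hasDerivAt (fun x hx => hf x ?_)
    (hc.intervalIntegrable _ _)
  rwa [uIcc_of_le hbc] at hx

/-- One-sided on purpose: the radial flux of the swirl energy has only a sign at the inner wall. The
derivative is asked for on the closed interval alone, because the formulas for `recip ε` are used
for `r ≥ ε` only. -/
lemma integral_box_dr_nonneg (hR : ε ≤ R) {A A' : (ℝ × ℝ) × ℝ → ℝ} (hc : Continuous A')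
    (hA : ∀ r ∈ Icc ε R, ∀ z t, HasDerivAt (fun x => A ((x, z), t)) (A' ((r, z), t)) r)
    (hb : ∀ z ∈ Ioo (-a) a, ∀ t ∈ Ioo 0 s, A ((ε, z), t) ≤ A ((R, z), t)) :
    0 ≤ ∫ p, A' p ∂box ε R a s := by
  have hi : Integrable A' ((rect ε R a).prod (volume.restrict (Ioo 0 s))) := integrable_box hc
  rw [box, integral_prod_symm _ hi]
  refine integral_nonneg_of_ae ?_
  filter_upwards [ae_restrict_mem measurableSet_Ioo] with t ht
  have hi2 : Integrable (fun x => A' (x, t))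
      ((volume.restrict (Ioo ε R)).prod (volume.restrict (Ioo (-a) a))) :=
    integrable_rect (by fun_prop)
  rw [rect, integral_prod_symm _ hi2]
  refine integral_nonneg_of_ae ?_
  filter_upwards [ae_restrict_mem measurableSet_Ioo] with z hz
  rw [setIntegral_Ioo_deriv hR (f := fun x => A ((x, z), t)) (fun x hx => hA x hx z t)
    (by fun_prop)]
  simpa using hb z hz t ht

lemma integral_box_dz_nonneg (ha : 0 ≤ a) {A A' : (ℝ × ℝ) × ℝ → ℝ} (hc : Continuous A')
    (hA : ∀ r z t, HasDerivAt (fun x => A ((r, x), t)) (A' ((r, z), t)) z)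
    (hb : ∀ r ∈ Ioo ε R, ∀ t ∈ Ioo 0 s, A ((r, -a), t) ≤ A ((r, a), t)) :
    0 ≤ ∫ p, A' p ∂box ε R a s := by
  have hi : Integrable A' ((rect ε R a).prod (volume.restrict (Ioo 0 s))) := integrable_box hc
  rw [box, integral_prod_symm _ hi]
  refine integral_nonneg_of_ae ?_
  filter_upwards [ae_restrict_mem measurableSet_Ioo] with t ht
  have hi2 : Integrable (fun x => A' (x, t))
      ((volume.restrict (Ioo ε R)).prod (volume.restrict (Ioo (-a) a))) :=
    integrable_rect (by fun_prop)
  rw [rect, integral_prod _ hi2]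
  refine integral_nonneg_of_ae ?_
  filter_upwards [ae_restrict_mem measurableSet_Ioo] with r hr
  rw [setIntegral_Ioo_deriv (by linarith) (f := fun x => A ((r, x), t)) (fun x _ => hA r x t)
    (by fun_prop)]
  simpa using hb r hr t ht

lemma integral_box_dr_eq_zero (hR : ε ≤ R) {A A' : (ℝ × ℝ) × ℝ → ℝ} (hc : Continuous A')
    (hA : ∀ r ∈ Icc ε R, ∀ z t, HasDerivAt (fun x => A ((x, z), t)) (A' ((r, z), t)) r)
    (hε : ∀ z ∈ Ioo (-a) a, ∀ t ∈ Ioo 0 s, A ((ε, z), t) = 0)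
    (hb : ∀ z ∈ Ioo (-a) a, ∀ t ∈ Ioo 0 s, A ((R, z), t) = 0) :
    ∫ p, A' p ∂box ε R a s = 0 := by
  have h1 := integral_box_dr_nonneg hR hc hA
    (fun z hz t ht => ((hε z hz t ht).trans (hb z hz t ht).symm).le)
  have h2 := integral_box_dr_nonneg (A := fun p => -A p) (A' := fun p => -A' p) (a := a) (s := s)
    hR hc.neg (fun r hr z t => (hA r hr z t).neg)
    (fun z hz t ht => by simp [hε z hz t ht, hb z hz t ht])
  rw [integral_neg] at h2
  linarith

lemma integral_box_dz_eq_zero (ha : 0 ≤ a) {A A' : (ℝ × ℝ) × ℝ → ℝ} (hc : Continuous A')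
    (hA : ∀ r z t, HasDerivAt (fun x => A ((r, x), t)) (A' ((r, z), t)) z)
    (hb : ∀ r ∈ Ioo ε R, ∀ t ∈ Ioo 0 s, A ((r, -a), t) = 0 ∧ A ((r, a), t) = 0) :
    ∫ p, A' p ∂box ε R a s = 0 := by
  have h1 := integral_box_dz_nonneg ha hc hA
    (fun r hr t ht => ((hb r hr t ht).1.trans (hb r hr t ht).2.symm).le)
  have h2 := integral_box_dz_nonneg (A := fun p => -A p) (A' := fun p => -A' p) (ε := ε) (R := R)
    (s := s) ha hc.neg (fun r z t => (hA r z t).neg)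
    (fun r hr t ht => by simp [hb r hr t ht])
  rw [integral_neg] at h2
  linarith

lemma integral_box_dt (hs : 0 ≤ s) {A A' : (ℝ × ℝ) × ℝ → ℝ} (hc : Continuous A')
    (hA0 : Continuous A) (hA : ∀ x t, HasDerivAt (fun τ => A (x, τ)) (A' (x, t)) t) :
    ∫ p, A' p ∂box ε R a s = ∫ x, A (x, s) ∂rect ε R a - ∫ x, A (x, 0) ∂rect ε R a := by
  have hi : Integrable A' ((rect ε R a).prod (volume.restrict (Ioo 0 s))) := integrable_box hc
  rw [box, integral_prod _ hi, ← integral_sub (integrable_rect (by fun_prop))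
    (integrable_rect (by fun_prop))]
  congr 1 with x
  exact setIntegral_Ioo_deriv hs (fun t _ => hA x t) (by fun_prop)

/-- Cauchy-Schwarz through the discriminant of the nonnegative quadratic polynomial `y ↦ ∫ (y f +
g)²`. -/
lemma integral_mul_sq_le {α : Type*} [MeasurableSpace α] {μ : Measure α} {f g : α → ℝ}
    (hf : Integrable (fun x => f x ^ 2) μ) (hg : Integrable (fun x => g x ^ 2) μ)
    (hfg : Integrable (fun x => f x * g x) μ) :
    (∫ x, f x * g x ∂μ) ^ 2 ≤ (∫ x, f x ^ 2 ∂μ) * ∫ x, g x ^ 2 ∂μ := by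
  have h : ∀ y : ℝ, 0 ≤ (∫ x, f x ^ 2 ∂μ) * (y * y) + (2 * ∫ x, f x * g x ∂μ) * y
      + ∫ x, g x ^ 2 ∂μ := by
    intro y
    have : ∫ x, (y * f x + g x) ^ 2 ∂μ = (∫ x, f x ^ 2 ∂μ) * (y * y)
        + (2 * ∫ x, f x * g x ∂μ) * y + ∫ x, g x ^ 2 ∂μ := by
      have e : ∀ x, (y * f x + g x) ^ 2 = (y * y) * f x ^ 2 + (2 * y) * (f x * g x) + g x ^ 2 :=
        fun x => by ring
      have i1 : Integrable (fun x => (y * y) * f x ^ 2) μ := hf.const_mul _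
      have i2 : Integrable (fun x => (2 * y) * (f x * g x)) μ := hfg.const_mul _
      have i3 : Integrable (fun x => (y * y) * f x ^ 2 + (2 * y) * (f x * g x)) μ := i1.add i2
      simp_rw [e]
      rw [integral_add i3 hg, integral_add i1 i2, integral_const_mul, integral_const_mul]
      ring
    rw [← this]
    exact integral_nonneg fun x => sq_nonneg _
  have := discrim_le_zero h
  rw [discrim] at this
  nlinarith

end Box

/-! ### A planar Ladyzhenskaya inequality and its parabolic consequence -/

section Ladyzhenskaya

variable {ε R a s : ℝ}

lemma le_setIntegral_abs_deriv {b c : ℝ} {f f' : ℝ → ℝ}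
    (hf : ∀ x ∈ Icc b c, HasDerivAt f (f' x) x) (hc : Continuous f') {x y : ℝ}
    (hx : x ∈ Icc b c) (hy : y ∈ Icc b c) : f x - f y ≤ ∫ u in Ioo b c, |f' u| := by
  have hint : f x - f y = ∫ u in y..x, f' u :=
    (intervalIntegral.integral_eq_sub_of_hasDerivAt
      (fun u hu => hf u (uIcc_subset_Icc hy hx hu)) (hc.intervalIntegrable _ _)).symm
  rw [hint]
  have hi : IntegrableOn (fun u => |f' u|) (Ioc b c) :=
    (hc.abs.continuousOn.integrableOn_compact isCompact_Icc).mono_set Ioc_subset_Icc_self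
  calc ∫ u in y..x, f' u ≤ |∫ u in y..x, f' u| := le_abs_self _
    _ ≤ |(∫ u in y..x, abs (f' u))| := by
        simpa [Real.norm_eq_abs] using
          intervalIntegral.norm_integral_le_abs_integral_norm (f := f') (a := y) (b := x)
            (μ := volume)
    _ ≤ ∫ u in Ioc b c, |f' u| := by
        rw [intervalIntegral.abs_integral_eq_abs_integral_uIoc, abs_of_nonneg
          (integral_nonneg fun u => abs_nonneg _)]
        refine setIntegral_mono_set hi (Filter.Eventually.of_forall fun u => abs_nonneg _) ?_
        refine (Ioc_subset_Ioc (le_min hy.1 hx.1) (max_le hy.2 hx.2)).eventuallyLE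
    _ = _ := integral_Ioc_eq_integral_Ioo

/-- The square of `g` is bounded by the product of the integrals of the suprema over the two
families of coordinate lines. -/
lemma integral_rect_sq_le (hR : ε ≤ R) (ha : 0 < a) {g gr gz : ℝ × ℝ → ℝ}
    (hg : Continuous g) (hgr : Continuous gr) (hgz : Continuous gz) 
    (h0 : ∀ x, x.1 ∈ Ioo ε R → 0 ≤ g x)
    (hr : ∀ r ∈ Icc ε R, ∀ z, HasDerivAt (fun x => g (x, z)) (gr (r, z)) r)
    (hz : ∀ r z, HasDerivAt (fun x => g (r, x)) (gz (r, z)) z)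
    (hb : ∀ z ∈ Ioo (-a) a, g (R, z) = 0) :
    ∫ x, g x ^ 2 ∂rect ε R a ≤ (∫ x, |gr x| ∂rect ε R a)
      * ∫ x, (1 / (2 * a) * g x + |gz x|) ∂rect ε R a := by
  set A : ℝ → ℝ := fun z => ∫ r in Ioo ε R, |gr (r, z)| with hA
  set B : ℝ → ℝ := fun r => ∫ z in Ioo (-a) a, (1 / (2 * a) * g (r, z) + |gz (r, z)|) with hB
  have iA : Integrable (fun x => |gr x|) (rect ε R a) := integrable_rect (by fun_prop)
  have iB : Integrable (fun x => 1 / (2 * a) * g x + |gz x|) (rect ε R a) :=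
    integrable_rect (by fun_prop)
  have eA : ∫ x, |gr x| ∂rect ε R a = ∫ z in Ioo (-a) a, A z := integral_prod_symm _ iA
  have eB : ∫ x, (1 / (2 * a) * g x + |gz x|) ∂rect ε R a = ∫ r in Ioo ε R, B r :=
    integral_prod _ iB
  -- Integration starts at `r = R`, where `g` vanishes. No information on the wall `r = ε` enters,
  -- so the bound does not see `ε`.
  have hgA : ∀ r ∈ Ioo ε R, ∀ z ∈ Ioo (-a) a, g (r, z) ≤ A z := by
    intro r hr' z hz'
    have := le_setIntegral_abs_deriv (f := fun x => g (x, z)) (fun x hx => hr x hx z)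
      (by fun_prop) (Ioo_subset_Icc_self hr') (right_mem_Icc.2 hR)
    simpa [hb z hz', hA] using this
  -- There is no boundary condition in `z`: the value at `z` is compared with all values on the
  -- segment and averaged, which produces the zeroth-order term with `1 / (2 * a)`.
  have hgB : ∀ r ∈ Ioo ε R, ∀ z ∈ Ioo (-a) a, g (r, z) ≤ B r := by
    intro r _ z hz'
    have ig : IntegrableOn (fun y => g (r, y)) (Ioo (-a) a) :=
      ((show Continuous fun y => g (r, y) by fun_prop).continuousOn.integrableOn_compact
        isCompact_Icc).mono_set Ioo_subset_Icc_self
    have igz : IntegrableOn (fun y => |gz (r, y)|) (Ioo (-a) a) :=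
      ((show Continuous fun y => |gz (r, y)| by fun_prop).continuousOn.integrableOn_compact
        isCompact_Icc).mono_set Ioo_subset_Icc_self
    have hpt : ∀ y ∈ Ioo (-a) a, g (r, z) ≤ g (r, y) + ∫ u in Ioo (-a) a, |gz (r, u)| := by
      intro y hy
      have := le_setIntegral_abs_deriv (f := fun x => g (r, x)) (fun x _ => hz r x)
        (by fun_prop) (Ioo_subset_Icc_self hz') (Ioo_subset_Icc_self hy)
      linarith
    have hvol : (volume.restrict (Ioo (-a) a)).real univ = 2 * a := by
      rw [measureReal_restrict_apply_univ, Real.volume_real_Ioo_of_le (by linarith)]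
      ring
    have := setIntegral_mono_on (μ := volume) (s := Ioo (-a) a) (f := fun _ => g (r, z))
      (g := fun y => g (r, y) + ∫ u in Ioo (-a) a, |gz (r, u)|)
      (integrable_const _) (ig.add (integrable_const _)) measurableSet_Ioo hpt
    rw [integral_const, integral_add ig (integrable_const _), integral_const, hvol,
      smul_eq_mul, smul_eq_mul] at this
    rw [hB]
    simp only
    rw [integral_add (ig.const_mul _) igz, integral_const_mul]
    have h2a : 0 < 2 * a := by linarith
    calc g (r, z) = 1 / (2 * a) * (2 * a * g (r, z)) := by field_simp
      _ ≤ 1 / (2 * a) * ((∫ y in Ioo (-a) a, g (r, y))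
          + 2 * a * ∫ u in Ioo (-a) a, |gz (r, u)|) := by gcongr
      _ = _ := by field_simp
  have iA1 : Integrable A (volume.restrict (Ioo (-a) a)) := iA.integral_prod_right
  have iB1 : Integrable B (volume.restrict (Ioo ε R)) := iB.integral_prod_left
  -- `g² ≤ A(z) B(r)`, and by Fubini the integral of the right-hand side factors.
  rw [eA, eB, mul_comm, ← integral_prod_mul]
  refine integral_mono_ae (integrable_rect (by fun_prop)) (iB1.mul_prod iA1) ?_
  filter_upwards [ae_rect] with x hx
  have h1 := hgA _ hx.1 _ hx.2
  have h2 := hgB _ hx.1 _ hx.2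
  rw [pow_two]
  exact mul_le_mul h2 h1 (h0 _ hx.1) ((h0 _ hx.1).trans h2)

/-- Ladyzhenskaya's inequality with weights. -/
lemma integral_rect_pow_four_le (hε : 0 < ε) (hR : ε ≤ R) (ha : 0 < a) {f fr fz : ℝ × ℝ → ℝ}
    {q : ℝ → ℝ} (hq : Continuous q) (hq1 : ∀ r ∈ Icc ε R, q r * r = 1)
    (hf : Continuous f) (hfr : Continuous fr) (hfz : Continuous fz)
    (hr : ∀ r ∈ Icc ε R, ∀ z, HasDerivAt (fun x => f (x, z)) (fr (r, z)) r)
    (hz : ∀ r z, HasDerivAt (fun x => f (r, x)) (fz (r, z)) z)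
    (hb : ∀ z ∈ Ioo (-a) a, f (R, z) = 0) :
    ∫ x, f x ^ 4 * x.1 ^ 2 ∂rect ε R a ≤ (∫ x, f x ^ 2 * x.1 ∂rect ε R a)
      * (3 * (5 + R / (2 * a)) ^ 2
        * ∫ x, (fr x ^ 2 + fz x ^ 2 + f x ^ 2 * q x.1 ^ 2) * x.1 ∂rect ε R a) := by
  have hR0 : 0 < R := hε.trans_le hR
  -- One constant for both directions: the radial integrand needs the coefficients `2` and `1`, the
  -- vertical one `2` and `R / (2a)`.
  set c : ℝ := 5 + R / (2 * a) with hc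
  have hRa : 0 < R / (2 * a) := by positivity
  have hc0 : 0 < c := by positivity
  set w : ℝ → ℝ := fun r => Real.sqrt |r| with hw
  have hw2 : ∀ r, 0 < r → w r ^ 2 = r := fun r hr => by
    rw [hw]; simp only; rw [Real.sq_sqrt (abs_nonneg _), abs_of_pos hr]
  have hwc : Continuous w := by fun_prop
  set e : ℝ × ℝ → ℝ := fun x => c * (|fr x| + |fz x| + |f x| * |q x.1|) with he
  have hec : Continuous e := by fun_prop
  have he0 : ∀ x, 0 ≤ e x := fun x => by positivity
  -- The choice `g = f² r` gives `g_r = 2 f f_r r + f²`. The extra `f²` is `|f| (|f| / r) r`, which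
  -- is why `f² / r²` appears in the dissipation.
  have key := integral_rect_sq_le (ε := ε) (R := R) (a := a) (g := fun x => f x ^ 2 * x.1)
    (gr := fun x => 2 * f x * fr x * x.1 + f x ^ 2) (gz := fun x => 2 * f x * fz x * x.1)
    hR ha (by fun_prop) (by fun_prop) (by fun_prop)
    (fun x hx => mul_nonneg (sq_nonneg _) (hε.le.trans hx.1.le))
    (fun r hr' z => by
      refine (((hr r hr' z).fun_pow 2).fun_mul (hasDerivAt_id' r)).congr_deriv ?_
      simp only [Nat.cast_ofNat, Nat.add_one_sub_one, pow_one]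
      ring)
    (fun r z => by
      refine (((hz r z).fun_pow 2).mul_const r).congr_deriv ?_
      simp only [Nat.cast_ofNat, Nat.add_one_sub_one, pow_one])
    (fun z hz' => by simp [hb z hz'])
  have i1 : Integrable (fun x : ℝ × ℝ => |f x| * e x * x.1) (rect ε R a) :=
    integrable_rect (by fun_prop)
  have b1 : ∫ x, |2 * f x * fr x * x.1 + f x ^ 2| ∂rect ε R a
      ≤ ∫ x, |f x| * e x * x.1 ∂rect ε R a := by
    refine integral_mono_ae (integrable_rect (by fun_prop)) i1 ?_
    filter_upwards [ae_rect] with x hx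
    have hx0 : 0 < x.1 := hε.trans hx.1.1
    have hq' : |q x.1| * x.1 = 1 := by
      have := congrArg abs (hq1 _ (Ioo_subset_Icc_self hx.1))
      rwa [abs_mul, abs_of_pos hx0, abs_one] at this
    have e1 : |f x| * |f x| = f x ^ 2 := by rw [← abs_mul, ← pow_two, abs_of_nonneg (sq_nonneg _)]
    calc |2 * f x * fr x * x.1 + f x ^ 2| ≤ |2 * f x * fr x * x.1| + |f x ^ 2| := abs_add_le _ _
      _ = 2 * |f x| * |fr x| * x.1 + |f x| * |f x| * (|q x.1| * x.1) := by
        rw [hq', e1, abs_mul, abs_mul, abs_mul, abs_of_pos hx0, abs_of_nonneg (sq_nonneg (f x)),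
          abs_two, mul_one]
      _ = |f x| * (2 * |fr x| + 1 * (|f x| * |q x.1|)) * x.1 := by ring
      _ ≤ |f x| * e x * x.1 := by
        gcongr
        rw [he]
        nlinarith [abs_nonneg (fr x), abs_nonneg (fz x),
          mul_nonneg (abs_nonneg (f x)) (abs_nonneg (q x.1))]
  have b2 : ∫ x, (1 / (2 * a) * (f x ^ 2 * x.1) + |2 * f x * fz x * x.1|) ∂rect ε R a
      ≤ ∫ x, |f x| * e x * x.1 ∂rect ε R a := by
    refine integral_mono_ae (integrable_rect (by fun_prop)) i1 ?_
    filter_upwards [ae_rect] with x hx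
    have hx0 : 0 < x.1 := hε.trans hx.1.1
    have hq' : |q x.1| * x.1 = 1 := by
      have := congrArg abs (hq1 _ (Ioo_subset_Icc_self hx.1))
      rwa [abs_mul, abs_of_pos hx0, abs_one] at this
    have e1 : |f x| * |f x| = f x ^ 2 := by rw [← abs_mul, ← pow_two, abs_of_nonneg (sq_nonneg _)]
    calc 1 / (2 * a) * (f x ^ 2 * x.1) + |2 * f x * fz x * x.1|
        = |f x| * (2 * |fz x| + x.1 / (2 * a) * (|f x| * (|q x.1| * x.1)) / x.1) * x.1 := by
          rw [hq', ← e1, abs_mul, abs_mul, abs_mul, abs_of_pos hx0, abs_two]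
          field_simp
          ring
      _ = |f x| * (2 * |fz x| + x.1 / (2 * a) * (|f x| * |q x.1|)) * x.1 := by
          field_simp
      _ ≤ |f x| * (2 * |fz x| + R / (2 * a) * (|f x| * |q x.1|)) * x.1 := by
          gcongr
          exact hx.1.2.le
      _ ≤ |f x| * e x * x.1 := by
        gcongr
        rw [he]
        nlinarith [abs_nonneg (fr x), abs_nonneg (fz x),
          mul_nonneg (abs_nonneg (f x)) (abs_nonneg (q x.1))]
  have b3 : ∫ x, |f x| * e x * x.1 ∂rect ε R a
      = ∫ x, (|f x| * w x.1) * (e x * w x.1) ∂rect ε R a := by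
    refine integral_congr_ae ?_
    filter_upwards [ae_rect] with x hx
    have := hw2 x.1 (hε.trans hx.1.1)
    calc |f x| * e x * x.1 = |f x| * e x * w x.1 ^ 2 := by rw [this]
      _ = _ := by ring
  have b4 := integral_mul_sq_le (μ := rect ε R a) (f := fun x => |f x| * w x.1)
    (g := fun x => e x * w x.1) (integrable_rect (by fun_prop)) (integrable_rect (by fun_prop))
    (integrable_rect (by fun_prop))
  have b5 : ∫ x, (|f x| * w x.1) ^ 2 ∂rect ε R a = ∫ x, f x ^ 2 * x.1 ∂rect ε R a := by
    refine integral_congr_ae ?_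
    filter_upwards [ae_rect] with x hx
    rw [mul_pow, hw2 x.1 (hε.trans hx.1.1), sq_abs]
  have b6 : ∫ x, (e x * w x.1) ^ 2 ∂rect ε R a ≤ 3 * c ^ 2
      * ∫ x, (fr x ^ 2 + fz x ^ 2 + f x ^ 2 * q x.1 ^ 2) * x.1 ∂rect ε R a := by
    rw [← integral_const_mul]
    refine integral_mono_ae (integrable_rect (by fun_prop)) (integrable_rect (by fun_prop)) ?_
    filter_upwards [ae_rect] with x hx
    have hx0 : 0 < x.1 := hε.trans hx.1.1
    rw [mul_pow, hw2 x.1 hx0, he]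
    simp only
    rw [mul_pow, ← mul_assoc, mul_assoc (3 : ℝ), mul_left_comm]
    have : (|fr x| + |fz x| + |f x| * |q x.1|) ^ 2
        ≤ 3 * (fr x ^ 2 + fz x ^ 2 + f x ^ 2 * q x.1 ^ 2) := by
      rw [← sq_abs (fr x), ← sq_abs (fz x), ← sq_abs (f x), ← sq_abs (q x.1)]
      nlinarith [sq_nonneg (|fr x| - |fz x|), sq_nonneg (|fr x| - |f x| * |q x.1|),
        sq_nonneg (|fz x| - |f x| * |q x.1|)]
    exact mul_le_mul_of_nonneg_right (mul_le_mul_of_nonneg_left this (by positivity)) hx0.le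
  have b0 : 0 ≤ ∫ x, |f x| * e x * x.1 ∂rect ε R a := by
    refine integral_nonneg_of_ae ?_
    filter_upwards [ae_rect] with x hx
    have hx0 : 0 < x.1 := hε.trans hx.1.1
    exact mul_nonneg (mul_nonneg (abs_nonneg _) (he0 x)) hx0.le
  have b7 : 0 ≤ ∫ x, f x ^ 2 * x.1 ∂rect ε R a := by
    rw [← b5]
    exact integral_nonneg fun x => sq_nonneg _
  calc ∫ x, f x ^ 4 * x.1 ^ 2 ∂rect ε R a = ∫ x, (f x ^ 2 * x.1) ^ 2 ∂rect ε R a := by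
        congr 1 with x
        ring
    _ ≤ _ := key
    _ ≤ (∫ x, |f x| * e x * x.1 ∂rect ε R a) * ∫ x, |f x| * e x * x.1 ∂rect ε R a := by
        refine mul_le_mul b1 b2 ?_ b0
        refine integral_nonneg_of_ae ?_
        filter_upwards [ae_rect] with x hx
        have hx0 : 0 < x.1 := hε.trans hx.1.1
        simp only [Pi.zero_apply]
        positivity
    _ = (∫ x, (|f x| * w x.1) * (e x * w x.1) ∂rect ε R a) ^ 2 := by rw [b3, pow_two]
    _ ≤ _ := b4
    _ ≤ _ := by
        rw [b5]
        exact mul_le_mul_of_nonneg_left b6 b7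

end Ladyzhenskaya

/-! ### Hölder's inequality with the weight `r` and space-time interpolation -/

section Hoelder

variable {ε R a s : ℝ}

instance : IsFiniteMeasure (box ε R a s) := by
  rw [box_eq]
  exact isFiniteMeasure_restrict.2 ((measure_mono (prod_mono (prod_mono Ioo_subset_Icc_self
    Ioo_subset_Icc_self) Ioo_subset_Icc_self)).trans_lt
    ((isCompact_Icc.prod isCompact_Icc).prod isCompact_Icc).measure_lt_top).ne

lemma memLp_box {f : (ℝ × ℝ) × ℝ → ℝ} (hf : Continuous f) (p : ℝ≥0∞) :
    MemLp f p (box ε R a s) := by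
  obtain ⟨C, hC⟩ := ((isCompact_Icc.prod isCompact_Icc).prod
    isCompact_Icc).exists_bound_of_continuousOn (s := (Icc ε R ×ˢ Icc (-a) a) ×ˢ Icc 0 s)
    hf.continuousOn
  refine MemLp.of_bound hf.aestronglyMeasurable C ?_
  filter_upwards [ae_box] with p hp
  exact hC p ⟨⟨Ioo_subset_Icc_self hp.1, Ioo_subset_Icc_self hp.2.1⟩, Ioo_subset_Icc_self hp.2.2⟩

/-- Hölder's inequality with respect to the measure `r dr dz dt`. -/
lemma integral_box_mul_le {p q : ℝ} (hpq : p.HolderConjugate q) (hε : 0 < ε)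
    {f g : (ℝ × ℝ) × ℝ → ℝ} (hf : Continuous f) (hg : Continuous g) (hf0 : ∀ x, 0 ≤ f x)
    (hg0 : ∀ x, 0 ≤ g x) :
    ∫ x, f x * g x * x.1.1 ∂box ε R a s ≤ (∫ x, f x ^ p * x.1.1 ∂box ε R a s) ^ (1 / p)
      * (∫ x, g x ^ q * x.1.1 ∂box ε R a s) ^ (1 / q) := by
  have hp := hpq.pos
  have hq := hpq.symm.pos
  have c1 : Continuous fun x : (ℝ × ℝ) × ℝ => f x * |x.1.1| ^ (1 / p) :=
    hf.mul ((by fun_prop : Continuous fun x : (ℝ × ℝ) × ℝ => |x.1.1|).rpow_const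
      fun x => Or.inr (by positivity))
  have c2 : Continuous fun x : (ℝ × ℝ) × ℝ => g x * |x.1.1| ^ (1 / q) :=
    hg.mul ((by fun_prop : Continuous fun x : (ℝ × ℝ) × ℝ => |x.1.1|).rpow_const
      fun x => Or.inr (by positivity))
  have key := integral_mul_le_Lp_mul_Lq_of_nonneg hpq (μ := box ε R a s)
    (f := fun x : (ℝ × ℝ) × ℝ => f x * |x.1.1| ^ (1 / p))
    (g := fun x : (ℝ × ℝ) × ℝ => g x * |x.1.1| ^ (1 / q))
    (Filter.Eventually.of_forall fun x => mul_nonneg (hf0 x) (by positivity))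
    (Filter.Eventually.of_forall fun x => mul_nonneg (hg0 x) (by positivity))
    (memLp_box c1 _) (memLp_box c2 _)
  have e1 : ∀ (r : ℝ), 0 < r → r ^ (1 / p) * r ^ (1 / q) = r := fun r hr => by
    rw [← Real.rpow_add hr, one_div, one_div, hpq.inv_add_inv_eq_one, Real.rpow_one]
  have e2 : ∫ x, f x * g x * x.1.1 ∂box ε R a s
      = ∫ x, f x * |x.1.1| ^ (1 / p) * (g x * |x.1.1| ^ (1 / q)) ∂box ε R a s := by
    refine integral_box_congr fun r hr z _ t _ => ?_
    have hr0 := hε.trans hr.1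
    simp only [abs_of_pos hr0]
    calc _ = f ((r, z), t) * g ((r, z), t) * (r ^ (1 / p) * r ^ (1 / q)) := by rw [e1 r hr0]
      _ = _ := by ring
  have e3 : ∀ (k : ℝ) (h : (ℝ × ℝ) × ℝ → ℝ), 0 < k → (∀ x, 0 ≤ h x) →
      ∫ x, (h x * |x.1.1| ^ (1 / k)) ^ k ∂box ε R a s = ∫ x, h x ^ k * x.1.1 ∂box ε R a s := by
    intro k h hk hh
    refine integral_box_congr fun r hr z _ t _ => ?_
    have hr0 := hε.trans hr.1
    simp only [abs_of_pos hr0]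
    rw [Real.mul_rpow (hh _) (by positivity), ← Real.rpow_mul hr0.le, one_div_mul_cancel hk.ne',
      Real.rpow_one]
  rw [e3 p f hp hf0, e3 q g hq hg0, ← e2] at key
  exact key

/-- A parabolic interpolation inequality, uniform in the distance `ε` to the axis and in time. -/
lemma integral_box_rpow_le (hε : 0 < ε) (hR : ε ≤ R) (ha : 0 < a)
    {f fr fz : (ℝ × ℝ) × ℝ → ℝ} {q : ℝ → ℝ} (hq : Continuous q)
    (hq1 : ∀ r ∈ Icc ε R, q r * r = 1)
    (hf : Continuous f) (hfr : Continuous fr) (hfz : Continuous fz)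
    (hr : ∀ r ∈ Icc ε R, ∀ z t, HasDerivAt (fun x => f ((x, z), t)) (fr ((r, z), t)) r)
    (hz : ∀ r z t, HasDerivAt (fun x => f ((r, x), t)) (fz ((r, z), t)) z)
    (hb : ∀ z ∈ Ioo (-a) a, ∀ t ∈ Ioo 0 s, f ((R, z), t) = 0) {H : ℝ} (hH0 : 0 ≤ H)
    (hH : ∀ᵐ t ∂volume.restrict (Ioo 0 s), ∫ x, f (x, t) ^ 2 * x.1 ∂rect ε R a ≤ H) :
    ∫ x, |f x| ^ (10 / 3 : ℝ) * x.1.1 ∂box ε R a s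
      ≤ (3 * (5 + R / (2 * a)) ^ 2) ^ (2 / 3 : ℝ) * H ^ (2 / 3 : ℝ)
        * ∫ x, (fr x ^ 2 + fz x ^ 2 + f x ^ 2 * q x.1.1 ^ 2) * x.1.1 ∂box ε R a s := by
  have hR0 : 0 < R := hε.trans_le hR
  set C := 3 * (5 + R / (2 * a)) ^ 2 with hC
  have hC0 : 0 ≤ C := by positivity
  set W : (ℝ × ℝ) × ℝ → ℝ :=
    fun x => (fr x ^ 2 + fz x ^ 2 + f x ^ 2 * q x.1.1 ^ 2) * x.1.1 with hW
  have hWc : Continuous W := by fun_prop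
  have hE0 : 0 ≤ ∫ x, W x ∂box ε R a s := integral_box_nonneg fun r hr z _ t _ => by
    have := hε.trans hr.1
    simp only [hW]
    positivity
  -- Ladyzhenskaya's inequality on each time slice; the energy of the slice is replaced by its bound
  -- `H` before integrating in time.
  have h4 : ∫ x, f x ^ 4 * x.1.1 ^ 2 ∂box ε R a s ≤ H * (C * ∫ x, W x ∂box ε R a s) := by
    have i1 : Integrable (fun x => f x ^ 4 * x.1.1 ^ 2)
      ((rect ε R a).prod (volume.restrict (Ioo 0 s))) := integrable_box (by fun_prop)
    have i2 : Integrable W ((rect ε R a).prod (volume.restrict (Ioo 0 s))) := integrable_box hWc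
    rw [box, integral_prod_symm _ i1, integral_prod_symm _ i2, ← integral_const_mul,
      ← integral_const_mul]
    refine integral_mono_ae i1.integral_prod_right
      ((i2.integral_prod_right.const_mul _).const_mul _) ?_
    filter_upwards [hH, ae_restrict_mem measurableSet_Ioo] with t hHt ht
    have := integral_rect_pow_four_le (f := fun x => f (x, t)) (fr := fun x => fr (x, t))
      (fz := fun x => fz (x, t)) hε hR ha hq hq1 (by fun_prop) (by fun_prop) (by fun_prop)
      (fun r hr' z => hr r hr' z t) (fun r z => hz r z t) (fun z hz' => hb z hz' t ht)
    refine this.trans (mul_le_mul_of_nonneg_right hHt ?_)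
    refine mul_nonneg hC0 (integral_nonneg_of_ae ?_)
    filter_upwards [ae_rect] with x hx
    have hx0 : 0 < x.1 := hε.trans hx.1.1
    simp only [Pi.zero_apply]
    positivity
  have h2 : ∫ x, (f x ^ 2 * q x.1.1 ^ 2) * x.1.1 ∂box ε R a s ≤ ∫ x, W x ∂box ε R a s := by
    refine integral_box_mono (by fun_prop) hWc fun r hr z _ t _ => ?_
    have := hε.trans hr.1
    simp only [hW]
    gcongr
    nlinarith [sq_nonneg (fr ((r, z), t)), sq_nonneg (fz ((r, z), t))]
  have c1 : Continuous fun x : (ℝ × ℝ) × ℝ => (f x ^ 2 * q x.1.1 ^ 2) ^ (1 / 3 : ℝ) :=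
    (by fun_prop : Continuous fun x : (ℝ × ℝ) × ℝ => f x ^ 2 * q x.1.1 ^ 2).rpow_const
      fun x => Or.inr (by norm_num)
  have c2 : Continuous fun x : (ℝ × ℝ) × ℝ => (f x ^ 4 * |x.1.1|) ^ (2 / 3 : ℝ) :=
    (by fun_prop : Continuous fun x : (ℝ × ℝ) × ℝ => f x ^ 4 * |x.1.1|).rpow_const
      fun x => Or.inr (by norm_num)
  have hol := integral_box_mul_le (ε := ε) (R := R) (a := a) (s := s) (p := 3) (q := 3 / 2)
    (Real.holderConjugate_iff.2 ⟨by norm_num, by norm_num⟩) hε c1 c2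
    (fun x => by positivity) (fun x => by positivity)
  -- Pointwise `|f|^(10/3) = (f² / r²)^(1/3) (f⁴ r)^(2/3)`: the powers of `r` cancel, so nothing is
  -- lost near the axis. Hölder's inequality with exponents `3` and `3/2` then meets exactly `h2`
  -- and `h4`.
  have e0 : ∫ x, |f x| ^ (10 / 3 : ℝ) * x.1.1 ∂box ε R a s
      = ∫ x, (f x ^ 2 * q x.1.1 ^ 2) ^ (1 / 3 : ℝ) * (f x ^ 4 * |x.1.1|) ^ (2 / 3 : ℝ) * x.1.1
        ∂box ε R a s := by
    refine integral_box_congr fun r hr z _ t _ => ?_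
    have hr0 := hε.trans hr.1
    have hqr := hq1 r (Ioo_subset_Icc_self hr)
    simp only [abs_of_pos hr0]
    congr 1
    generalize f ((r, z), t) = y
    have hq0 : 0 < q r := by
      by_contra hcon
      nlinarith
    have hqr' : q r ^ (2 / 3 : ℝ) * r ^ (2 / 3 : ℝ) = 1 := by
      rw [← Real.mul_rpow hq0.le hr0.le, hqr, Real.one_rpow]
    rw [← sq_abs y, show y ^ 4 = |y| ^ 4 by rw [← abs_pow, abs_of_nonneg (by positivity)],
      Real.mul_rpow (by positivity) (by positivity), Real.mul_rpow (by positivity) (by positivity)]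
    have p1 : ∀ (x : ℝ) (n : ℕ) (k : ℝ), 0 ≤ x → (x ^ n) ^ k = x ^ (n * k : ℝ) := fun x n k hx => by
      rw [Real.rpow_mul hx, Real.rpow_natCast]
    rw [p1 _ _ _ (abs_nonneg y), p1 _ _ _ (abs_nonneg y), p1 _ _ _ hq0.le]
    calc |y| ^ (10 / 3 : ℝ) = |y| ^ (((2 : ℕ) : ℝ) * (1 / 3)) * |y| ^ (((4 : ℕ) : ℝ) * (2 / 3))
        * (q r ^ (2 / 3 : ℝ) * r ^ (2 / 3 : ℝ)) := by
          rw [hqr', mul_one, ← Real.rpow_add_of_nonneg (abs_nonneg y) (by norm_num) (by norm_num)]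
          norm_num
      _ = _ := by
          rw [show (((2 : ℕ) : ℝ) * (1 / 3)) = 2 / 3 by norm_num]
          ring
  have e1 : ∫ x, ((f x ^ 2 * q x.1.1 ^ 2) ^ (1 / 3 : ℝ)) ^ (3 : ℝ) * x.1.1 ∂box ε R a s
      = ∫ x, (f x ^ 2 * q x.1.1 ^ 2) * x.1.1 ∂box ε R a s := by
    refine integral_congr_ae (Filter.Eventually.of_forall fun x => ?_)
    simp only
    rw [← Real.rpow_mul (by positivity)]
    norm_num
  have e2 : ∫ x, ((f x ^ 4 * |x.1.1|) ^ (2 / 3 : ℝ)) ^ (3 / 2 : ℝ) * x.1.1 ∂box ε R a s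
      = ∫ x, f x ^ 4 * x.1.1 ^ 2 ∂box ε R a s := by
    refine integral_box_congr fun r hr z _ t _ => ?_
    have hr0 := hε.trans hr.1
    simp only [abs_of_pos hr0]
    rw [← Real.rpow_mul (by positivity)]
    norm_num
    ring
  rw [e0]
  refine hol.trans ?_
  rw [e1, e2]
  have n2 : 0 ≤ ∫ x, (f x ^ 2 * q x.1.1 ^ 2) * x.1.1 ∂box ε R a s :=
    integral_box_nonneg fun r hr z _ t _ => by
      have := hε.trans hr.1
      positivity
  have n4 : 0 ≤ ∫ x, f x ^ 4 * x.1.1 ^ 2 ∂box ε R a s :=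
    integral_box_nonneg fun r hr z _ t _ => by positivity
  calc _ ≤ (∫ x, W x ∂box ε R a s) ^ (1 / 3 : ℝ)
        * (H * (C * ∫ x, W x ∂box ε R a s)) ^ (1 / (3 / 2) : ℝ) := by gcongr
    _ = C ^ (2 / 3 : ℝ) * H ^ (2 / 3 : ℝ) * ((∫ x, W x ∂box ε R a s) ^ (1 / 3 : ℝ)
        * (∫ x, W x ∂box ε R a s) ^ (2 / 3 : ℝ)) := by
        rw [Real.mul_rpow hH0 (by positivity), Real.mul_rpow hC0 hE0]
        norm_num
        ring
    _ = _ := by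
        rw [← Real.rpow_add_of_nonneg hE0 (by norm_num) (by norm_num)]
        norm_num

end Hoelder

/-! ### The norms as integrals of continuous functions over boxes -/

section Norms

variable {r₁ r₂ a s : ℝ}

lemma cylMeasure_eq : cylMeasure r₁ r₂ a
    = (rect r₁ r₂ a).withDensity fun x => ENNReal.ofReal (2 * Real.pi * x.1) := by
  rw [cylMeasure, rect_eq]

lemma cylTimeMeasure_eq : cylTimeMeasure r₁ r₂ a s
    = (box r₁ r₂ a s).withDensity fun x => ENNReal.ofReal (2 * Real.pi * x.1.1) := by
  rw [cylTimeMeasure, cylMeasure_eq, prod_withDensity_left (by fun_prop), box]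

/-- `h` is the continuous substitute for a field `g` that contains quotients by `r`; agreement
almost everywhere is enough for the norm. -/
lemma eLpNorm_withDensity_eq {α : Type*} [MeasurableSpace α] {μ : Measure α} {w g h : α → ℝ}
    {p : ℝ≥0∞} {q : ℝ} (hq : p.toReal = q) (hq0 : 0 < q) (hw : Measurable w)
    (hw0 : ∀ᵐ x ∂μ, 0 ≤ w x) (hgh : g =ᵐ[μ] h)
    (hi : Integrable (fun x => |h x| ^ q * w x) μ) :
    eLpNorm g p (μ.withDensity fun x => ENNReal.ofReal (2 * Real.pi * w x))
      = ENNReal.ofReal ((2 * Real.pi * ∫ x, |h x| ^ q * w x ∂μ) ^ (1 / q)) := by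
  have hp := ENNReal.toReal_pos_iff.1 (hq ▸ hq0)
  have h0 : ∀ᵐ x ∂μ, 0 ≤ 2 * Real.pi * (|h x| ^ q * w x) := by
    filter_upwards [hw0] with x hx
    have := Real.pi_pos
    positivity
  rw [eLpNorm_congr_ae ((withDensity_absolutelyContinuous μ _).ae_eq hgh),
    eLpNorm_eq_lintegral_rpow_enorm_toReal hp.1.ne' hp.2.ne,
    lintegral_withDensity_eq_lintegral_mul_non_measurable _ (by fun_prop)
      (Filter.Eventually.of_forall fun x => ENNReal.ofReal_lt_top), hq, ← integral_const_mul,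
    ← ENNReal.ofReal_rpow_of_nonneg (integral_nonneg_of_ae h0) (by positivity),
    ofReal_integral_eq_lintegral_ofReal (hi.const_mul _) h0]
  congr 1
  refine lintegral_congr_ae ?_
  filter_upwards [hw0] with x hx
  have h2 : (0 : ℝ) ≤ 2 * Real.pi * w x := by
    have := Real.pi_pos
    positivity
  rw [Pi.mul_apply, Real.enorm_eq_ofReal_abs, ENNReal.ofReal_rpow_of_nonneg (abs_nonneg _) hq0.le,
    ← ENNReal.ofReal_mul h2]
  congr 1
  ring

lemma normXT_eq (h₁ : 0 < r₁) {p : ℝ≥0∞} {q : ℝ} (hq : p.toReal = q) (hq0 : 0 < q) {g : Field}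
    {G : (ℝ × ℝ) × ℝ → ℝ} (hG : Continuous G)
    (h : ∀ r ∈ Ioo r₁ r₂, ∀ z ∈ Ioo (-a) a, ∀ t ∈ Ioo 0 s, g r z t = G ((r, z), t)) :
    normXT p r₁ r₂ a s g
      = ENNReal.ofReal ((2 * Real.pi * ∫ x, |G x| ^ q * x.1.1 ∂box r₁ r₂ a s) ^ (1 / q)) := by
  rw [normXT, cylTimeMeasure_eq]
  have hi : Integrable (fun x => |G x| ^ q * x.1.1) (box r₁ r₂ a s) :=
    integrable_box ((hG.abs.rpow_const fun x => Or.inr hq0.le).mul (by fun_prop))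
  refine eLpNorm_withDensity_eq (w := fun x : (ℝ × ℝ) × ℝ => x.1.1) (h := G) hq hq0
    (by fun_prop) ?_ ?_ hi
  · filter_upwards [ae_box] with x hx using (h₁.trans hx.1.1).le
  · filter_upwards [ae_box] with x hx using h _ hx.1 _ hx.2.1 _ hx.2.2

lemma normX_eq (h₁ : 0 < r₁) {p : ℝ≥0∞} {q : ℝ} (hq : p.toReal = q) (hq0 : 0 < q) {g : Field}
    {G : ℝ × ℝ → ℝ} (hG : Continuous G)
    (h : ∀ r ∈ Ioo r₁ r₂, ∀ z ∈ Ioo (-a) a, g r z s = G (r, z)) :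
    normX p r₁ r₂ a g s
      = ENNReal.ofReal ((2 * Real.pi * ∫ x, |G x| ^ q * x.1 ∂rect r₁ r₂ a) ^ (1 / q)) := by
  rw [normX, cylMeasure_eq]
  have hi : Integrable (fun x => |G x| ^ q * x.1) (rect r₁ r₂ a) :=
    integrable_rect ((hG.abs.rpow_const fun x => Or.inr hq0.le).mul (by fun_prop))
  refine eLpNorm_withDensity_eq (w := fun x : ℝ × ℝ => x.1) (h := G) hq hq0
    (by fun_prop) ?_ ?_ hi
  · filter_upwards [ae_rect] with x hx using (h₁.trans hx.1.1).le
  · filter_upwards [ae_rect] with x hx using h _ hx.1 _ hx.2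

lemma integral_box_weight_nonneg (h₁ : 0 < r₁) {f : (ℝ × ℝ) × ℝ → ℝ} (hf : ∀ x, 0 ≤ f x) :
    0 ≤ ∫ x, f x * x.1.1 ∂box r₁ r₂ a s :=
  integral_box_nonneg fun _ hr _ _ _ _ => mul_nonneg (hf _) (h₁.trans hr.1).le

lemma integral_rect_weight_nonneg (h₁ : 0 < r₁) {f : ℝ × ℝ → ℝ} (hf : ∀ x, 0 ≤ f x) :
    0 ≤ ∫ x, f x * x.1 ∂rect r₁ r₂ a := by
  refine integral_nonneg_of_ae ?_
  filter_upwards [ae_rect] with x hx using mul_nonneg (hf _) (h₁.trans hx.1.1).le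

lemma sq_rpow_half {x : ℝ} (hx : 0 ≤ x) : (x ^ (1 / 2 : ℝ)) ^ 2 = x := by
  rw [← Real.rpow_natCast, ← Real.rpow_mul hx]
  norm_num

lemma normXT_two_sq (h₁ : 0 < r₁) {g : Field}
    {G : (ℝ × ℝ) × ℝ → ℝ} (hG : Continuous G)
    (h : ∀ r ∈ Ioo r₁ r₂, ∀ z ∈ Ioo (-a) a, ∀ t ∈ Ioo 0 s, g r z t = G ((r, z), t)) :
    normXT 2 r₁ r₂ a s g ^ 2
      = ENNReal.ofReal (2 * Real.pi * ∫ x, G x ^ 2 * x.1.1 ∂box r₁ r₂ a s) := by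
  have h0 : 0 ≤ 2 * Real.pi * ∫ x, G x ^ 2 * x.1.1 ∂box r₁ r₂ a s :=
    mul_nonneg (by positivity) (integral_box_weight_nonneg h₁ fun x => sq_nonneg _)
  rw [normXT_eq h₁ (q := 2) (by simp) (by norm_num) hG h]
  simp only [Real.rpow_two, sq_abs]
  rw [← ENNReal.ofReal_pow (by positivity), sq_rpow_half h0]

lemma normX_two_sq (h₁ : 0 < r₁) {g : Field}
    {G : ℝ × ℝ → ℝ} (hG : Continuous G)
    (h : ∀ r ∈ Ioo r₁ r₂, ∀ z ∈ Ioo (-a) a, g r z s = G (r, z)) :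
    normX 2 r₁ r₂ a g s ^ 2
      = ENNReal.ofReal (2 * Real.pi * ∫ x, G x ^ 2 * x.1 ∂rect r₁ r₂ a) := by
  have h0 : 0 ≤ 2 * Real.pi * ∫ x, G x ^ 2 * x.1 ∂rect r₁ r₂ a :=
    mul_nonneg (by positivity) (integral_rect_weight_nonneg h₁ fun x => sq_nonneg _)
  rw [normX_eq h₁ (q := 2) (by simp) (by norm_num) hG h]
  simp only [Real.rpow_two, sq_abs]
  rw [← ENNReal.ofReal_pow (by positivity), sq_rpow_half h0]

/-- The part of the box where `G > d` is open and null, hence empty. -/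
lemma forall_le_of_ae_box {d : ℝ} {G : (ℝ × ℝ) × ℝ → ℝ} (hG : Continuous G)
    (h : ∀ᵐ x ∂box r₁ r₂ a s, G x ≤ d) :
    ∀ r ∈ Ioo r₁ r₂, ∀ z ∈ Ioo (-a) a, ∀ t ∈ Ioo 0 s, G ((r, z), t) ≤ d := by
  intro r hr z hz t ht
  by_contra hcon
  set U : Set ((ℝ × ℝ) × ℝ) := (Ioo r₁ r₂ ×ˢ Ioo (-a) a) ×ˢ Ioo 0 s ∩ {x | d < G x} with hU
  have hUo : IsOpen U := ((isOpen_Ioo.prod isOpen_Ioo).prod isOpen_Ioo).inter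
    (isOpen_lt continuous_const hG)
  have hU0 : volume U = 0 := by
    rw [box_eq, ae_restrict_iff' ((measurableSet_Ioo.prod measurableSet_Ioo).prod
      measurableSet_Ioo)] at h
    refine measure_mono_null (fun x hx => ?_) h
    simp only [mem_compl_iff, mem_ofPred_eq, not_forall]
    exact ⟨hx.1, not_le.2 hx.2⟩
  have := (hUo.measure_eq_zero_iff volume).1 hU0
  exact absurd (show ((r, z), t) ∈ U from ⟨⟨⟨hr, hz⟩, ht⟩, not_le.1 hcon⟩) (by simp [this])

lemma abs_le_of_normXT_top_le (h₁ : 0 < r₁) {g : Field} {d : ℝ} (hd : 0 ≤ d)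
    {G : (ℝ × ℝ) × ℝ → ℝ} (hG : Continuous G)
    (h : ∀ r ∈ Ioo r₁ r₂, ∀ z ∈ Ioo (-a) a, ∀ t ∈ Ioo 0 s, g r z t = G ((r, z), t))
    (hn : normXT ∞ r₁ r₂ a s g ≤ ENNReal.ofReal d) :
    ∀ r ∈ Ioo r₁ r₂, ∀ z ∈ Ioo (-a) a, ∀ t ∈ Ioo 0 s, |G ((r, z), t)| ≤ d := by
  rw [normXT, cylTimeMeasure_eq, eLpNorm_exponent_top] at hn
  have h2 := ae_le_eLpNormEssSup (f := fun q : (ℝ × ℝ) × ℝ => g q.1.1 q.1.2 q.2)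
    (μ := (box r₁ r₂ a s).withDensity fun x => ENNReal.ofReal (2 * Real.pi * x.1.1))
  rw [ae_withDensity_iff (by fun_prop)] at h2
  refine forall_le_of_ae_box hG.abs ?_
  filter_upwards [h2, ae_box] with x hx hb
  have hx1 := (hx (by
    have := h₁.trans hb.1.1
    have := Real.pi_pos
    simp only [ne_eq, ENNReal.ofReal_eq_zero, not_le]
    positivity)).trans hn
  rwa [h _ hb.1 _ hb.2.1 _ hb.2.2, Real.enorm_eq_ofReal_abs,
    ENNReal.ofReal_le_ofReal_iff hd] at hx1

end Norms

/-! ### Partial derivatives of functions of `((r, z), t)` -/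

section Calculus

/-- A field as a function of the triple `((r, z), t)`. -/
def unc (g : Field) : (ℝ × ℝ) × ℝ → ℝ := fun p => g p.1.1 p.1.2 p.2

/-- The directional derivative of `f` in the direction `e`. -/
def Dir (e : (ℝ × ℝ) × ℝ) (f : (ℝ × ℝ) × ℝ → ℝ) : (ℝ × ℝ) × ℝ → ℝ := fun p => fderiv ℝ f p e

/-- The partial derivative with respect to `r`. -/
abbrev Dr : ((ℝ × ℝ) × ℝ → ℝ) → (ℝ × ℝ) × ℝ → ℝ := Dir ((1, 0), 0)

/-- The partial derivative with respect to `z`. -/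
abbrev Dz : ((ℝ × ℝ) × ℝ → ℝ) → (ℝ × ℝ) × ℝ → ℝ := Dir ((0, 1), 0)

/-- The partial derivative with respect to `t`. -/
abbrev Dt : ((ℝ × ℝ) × ℝ → ℝ) → (ℝ × ℝ) × ℝ → ℝ := Dir ((0, 0), 1)

variable {f g : (ℝ × ℝ) × ℝ → ℝ}

lemma hasDerivAt_Dr (hf : ContDiff ℝ 1 f) (r z t : ℝ) :
    HasDerivAt (fun x => f ((x, z), t)) (Dr f ((r, z), t)) r :=
  (hf.differentiable one_ne_zero ((r, z), t)).hasFDerivAt.comp_hasDerivAt r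
    (((hasDerivAt_id r).prodMk (hasDerivAt_const r z)).prodMk (hasDerivAt_const r t))

lemma hasDerivAt_Dz (hf : ContDiff ℝ 1 f) (r z t : ℝ) :
    HasDerivAt (fun x => f ((r, x), t)) (Dz f ((r, z), t)) z :=
  (hf.differentiable one_ne_zero ((r, z), t)).hasFDerivAt.comp_hasDerivAt z
    (((hasDerivAt_const z r).prodMk (hasDerivAt_id z)).prodMk (hasDerivAt_const z t))

lemma hasDerivAt_Dt (hf : ContDiff ℝ 1 f) (x : ℝ × ℝ) (t : ℝ) :
    HasDerivAt (fun τ => f (x, τ)) (Dt f (x, t)) t :=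
  (hf.differentiable one_ne_zero (x, t)).hasFDerivAt.comp_hasDerivAt t
    ((hasDerivAt_const t x).prodMk (hasDerivAt_id t))

lemma contDiff_Dir {n m : ℕ∞} (e : (ℝ × ℝ) × ℝ) (hf : ContDiff ℝ n f) (h : m + 1 ≤ n) :
    ContDiff ℝ m (Dir e f) :=
  (hf.fderiv_right (by exact_mod_cast h)).clm_apply contDiff_const

lemma Dir_comm (e e' : (ℝ × ℝ) × ℝ) (hf : ContDiff ℝ 2 f) :
    Dir e (Dir e' f) = Dir e' (Dir e f) := by
  ext p
  have h1 : DifferentiableAt ℝ (fderiv ℝ f) p :=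
    ((hf.fderiv_right (m := 1) (by norm_num)).differentiable one_ne_zero) p
  have hs : IsSymmSndFDerivAt ℝ f p := hf.contDiffAt.isSymmSndFDerivAt (by simp)
  have key : ∀ u v : (ℝ × ℝ) × ℝ, Dir u (Dir v f) p = fderiv ℝ (fderiv ℝ f) p u v := by
    intro u v
    unfold Dir
    rw [fderiv_clm_apply h1 (differentiableAt_const v)]
    simp
  rw [key, key, hs.eq]

lemma Dir_sub (e : (ℝ × ℝ) × ℝ) (hf : ContDiff ℝ 1 f) (hg : ContDiff ℝ 1 g) :
    Dir e (f - g) = Dir e f - Dir e g := by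
  ext p
  simp only [Dir, Pi.sub_apply]
  rw [fderiv_sub (hf.differentiable one_ne_zero p) (hg.differentiable one_ne_zero p)]
  rfl

variable {v w : Field}

lemma IsSmooth.contDiff_unc {n : ℕ∞} (h : IsSmooth n v) : ContDiff ℝ n (unc v) :=
  ContDiff.comp (g := fun q : ℝ × ℝ × ℝ => v q.1 q.2.1 q.2.2)
    (f := fun p : (ℝ × ℝ) × ℝ => (p.1.1, p.1.2, p.2)) h (by fun_prop)

lemma dr_eq (h : ContDiff ℝ 1 (unc v)) (r z t : ℝ) : dr v r z t = Dr (unc v) ((r, z), t) :=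
  (hasDerivAt_Dr h r z t).deriv

lemma dz_eq (h : ContDiff ℝ 1 (unc v)) (r z t : ℝ) : dz v r z t = Dz (unc v) ((r, z), t) :=
  (hasDerivAt_Dz h r z t).deriv

lemma dt_eq (h : ContDiff ℝ 1 (unc v)) (r z t : ℝ) : dt v r z t = Dt (unc v) ((r, z), t) :=
  (hasDerivAt_Dt h (r, z) t).deriv

lemma lap_eq (h : ContDiff ℝ 2 (unc v)) {r : ℝ} (hr : r ≠ 0) (z t : ℝ) : lap v r z t
    = Dr (Dr (unc v)) ((r, z), t) + r⁻¹ * Dr (unc v) ((r, z), t) + Dz (Dz (unc v)) ((r, z), t) := by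
  have h1 : ContDiff ℝ 1 (unc v) := h.of_le (by norm_num)
  have e1 : dr v = fun r z t => Dr (unc v) ((r, z), t) := by
    ext r z t; exact dr_eq h1 r z t
  have e2 : dz v = fun r z t => Dz (unc v) ((r, z), t) := by
    ext r z t; exact dz_eq h1 r z t
  have h2 : ∀ e, ContDiff ℝ 1 (Dir e (unc v)) := fun e =>
    contDiff_Dir (n := 2) (m := 1) e h (by norm_num)
  rw [lap, e1, e2]
  simp only [dr, dz]
  rw [((hasDerivAt_id' r).fun_mul (hasDerivAt_Dr (h2 _) r z t)).deriv,
    (hasDerivAt_Dz (h2 _) r z t).deriv]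
  field_simp
  ring

/-- A continuous function that equals `1 / r` for `r ≥ ε / 2`. -/
def recip (ε : ℝ) : ℝ → ℝ := fun r => (max r (ε / 2))⁻¹

variable {ε : ℝ}

lemma continuous_recip (hε : 0 < ε) : Continuous (recip ε) :=
  (by fun_prop : Continuous fun r : ℝ => max r (ε / 2)).inv₀ fun r =>
    (lt_max_of_lt_right (by linarith)).ne'

lemma recip_eq (hε : 0 < ε) {r : ℝ} (hr : ε ≤ r) : recip ε r = r⁻¹ := by
  rw [recip, max_eq_left (by linarith)]

lemma recip_mul (hε : 0 < ε) {r : ℝ} (hr : ε ≤ r) : recip ε r * r = 1 := by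
  rw [recip_eq hε hr, inv_mul_cancel₀ (by linarith)]

/-- Truncating at `ε / 2` and not at `ε` leaves room on both sides of the wall `r = ε`, so a
two-sided derivative exists there. -/
lemma hasDerivAt_recip (hε : 0 < ε) {r : ℝ} (hr : ε ≤ r) :
    HasDerivAt (recip ε) (-recip ε r ^ 2) r := by
  have h : HasDerivAt (fun x : ℝ => x⁻¹) (-(r ^ 2)⁻¹) r := hasDerivAt_inv (by linarith)
  rw [recip_eq hε hr, inv_pow]
  refine h.congr_of_eventuallyEq ?_
  filter_upwards [lt_mem_nhds (show ε / 2 < r by linarith)] with x hx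
  rw [recip, max_eq_left hx.le]

end Calculus

/-! ### The equations for the vorticity and for the azimuthal velocity -/

section Equations

/-- The azimuthal vorticity as a function of `((r, z), t)`. -/
def vort (vr vz : Field) : (ℝ × ℝ) × ℝ → ℝ := Dz (unc vr) - Dr (unc vz)

/-- `χ_t + v · ∇ χ - (v_r / r) χ - ν (Δ χ - χ / r²) - 2 v_φ v_{φ,z} / r`. -/
def vortForce (ν ε : ℝ) (vr vφ vz : Field) : (ℝ × ℝ) × ℝ → ℝ := fun p =>
  Dt (vort vr vz) p + unc vr p * Dr (vort vr vz) p + unc vz p * Dz (vort vr vz) p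
    - unc vr p * recip ε p.1.1 * vort vr vz p
    - ν * (Dr (Dr (vort vr vz)) p + recip ε p.1.1 * Dr (vort vr vz) p + Dz (Dz (vort vr vz)) p
      - recip ε p.1.1 ^ 2 * vort vr vz p)
    - 2 * recip ε p.1.1 * unc vφ p * Dz (unc vφ) p

/-- The left-hand side of the equation for `v_φ`. -/
def swirlForce (ν ε : ℝ) (vr vφ vz : Field) : (ℝ × ℝ) × ℝ → ℝ := fun p =>
  Dt (unc vφ) p + unc vr p * Dr (unc vφ) p + unc vz p * Dz (unc vφ) p
    + unc vr p * recip ε p.1.1 * unc vφ p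
    - ν * (Dr (Dr (unc vφ)) p + recip ε p.1.1 * Dr (unc vφ) p + Dz (Dz (unc vφ)) p)
    + ν * recip ε p.1.1 ^ 2 * unc vφ p

variable {ν R a T ε : ℝ} {vr vφ vz p fr fφ fz : Field}

lemma IsSolution.swirlForce_eq (h : IsSolution ν R a T ε vr vφ vz p fr fφ fz) (hε : 0 < ε)
    {r z t : ℝ} (hr : r ∈ Ioo ε R) (hz : z ∈ Ioo (-a) a) (ht : t ∈ Ioo 0 T) :
    fφ r z t = swirlForce ν ε vr vφ vz ((r, z), t) := by
  have hφ := h.smooth_φ.contDiff_unc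
  have hφ2 : ContDiff ℝ 2 (unc vφ) := hφ.of_le (by norm_num)
  have hφ1 : ContDiff ℝ 1 (unc vφ) := hφ.of_le (by norm_num)
  rw [← h.momentum_φ r hr z hz t ht, lap_eq hφ2 (hε.trans hr.1).ne', adv, dt_eq hφ1, dr_eq hφ1,
    dz_eq hφ1, swirlForce, recip_eq hε hr.1.le]
  simp only [unc]
  field_simp
  ring

lemma IsSolution.div_eq (h : IsSolution ν R a T ε vr vφ vz p fr fφ fz) (hε : 0 < ε)
    {r z t : ℝ} (hr : r ∈ Ioo ε R) (hz : z ∈ Ioo (-a) a) (ht : t ∈ Ioo 0 T) :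
    Dr (unc vr) ((r, z), t) + Dz (unc vz) ((r, z), t)
      + unc vr ((r, z), t) * recip ε r = 0 := by
  have h1 : ContDiff ℝ 1 (unc vr) := h.smooth_r.contDiff_unc.of_le (by norm_num)
  have h2 : ContDiff ℝ 1 (unc vz) := h.smooth_z.contDiff_unc.of_le (by norm_num)
  have := h.div_free r hr z hz t ht
  rw [dr_eq h1, dz_eq h2] at this
  rw [this, recip_eq hε hr.1.le]
  simp only [unc]
  ring

/-- No regularity of the forces is assumed. Near an interior point the momentum equations express
them through `v` and `p`, and these expressions are differentiated. The pressure drops out by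
symmetry of second derivatives. -/
lemma IsSolution.rot_force_eq (h : IsSolution ν R a T ε vr vφ vz p fr fφ fz) (hε : 0 < ε)
    {r z t : ℝ} (hr : r ∈ Ioo ε R) (hz : z ∈ Ioo (-a) a) (ht : t ∈ Ioo 0 T) :
    rot fr fz r z t = vortForce ν ε vr vφ vz ((r, z), t) := by
  have hr3 := h.smooth_r.contDiff_unc
  have hz3 := h.smooth_z.contDiff_unc
  have hφ1 : ContDiff ℝ 1 (unc vφ) := h.smooth_φ.contDiff_unc.of_le (by norm_num)
  have hp2 : ContDiff ℝ 2 (unc p) := h.smooth_p.contDiff_unc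
  have hr2 : ContDiff ℝ 2 (unc vr) := hr3.of_le (by norm_num)
  have hz2 : ContDiff ℝ 2 (unc vz) := hz3.of_le (by norm_num)
  have hr1 : ContDiff ℝ 1 (unc vr) := hr3.of_le (by norm_num)
  have hz1 : ContDiff ℝ 1 (unc vz) := hz3.of_le (by norm_num)
  have hp1 : ContDiff ℝ 1 (unc p) := hp2.of_le (by norm_num)
  have hDr2 : ∀ e, ContDiff ℝ 2 (Dir e (unc vr)) := fun e =>
    contDiff_Dir (n := 3) (m := 2) e hr3 (by norm_num)
  have hDz2 : ∀ e, ContDiff ℝ 2 (Dir e (unc vz)) := fun e =>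
    contDiff_Dir (n := 3) (m := 2) e hz3 (by norm_num)
  have hDr1 : ∀ e, ContDiff ℝ 1 (Dir e (unc vr)) := fun e => (hDr2 e).of_le (by norm_num)
  have hDz1 : ∀ e, ContDiff ℝ 1 (Dir e (unc vz)) := fun e => (hDz2 e).of_le (by norm_num)
  have hDp1 : ∀ e, ContDiff ℝ 1 (Dir e (unc p)) := fun e =>
    contDiff_Dir (n := 2) (m := 1) e hp2 (by norm_num)
  have hDDr1 : ∀ e e', ContDiff ℝ 1 (Dir e (Dir e' (unc vr))) := fun e e' =>
    contDiff_Dir (n := 2) (m := 1) e (hDr2 e') (by norm_num)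
  have hDDz1 : ∀ e e', ContDiff ℝ 1 (Dir e (Dir e' (unc vz))) := fun e e' =>
    contDiff_Dir (n := 2) (m := 1) e (hDz2 e') (by norm_num)
  have hr0 : r ≠ 0 := (hε.trans hr.1).ne'
  -- the momentum equations, solved for the forces
  have e1 : dz fr r z t = deriv (fun x => Dt (unc vr) ((r, x), t)
      + (unc vr ((r, x), t) * Dr (unc vr) ((r, x), t) + unc vz ((r, x), t) * Dz (unc vr) ((r, x), t))
      - unc vφ ((r, x), t) ^ 2 / r
      - ν * (Dr (Dr (unc vr)) ((r, x), t) + r⁻¹ * Dr (unc vr) ((r, x), t)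
        + Dz (Dz (unc vr)) ((r, x), t))
      + ν * unc vr ((r, x), t) / r ^ 2 + Dr (unc p) ((r, x), t)) z := by
    rw [dz]
    refine Filter.EventuallyEq.deriv_eq ?_
    filter_upwards [Ioo_mem_nhds hz.1 hz.2] with x hx
    have := h.momentum_r r hr x hx t ht
    rw [lap_eq hr2 hr0, adv, dt_eq hr1, dr_eq hr1, dz_eq hr1, dr_eq hp1] at this
    simp only [unc] at this ⊢
    linarith
  have e2 : dr fz r z t = deriv (fun x => Dt (unc vz) ((x, z), t)
      + (unc vr ((x, z), t) * Dr (unc vz) ((x, z), t) + unc vz ((x, z), t) * Dz (unc vz) ((x, z), t))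
      - ν * (Dr (Dr (unc vz)) ((x, z), t) + x⁻¹ * Dr (unc vz) ((x, z), t)
        + Dz (Dz (unc vz)) ((x, z), t))
      + Dz (unc p) ((x, z), t)) r := by
    rw [dr]
    refine Filter.EventuallyEq.deriv_eq ?_
    filter_upwards [Ioo_mem_nhds hr.1 hr.2] with x hx
    have := h.momentum_z x hx z hz t ht
    rw [lap_eq hz2 (hε.trans hx.1).ne', adv, dt_eq hz1, dr_eq hz1, dz_eq hz1, dz_eq hp1] at this
    simp only [unc] at this ⊢
    linarith
  have hdiv := h.div_eq hε hr hz ht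
  rw [recip_eq hε hr.1.le] at hdiv
  rw [rot, e1, e2]
  rw [HasDerivAt.deriv ((((((hasDerivAt_Dz (hDr1 _) r z t).fun_add
    (((hasDerivAt_Dz hr1 r z t).fun_mul (hasDerivAt_Dz (hDr1 _) r z t)).fun_add
      ((hasDerivAt_Dz hz1 r z t).fun_mul (hasDerivAt_Dz (hDr1 _) r z t)))).fun_sub
    (((hasDerivAt_Dz hφ1 r z t).fun_pow 2).div_const r)).fun_sub
    ((((hasDerivAt_Dz (hDDr1 _ _) r z t).fun_add
      ((hasDerivAt_Dz (hDr1 _) r z t).const_mul r⁻¹)).fun_add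
      (hasDerivAt_Dz (hDDr1 _ _) r z t)).const_mul ν)).fun_add
    (((hasDerivAt_Dz hr1 r z t).const_mul ν).div_const (r ^ 2))).fun_add
    (hasDerivAt_Dz (hDp1 _) r z t)),
    HasDerivAt.deriv ((((hasDerivAt_Dr (hDz1 _) r z t).fun_add
    (((hasDerivAt_Dr hr1 r z t).fun_mul (hasDerivAt_Dr (hDz1 _) r z t)).fun_add
      ((hasDerivAt_Dr hz1 r z t).fun_mul (hasDerivAt_Dr (hDz1 _) r z t)))).fun_sub
    ((((hasDerivAt_Dr (hDDz1 _ _) r z t).fun_add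
      ((hasDerivAt_inv hr0).fun_mul (hasDerivAt_Dr (hDz1 _) r z t))).fun_add
      (hasDerivAt_Dr (hDDz1 _ _) r z t)).const_mul ν)).fun_add
    (hasDerivAt_Dr (hDp1 _) r z t))]
  have c1 : Dz (Dr (unc p)) = Dr (Dz (unc p)) := Dir_comm _ _ hp2
  have c2 : Dz (Dt (unc vr)) = Dt (Dz (unc vr)) := Dir_comm _ _ hr2
  have c3 : Dr (Dt (unc vz)) = Dt (Dr (unc vz)) := Dir_comm _ _ hz2
  have c4 : Dz (Dr (unc vr)) = Dr (Dz (unc vr)) := Dir_comm _ _ hr2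
  have c5 : Dz (Dr (unc vz)) = Dr (Dz (unc vz)) := Dir_comm _ _ hz2
  have c6 : Dz (Dr (Dr (unc vr))) = Dr (Dr (Dz (unc vr))) := by
    rw [← c4]; exact Dir_comm _ _ (hDr2 _)
  have c7 : Dz (Dr (Dz (unc vz))) = Dr (Dz (Dz (unc vz))) := Dir_comm _ _ (hDz2 _)
  rw [vortForce, recip_eq hε hr.1.le, vort]
  dsimp only [Dr, Dz, Dt] at *
  rw [Dir_sub _ (hDr1 _) (hDz1 _), Dir_sub _ (hDr1 _) (hDz1 _), Dir_sub _ (hDr1 _) (hDz1 _),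
    Dir_sub _ (hDDr1 _ _) (hDDz1 _ _), Dir_sub _ (hDDr1 _ _) (hDDz1 _ _)]
  simp only [Pi.sub_apply]
  rw [c1, c2, c3, c6, c4, c5, c7]
  field_simp at hdiv ⊢
  simp only [Nat.cast_ofNat, Nat.add_one_sub_one, pow_one]
  -- Cross-differentiating the transport terms leaves `χ (v_{r,r} + v_{z,z})`; the divergence
  -- equation turns it into the stretching term `-χ v_r / r`.
  linear_combination (r * (Dir ((0, 1), 0) (unc vr) ((r, z), t)
    - Dir ((1, 0), 0) (unc vz) ((r, z), t))) * hdiv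

end Equations

/-! ### Boundary values -/

section Boundary

variable {ν R a T ε : ℝ} {vr vφ vz p fr fφ fz ψ : Field}

/-- The equations and the formulas for the velocity hold in the open domain; continuity carries them
to the wall `r = ε`. -/
lemma eq_left_of_eqOn_Ioo {f g : ℝ → ℝ} (hf : Continuous f) (hg : Continuous g) {b c : ℝ}
    (hbc : b < c) (h : ∀ x ∈ Ioo b c, f x = g x) : f b = g b :=
  (show EqOn f g (Ioo b c) from h).closure hf hg
    (by rw [closure_Ioo hbc.ne]; exact left_mem_Icc.2 hbc.le)

lemma eq_right_of_eqOn_Ioo {f g : ℝ → ℝ} (hf : Continuous f) (hg : Continuous g) {b c : ℝ}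
    (hbc : b < c) (h : ∀ x ∈ Ioo b c, f x = g x) : f c = g c :=
  (show EqOn f g (Ioo b c) from h).closure hf hg
    (by rw [closure_Ioo hbc.ne]; exact right_mem_Icc.2 hbc.le)

/-- A solution of the homogeneous stream function equation in `(0, ε) × (-a, a)` that vanishes on
the boundary has vanishing radial derivative. -/
lemma Dr_eq_zero_of_homogeneous (hε : 0 < ε) (ha : 0 < a) {n : (ℝ × ℝ) × ℝ → ℝ}
    (hn : ContDiff ℝ 2 n)
    (heq : ∀ r ∈ Ioo 0 ε, ∀ z ∈ Ioo (-a) a, ∀ t ∈ Ioo (0 : ℝ) 1, r * Dz (Dz n) ((r, z), t)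
      + 3 * Dr n ((r, z), t) + r * Dr (Dr n) ((r, z), t) = 0)
    (hlat : ∀ z ∈ Ioo (-a) a, ∀ t ∈ Ioo (0 : ℝ) 1, n ((ε, z), t) = 0)
    (hflat : ∀ r ∈ Ioo 0 ε, ∀ t ∈ Ioo (0 : ℝ) 1, n ((r, -a), t) = 0 ∧ n ((r, a), t) = 0) :
    ∀ r ∈ Ioo 0 ε, ∀ z ∈ Ioo (-a) a, ∀ t ∈ Ioo (0 : ℝ) 1, Dr n ((r, z), t) = 0 := by
  have hn1 : ContDiff ℝ 1 n := hn.of_le (by norm_num)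
  have hD : ∀ e, ContDiff ℝ 1 (Dir e n) := fun e =>
    contDiff_Dir (n := 2) (m := 1) e hn (by norm_num)
  have hD0 : ∀ e e', ContDiff ℝ 0 (Dir e (Dir e' n)) := fun e e' =>
    contDiff_Dir (n := 1) (m := 0) e (hD e') (by norm_num)
  have k0 : Continuous n := hn.continuous
  have k1 : Continuous (Dr n) := (hD _).continuous
  have k2 : Continuous (Dz n) := (hD _).continuous
  have k3 : Continuous (Dr (Dr n)) := (hD0 _ _).continuous
  have k4 : Continuous (Dz (Dz n)) := (hD0 _ _).continuous
  -- Multiplied by `r² n`, the equation reads `(r³ n n_r)_r + (r³ n n_z)_z = r³ (n_r² + n_z²)`. The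
  -- factor `r³` removes the flux at the axis, and the boundary values remove the other fluxes.
  have i1 := integral_box_dr_eq_zero (ε := 0) (R := ε) (a := a) (s := 1)
    (A := fun x => x.1.1 ^ 3 * (n x * Dr n x))
    (A' := fun x => 3 * x.1.1 ^ 2 * (n x * Dr n x)
      + x.1.1 ^ 3 * (Dr n x * Dr n x + n x * Dr (Dr n) x)) hε.le (by fun_prop)
    (fun r _ z t => ((hasDerivAt_pow 3 r).fun_mul ((hasDerivAt_Dr hn1 r z t).fun_mul
      (hasDerivAt_Dr (hD _) r z t))).congr_deriv (by simp))
    (fun z _ t _ => by simp) (fun z hz t ht => by simp [hlat z hz t ht])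
  have i2 := integral_box_dz_eq_zero (ε := 0) (R := ε) (a := a) (s := 1)
    (A := fun x => x.1.1 ^ 3 * (n x * Dz n x))
    (A' := fun x => x.1.1 ^ 3 * (Dz n x * Dz n x + n x * Dz (Dz n) x)) ha.le (by fun_prop)
    (fun r z t => ((hasDerivAt_Dz hn1 r z t).fun_mul (hasDerivAt_Dz (hD _) r z t)).const_mul (r ^ 3))
    (fun r hr t ht => by simp [hflat r hr t ht])
  have i3 : ∫ x, x.1.1 ^ 3 * (Dr n x ^ 2 + Dz n x ^ 2) ∂box 0 ε a 1 = 0 := by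
    have := integral_add (μ := box 0 ε a 1) (integrable_box (f := fun x => 3 * x.1.1 ^ 2
      * (n x * Dr n x) + x.1.1 ^ 3 * (Dr n x * Dr n x + n x * Dr (Dr n) x)) (by fun_prop))
      (integrable_box (f := fun x => x.1.1 ^ 3 * (Dz n x * Dz n x + n x * Dz (Dz n) x))
        (by fun_prop))
    rw [i1, i2, add_zero] at this
    refine Eq.trans ?_ this
    refine integral_box_congr fun r hr z hz t ht => ?_
    linear_combination (-r ^ 2 * n ((r, z), t)) * heq r hr z hz t ht
  rw [integral_eq_zero_iff_of_nonneg_ae ?_ (integrable_box (by fun_prop))] at i3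
  · intro r hr z hz t ht
    have h := forall_le_of_ae_box (d := 0) (by fun_prop) (i3.mono fun x hx => hx.le) r hr z hz t ht
    have h3 : 0 < r ^ 3 := pow_pos hr.1 3
    simp only at h
    have : Dr n ((r, z), t) ^ 2 + Dz n ((r, z), t) ^ 2 ≤ 0 := by
      by_contra hcon
      nlinarith [mul_pos h3 (not_le.1 hcon)]
    nlinarith [sq_nonneg (Dr n ((r, z), t)), sq_nonneg (Dz n ((r, z), t))]
  · filter_upwards [ae_box] with x hx
    have := hx.1.1
    simp only [Pi.zero_apply]
    positivity

/-- The stream function forces `v_z` to vanish on the inner wall as well. -/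
lemma vz_eq_zero_inner (h : IsSolution ν R a T ε vr vφ vz p fr fφ fz)
    (hψ : IsStreamFunction R a T ε vr vz ψ) (ha : 0 < a) (hε : 0 < ε) (hR : ε < R)
    {z t : ℝ} (hz : z ∈ Ioo (-a) a) (ht : t ∈ Ioo 0 T) : unc vz ((ε, z), t) = 0 := by
  obtain ⟨η, hη, hψη⟩ := hψ.regular t ht
  -- `η` at the fixed time `t`, made constant in the third variable so that the box lemmas apply.
  -- The time `τ ∈ (0, 1)` below is a dummy, and so is its value `1 / 2`.
  set n : (ℝ × ℝ) × ℝ → ℝ := fun x => η x.1.1 x.1.2 with hn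
  have hn2 : ContDiff ℝ 2 n := hη.comp (by fun_prop : ContDiff ℝ 2 fun x : (ℝ × ℝ) × ℝ => x.1)
  have hn1 : ContDiff ℝ 1 n := hn2.of_le (by norm_num)
  have hD : ∀ e, ContDiff ℝ 1 (Dir e n) := fun e =>
    contDiff_Dir (n := 2) (m := 1) e hn2 (by norm_num)
  have k0 : Continuous n := hn2.continuous
  have k1 : Continuous (Dr n) := (hD _).continuous
  have k2 : Continuous (Dz n) := (hD _).continuous
  have kr : Continuous (unc vr) := h.smooth_r.contDiff_unc.continuous
  have kz : Continuous (unc vz) := h.smooth_z.contDiff_unc.continuous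
  have dzψ : ∀ r z τ, dz ψ r z t = r ^ 2 * Dz n ((r, z), τ) := by
    intro r z τ
    simp only [dz, hψη]
    exact ((hasDerivAt_Dz hn1 r z τ).const_mul (r ^ 2)).deriv
  have drψ : ∀ r z τ, dr ψ r z t = 2 * r * n ((r, z), τ) + r ^ 2 * Dr n ((r, z), τ) := by
    intro r z τ
    simp only [dr, hψη]
    refine (((hasDerivAt_pow 2 r).fun_mul (hasDerivAt_Dr hn1 r z τ)).congr_deriv ?_).deriv
    simp
  -- `v_r = ψ_z / r = r η_z` extends to `r = ε` by continuity, and there `v_r = 0`.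
  have hDz0 : ∀ z ∈ Ioo (-a) a, ∀ τ, Dz n ((ε, z), τ) = 0 := by
    intro z hz τ
    have := eq_left_of_eqOn_Ioo (f := fun r => unc vr ((r, z), t))
      (g := fun r => r * Dz n ((r, z), τ)) (by fun_prop) (by fun_prop) hR fun r hr => by
        have h1 := (hψ.velocity r hr z hz t ht).1
        rw [dzψ r z τ] at h1
        simp only [unc, h1]
        field_simp [(hε.trans hr.1).ne']
    have h0 : unc vr ((ε, z), t) = 0 := (h.bc_lateral ε (Or.inr rfl) z hz t ht).1
    simp only [h0] at this
    exact (mul_eq_zero.1 this.symm).resolve_left hε.ne'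
  have hflat : ∀ r ∈ Ioc 0 ε, ∀ τ, n ((r, -a), τ) = 0 ∧ n ((r, a), τ) = 0 := by
    intro r hr τ
    have hb := (hψ.boundary t ht).2 r ⟨hr.1.le, hr.2.trans hR.le⟩
    rw [hψη, hψη] at hb
    have hr2 : r ^ 2 ≠ 0 := (pow_pos hr.1 2).ne'
    exact ⟨(mul_eq_zero.1 hb.1).resolve_left hr2, (mul_eq_zero.1 hb.2).resolve_left hr2⟩
  -- So `η` is constant along the inner wall, and it vanishes at the lower end of it.
  have hlat : ∀ z ∈ Ioo (-a) a, ∀ τ, n ((ε, z), τ) = 0 := by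
    intro z hz τ
    have := setIntegral_Ioo_deriv hz.1.le (f := fun x => n ((ε, x), τ))
      (fun x _ => hasDerivAt_Dz hn1 ε x τ) (by fun_prop)
    rw [setIntegral_eq_zero_of_forall_eq_zero fun x hx => hDz0 x ⟨hx.1, hx.2.trans hz.2⟩ τ,
      (hflat ε ⟨hε, le_rfl⟩ τ).1] at this
    linarith
  -- For `r < ε` the continued `χ` is zero, and `η` has zero values on all of the boundary off the
  -- axis.
  have hDr0 := Dr_eq_zero_of_homogeneous hε ha hn2 (fun r hr z hz τ _ => by
      have he := hψ.elliptic r ⟨hr.1, hr.2.trans hR⟩ z hz t ht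
      rw [rotExt, if_pos hr.2.le] at he
      rw [← he]
      have e1 : dz (fun r z t => dz ψ r z t / r) r z t = r * Dz (Dz n) ((r, z), τ) := by
        rw [dz]
        simp only [fun x => dzψ r x τ]
        refine ((((hasDerivAt_Dz (hD _) r z τ).const_mul (r ^ 2)).div_const r).congr_deriv
          ?_).deriv
        field_simp [hr.1.ne']
      have e2 : dr (fun r z t => dr ψ r z t / r) r z t
          = 3 * Dr n ((r, z), τ) + r * Dr (Dr n) ((r, z), τ) := by
        rw [dr]
        have : HasDerivAt (fun x => 2 * n ((x, z), τ) + x * Dr n ((x, z), τ))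
            (3 * Dr n ((r, z), τ) + r * Dr (Dr n) ((r, z), τ)) r :=
          (((hasDerivAt_Dr hn1 r z τ).const_mul 2).fun_add ((hasDerivAt_id' r).fun_mul
            (hasDerivAt_Dr (hD _) r z τ))).congr_deriv (by ring)
        refine (this.congr_of_eventuallyEq ?_).deriv
        filter_upwards [lt_mem_nhds hr.1] with x hx
        rw [drψ x z τ]
        field_simp
      rw [e1, e2]
      ring)
    (fun z hz τ _ => hlat z hz τ) (fun r hr τ _ => hflat r ⟨hr.1, hr.2.le⟩ τ)
  have hhalf : (1 / 2 : ℝ) ∈ Ioo (0 : ℝ) 1 := by norm_num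
  have hDrε : Dr n ((ε, z), 1 / 2) = 0 :=
    eq_right_of_eqOn_Ioo (f := fun r => Dr n ((r, z), 1 / 2)) (g := fun _ => 0) (by fun_prop)
      (by fun_prop) hε fun r hr => hDr0 r hr z hz _ hhalf
  -- `η` is smooth across `r = ε`: the normal derivative found from inside is the one that gives
  -- `v_z` from outside.
  have := eq_left_of_eqOn_Ioo (f := fun r => unc vz ((r, z), t))
      (g := fun r => -(2 * n ((r, z), 1 / 2) + r * Dr n ((r, z), 1 / 2))) (by fun_prop)
      (by fun_prop) hR fun r hr => by
        have h1 := (hψ.velocity r hr z hz t ht).2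
        rw [drψ r z (1 / 2)] at h1
        simp only [unc, h1]
        field_simp [(hε.trans hr.1).ne']
  simp only [hlat z hz, hDrε] at this
  simpa using this

lemma Dz_eq_zero_of_eqOn {f : (ℝ × ℝ) × ℝ → ℝ} (hf : ContDiff ℝ 1 f) {r t : ℝ}
    (h0 : ∀ z ∈ Ioo (-a) a, f ((r, z), t) = 0) {z : ℝ} (hz : z ∈ Ioo (-a) a) :
    Dz f ((r, z), t) = 0 := by
  refine (hasDerivAt_Dz hf r z t).unique ((hasDerivAt_const z (0 : ℝ)).congr_of_eventuallyEq ?_)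
  filter_upwards [Ioo_mem_nhds hz.1 hz.2] with x hx using h0 x hx

lemma Dr_eq_zero_of_eqOn {f : (ℝ × ℝ) × ℝ → ℝ} (hf : ContDiff ℝ 1 f) {z t : ℝ}
    (h0 : ∀ r ∈ Ioo ε R, f ((r, z), t) = 0) {r : ℝ} (hr : r ∈ Ioo ε R) :
    Dr f ((r, z), t) = 0 := by
  refine (hasDerivAt_Dr hf r z t).unique ((hasDerivAt_const r (0 : ℝ)).congr_of_eventuallyEq ?_)
  filter_upwards [Ioo_mem_nhds hr.1 hr.2] with x hx using h0 x hx

lemma Dz_vr_lateral (h : IsSolution ν R a T ε vr vφ vz p fr fφ fz) {r z t : ℝ}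
    (hr : r = R ∨ r = ε) (hz : z ∈ Ioo (-a) a) (ht : t ∈ Ioo 0 T) :
    Dz (unc vr) ((r, z), t) = 0 :=
  Dz_eq_zero_of_eqOn (h.smooth_r.contDiff_unc.of_le (by norm_num))
    (fun z hz => (h.bc_lateral r hr z hz t ht).1) hz

lemma vort_lateral (h : IsSolution ν R a T ε vr vφ vz p fr fφ fz) {r z t : ℝ}
    (hr : r = R ∨ r = ε) (hz : z ∈ Ioo (-a) a) (ht : t ∈ Ioo 0 T) :
    vort vr vz ((r, z), t) = 0 := by
  have h1 := (h.bc_lateral r hr z hz t ht).2.1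
  rw [dr_eq (h.smooth_z.contDiff_unc.of_le (by norm_num))] at h1
  rw [vort, Pi.sub_apply, Dz_vr_lateral h hr hz ht, h1, sub_zero]

lemma Dz_vr_flat (h : IsSolution ν R a T ε vr vφ vz p fr fφ fz) {r z t : ℝ}
    (hr : r ∈ Ioo ε R) (hz : z = -a ∨ z = a) (ht : t ∈ Ioo 0 T) :
    Dz (unc vr) ((r, z), t) = 0 := by
  have h1 := (h.bc_flat r hr z hz t ht).2.1
  rwa [dz_eq (h.smooth_r.contDiff_unc.of_le (by norm_num))] at h1

lemma Dz_vφ_flat (h : IsSolution ν R a T ε vr vφ vz p fr fφ fz) {r z t : ℝ}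
    (hr : r ∈ Ioo ε R) (hz : z = -a ∨ z = a) (ht : t ∈ Ioo 0 T) :
    Dz (unc vφ) ((r, z), t) = 0 := by
  have h1 := (h.bc_flat r hr z hz t ht).2.2
  rwa [dz_eq (h.smooth_φ.contDiff_unc.of_le (by norm_num))] at h1

lemma vort_flat (h : IsSolution ν R a T ε vr vφ vz p fr fφ fz) {r z t : ℝ}
    (hr : r ∈ Ioo ε R) (hz : z = -a ∨ z = a) (ht : t ∈ Ioo 0 T) :
    vort vr vz ((r, z), t) = 0 := by
  have h1 : Dr (unc vz) ((r, z), t) = 0 :=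
    Dr_eq_zero_of_eqOn (h.smooth_z.contDiff_unc.of_le (by norm_num))
      (fun r hr => (h.bc_flat r hr z hz t ht).1) hr
  rw [vort, Pi.sub_apply, Dz_vr_flat h hr hz ht, h1, sub_zero]

lemma Dr_vφ_inner (h : IsSolution ν R a T ε vr vφ vz p fr fφ fz) (hε : 0 < ε) {z t : ℝ}
    (hz : z ∈ Ioo (-a) a) (ht : t ∈ Ioo 0 T) :
    Dr (unc vφ) ((ε, z), t) = unc vφ ((ε, z), t) * recip ε ε := by
  have h1 := (h.bc_lateral ε (Or.inr rfl) z hz t ht).2.2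
  rw [dr_eq (h.smooth_φ.contDiff_unc.of_le (by norm_num))] at h1
  rw [h1, recip_eq hε le_rfl, div_eq_mul_inv]
  rfl

/-- Since `v_z` vanishes along the inner wall, so does `v_{z,z}`, and the divergence equation leaves
`v_{r,r} = 0`. This removes the boundary term at `r = ε` in the elliptic estimate, and is the only
use of the stream function. -/
lemma Dr_vr_inner (h : IsSolution ν R a T ε vr vφ vz p fr fφ fz)
    (hψ : IsStreamFunction R a T ε vr vz ψ) (ha : 0 < a) (hε : 0 < ε) (hR : ε < R) {z t : ℝ}
    (hz : z ∈ Ioo (-a) a) (ht : t ∈ Ioo 0 T) : Dr (unc vr) ((ε, z), t) = 0 := by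
  have hr3 : ContDiff ℝ 3 (unc vr) := h.smooth_r.contDiff_unc
  have hz3 : ContDiff ℝ 3 (unc vz) := h.smooth_z.contDiff_unc
  have k0 : Continuous (unc vr) := hr3.continuous
  have k1 : Continuous (Dr (unc vr)) :=
    (contDiff_Dir (n := 3) (m := 2) _ hr3 (by norm_num)).continuous
  have k2 : Continuous (Dz (unc vz)) :=
    (contDiff_Dir (n := 3) (m := 2) _ hz3 (by norm_num)).continuous
  have kq := continuous_recip hε
  have h1 := eq_left_of_eqOn_Ioo (f := fun r => Dr (unc vr) ((r, z), t) + Dz (unc vz) ((r, z), t)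
    + unc vr ((r, z), t) * recip ε r) (g := fun _ => 0) (by fun_prop) (by fun_prop) hR
    fun r hr => h.div_eq hε hr hz ht
  have h2 : Dz (unc vz) ((ε, z), t) = 0 :=
    Dz_eq_zero_of_eqOn (hz3.of_le (by norm_num))
      (fun z hz => vz_eq_zero_inner h hψ ha hε hR hz ht) hz
  have h3 : unc vr ((ε, z), t) = 0 := (h.bc_lateral ε (Or.inr rfl) z hz t ht).1
  simp only [h2, h3] at h1
  linarith

end Boundary

/-! ### Energy identities -/

section Identities

variable {ν ε R a s : ℝ} {U V Φ X F : (ℝ × ℝ) × ℝ → ℝ} {ζ ζ' ζ'' : ℝ → ℝ}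

/-- Energy identity for `χ ζ² / r`. -/
lemma vorticity_energy (hε : 0 < ε) (hR : ε < R) (ha : 0 < a) (hs : 0 ≤ s)
    (hU : ContDiff ℝ 1 U) (hV : ContDiff ℝ 1 V) (hΦ : ContDiff ℝ 1 Φ) (hX : ContDiff ℝ 2 X)
    (_hF0 : Continuous F) (hζ : ∀ r, HasDerivAt ζ (ζ' r) r) (hζ' : Continuous ζ') (hζR : ζ R = 0)
    (hdiv : ∀ r ∈ Ioo ε R, ∀ z ∈ Ioo (-a) a, ∀ t ∈ Ioo 0 s,
      Dr U ((r, z), t) + Dz V ((r, z), t) + U ((r, z), t) * recip ε r = 0)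
    (hF : ∀ r ∈ Ioo ε R, ∀ z ∈ Ioo (-a) a, ∀ t ∈ Ioo 0 s, F ((r, z), t)
      = Dt X ((r, z), t) + U ((r, z), t) * Dr X ((r, z), t) + V ((r, z), t) * Dz X ((r, z), t)
        - U ((r, z), t) * recip ε r * X ((r, z), t)
        - ν * (Dr (Dr X) ((r, z), t) + recip ε r * Dr X ((r, z), t) + Dz (Dz X) ((r, z), t)
          - recip ε r ^ 2 * X ((r, z), t))
        - 2 * recip ε r * Φ ((r, z), t) * Dz Φ ((r, z), t))
    (hXε : ∀ z ∈ Ioo (-a) a, ∀ t ∈ Ioo 0 s, X ((ε, z), t) = 0)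
    (hXa : ∀ r ∈ Ioo ε R, ∀ t ∈ Ioo 0 s, X ((r, -a), t) = 0 ∧ X ((r, a), t) = 0) :
    ∫ x, 1 / 2 * X (x, s) ^ 2 * (ζ x.1 ^ 4 * recip ε x.1) ∂rect ε R a
      - ∫ x, 1 / 2 * X (x, 0) ^ 2 * (ζ x.1 ^ 4 * recip ε x.1) ∂rect ε R a
      + ν * ∫ x, ((Dr X x * (ζ x.1.1 ^ 2 * recip ε x.1.1) + X x * (2 * ζ x.1.1 * ζ' x.1.1
          * recip ε x.1.1 - ζ x.1.1 ^ 2 * recip ε x.1.1 ^ 2)) ^ 2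
        + (Dz X x * (ζ x.1.1 ^ 2 * recip ε x.1.1)) ^ 2) * x.1.1 ∂box ε R a s
      = ∫ x, (F x * X x * (ζ x.1.1 ^ 4 * recip ε x.1.1)
        + 2 * U x * X x ^ 2 * ζ x.1.1 ^ 3 * ζ' x.1.1 * recip ε x.1.1
        - 4 * ν * X x ^ 2 * recip ε x.1.1 ^ 2 * ζ x.1.1 ^ 2
          * (ζ x.1.1 * ζ' x.1.1 - x.1.1 * ζ' x.1.1 ^ 2)
        - Φ x ^ 2 * ζ x.1.1 ^ 2 * recip ε x.1.1 ^ 2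
          * (Dz X x * (ζ x.1.1 ^ 2 * recip ε x.1.1)) * x.1.1) ∂box ε R a s := by
  set q := recip ε with hq
  have hX1 : ContDiff ℝ 1 X := hX.of_le (by norm_num)
  have hD : ∀ e, ContDiff ℝ 1 (Dir e X) := fun e =>
    contDiff_Dir (n := 2) (m := 1) e hX (by norm_num)
  have hc : ∀ {f} e, ContDiff ℝ 1 f → Continuous (Dir e f) := fun e hf =>
    (contDiff_Dir (n := 1) (m := 0) e hf (by norm_num)).continuous
  have k0 : Continuous X := hX.continuous
  have k1 : Continuous (Dr X) := hc _ hX1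
  have k2 : Continuous (Dz X) := hc _ hX1
  have k3 : Continuous (Dt X) := hc _ hX1
  have k4 : Continuous (Dr (Dr X)) := hc _ (hD _)
  have k5 : Continuous (Dz (Dz X)) := hc _ (hD _)
  have k6 : Continuous U := hU.continuous
  have k7 : Continuous (Dr U) := hc _ hU
  have k8 : Continuous V := hV.continuous
  have k9 : Continuous (Dz V) := hc _ hV
  have k10 : Continuous Φ := hΦ.continuous
  have k11 : Continuous (Dz Φ) := hc _ hΦ
  have kζ : Continuous ζ := continuous_iff_continuousAt.2 fun r => (hζ r).continuousAt
  have kq : Continuous q := continuous_recip hε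
  have hM : ∀ r ∈ Icc ε R, HasDerivAt (fun r => ζ r ^ 4 * q r)
      (4 * ζ r ^ 3 * ζ' r * q r - ζ r ^ 4 * q r ^ 2) r := fun r hr =>
    (((hζ r).fun_pow 4).fun_mul (hasDerivAt_recip hε hr.1)).congr_deriv (by
      simp only [Nat.cast_ofNat, Nat.add_one_sub_one, ← hq]; ring)
  have i1 := integral_box_dt (ε := ε) (R := R) (a := a) hs
    (A := fun x => 1 / 2 * X x ^ 2 * (ζ x.1.1 ^ 4 * q x.1.1))
    (A' := fun x => X x * Dt X x * (ζ x.1.1 ^ 4 * q x.1.1)) (by fun_prop) (by fun_prop)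
    (fun x t => ((((hasDerivAt_Dt hX1 x t).fun_pow 2).const_mul (1 / 2)).mul_const
      (ζ x.1 ^ 4 * q x.1)).congr_deriv (by
        simp only [Nat.cast_ofNat, Nat.add_one_sub_one]; ring))
  -- With the divergence equation, the derivative of the factor `1 / r` in the weight cancels the
  -- stretching term exactly; only the part with `ζ'` remains. The flux vanishes at `ε` because `X`
  -- does, and at `R` because `ζ` does.
  have i2 := integral_box_dr_eq_zero (a := a) (s := s) hR.le
    (A := fun x => 1 / 2 * (U x * X x ^ 2 * (ζ x.1.1 ^ 4 * q x.1.1))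
      - ν * (Dr X x * X x * (ζ x.1.1 ^ 4 * q x.1.1)))
    (A' := fun x => 1 / 2 * ((Dr U x * X x ^ 2 + U x * (2 * X x * Dr X x))
        * (ζ x.1.1 ^ 4 * q x.1.1) + U x * X x ^ 2
          * (4 * ζ x.1.1 ^ 3 * ζ' x.1.1 * q x.1.1 - ζ x.1.1 ^ 4 * q x.1.1 ^ 2))
      - ν * ((Dr (Dr X) x * X x + Dr X x * Dr X x) * (ζ x.1.1 ^ 4 * q x.1.1) + Dr X x * X x
          * (4 * ζ x.1.1 ^ 3 * ζ' x.1.1 * q x.1.1 - ζ x.1.1 ^ 4 * q x.1.1 ^ 2))) (by fun_prop)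
    (fun r hr z t => (((((hasDerivAt_Dr hU r z t).fun_mul ((hasDerivAt_Dr hX1 r z t).fun_pow
      2)).fun_mul (hM r hr)).const_mul (1 / 2)).fun_sub ((((hasDerivAt_Dr (hD _) r z t).fun_mul
      (hasDerivAt_Dr hX1 r z t)).fun_mul (hM r hr)).const_mul ν)).congr_deriv (by
        simp only [Nat.cast_ofNat, Nat.add_one_sub_one]; ring))
    (fun z hz t ht => by simp [hXε z hz t ht]) (fun z hz t ht => by simp [hζR])
  -- The last term of this flux moves the `z`-derivative of the swirl source from `Φ²` onto `X`.
  have i3 := integral_box_dz_eq_zero (ε := ε) (R := R) (s := s) ha.le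
    (A := fun x => (1 / 2 * (V x * X x ^ 2)
      - ν * (Dz X x * X x) - Φ x ^ 2 * X x * q x.1.1) * (ζ x.1.1 ^ 4 * q x.1.1))
    (A' := fun x => (1 / 2 * (Dz V x * X x ^ 2 + V x * (2 * X x * Dz X x))
      - ν * (Dz (Dz X) x * X x + Dz X x * Dz X x)
      - (2 * Φ x * Dz Φ x * X x + Φ x ^ 2 * Dz X x) * q x.1.1) * (ζ x.1.1 ^ 4 * q x.1.1))
    (by fun_prop)
    (fun r z t => ((((((hasDerivAt_Dz hV r z t).fun_mul ((hasDerivAt_Dz hX1 r z t).fun_pow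
      2)).const_mul (1 / 2)).fun_sub (((hasDerivAt_Dz (hD _) r z t).fun_mul
      (hasDerivAt_Dz hX1 r z t)).const_mul ν)).fun_sub ((((hasDerivAt_Dz hΦ r z t).fun_pow
      2).fun_mul (hasDerivAt_Dz hX1 r z t)).mul_const (q r))).mul_const
      (ζ r ^ 4 * q r)).congr_deriv (by simp only [Nat.cast_ofNat, Nat.add_one_sub_one]; ring))
    (fun r hr t ht => by simp [hXa r hr t ht])
  rw [← i1, ← integral_const_mul, ← add_zero (∫ x, X x * Dt X x * _ ∂_), ← i2, ← integral_add
    (integrable_box (by fun_prop)) (integrable_box (by fun_prop)), ← add_zero (∫ x, _ + _ ∂_),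
    ← i3, ← integral_add (integrable_box (by fun_prop)) (integrable_box (by fun_prop)),
    ← integral_add (integrable_box (by fun_prop)) (integrable_box (by fun_prop))]
  refine integral_box_congr fun r hr z hz t ht => ?_
  have h1 := hdiv r hr z hz t ht
  have h2 := hF r hr z hz t ht
  have h3 : q r * r = 1 := recip_mul hε hr.1.le
  simp only at h1 h2 ⊢
  rw [h2]
  generalize q r = q at *
  linear_combination (1 / 2 * X ((r, z), t) ^ 2 * (ζ r ^ 4 * q)) * h1
    + (ν * q * (Dr X ((r, z), t) * ζ r ^ 2 + X ((r, z), t)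
        * (2 * ζ r * ζ' r - ζ r ^ 2 * q)) ^ 2 + ν * q * Dz X ((r, z), t) ^ 2 * ζ r ^ 4
      - 4 * ν * X ((r, z), t) ^ 2 * q * ζ r ^ 2 * ζ' r ^ 2
      + Φ ((r, z), t) ^ 2 * ζ r ^ 4 * Dz X ((r, z), t) * q ^ 2) * h3

/-- Energy inequality for `v_φ² ζ² / r`. -/
lemma swirl_energy (hν : 0 ≤ ν) (hε : 0 < ε) (hR : ε < R) (ha : 0 < a) (hs : 0 ≤ s)
    (hU : ContDiff ℝ 1 U) (hV : ContDiff ℝ 1 V) (hΦ : ContDiff ℝ 2 Φ)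
    (_hF0 : Continuous F) (hζ : ∀ r, HasDerivAt ζ (ζ' r) r) (hζ' : Continuous ζ') (hζR : ζ R = 0)
    (hdiv : ∀ r ∈ Ioo ε R, ∀ z ∈ Ioo (-a) a, ∀ t ∈ Ioo 0 s,
      Dr U ((r, z), t) + Dz V ((r, z), t) + U ((r, z), t) * recip ε r = 0)
    (hF : ∀ r ∈ Ioo ε R, ∀ z ∈ Ioo (-a) a, ∀ t ∈ Ioo 0 s, F ((r, z), t)
      = Dt Φ ((r, z), t) + U ((r, z), t) * Dr Φ ((r, z), t) + V ((r, z), t) * Dz Φ ((r, z), t)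
        + U ((r, z), t) * recip ε r * Φ ((r, z), t)
        - ν * (Dr (Dr Φ) ((r, z), t) + recip ε r * Dr Φ ((r, z), t) + Dz (Dz Φ) ((r, z), t))
        + ν * recip ε r ^ 2 * Φ ((r, z), t))
    (hUε : ∀ z ∈ Ioo (-a) a, ∀ t ∈ Ioo 0 s, U ((ε, z), t) = 0)
    (hΦε : ∀ z ∈ Ioo (-a) a, ∀ t ∈ Ioo 0 s, Dr Φ ((ε, z), t) = Φ ((ε, z), t) * recip ε ε)
    (hVa : ∀ r ∈ Ioo ε R, ∀ t ∈ Ioo 0 s, V ((r, -a), t) = 0 ∧ V ((r, a), t) = 0)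
    (hΦa : ∀ r ∈ Ioo ε R, ∀ t ∈ Ioo 0 s, Dz Φ ((r, -a), t) = 0 ∧ Dz Φ ((r, a), t) = 0) :
    ∫ x, 1 / 4 * Φ (x, s) ^ 4 * (ζ x.1 ^ 4 * recip ε x.1) ∂rect ε R a
      - ∫ x, 1 / 4 * Φ (x, 0) ^ 4 * (ζ x.1 ^ 4 * recip ε x.1) ∂rect ε R a
      + 3 / 4 * ν * ∫ x, ((2 * Φ x * Dr Φ x * (ζ x.1.1 ^ 2 * recip ε x.1.1) + Φ x ^ 2
          * (2 * ζ x.1.1 * ζ' x.1.1 * recip ε x.1.1 - ζ x.1.1 ^ 2 * recip ε x.1.1 ^ 2)) ^ 2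
        + (2 * Φ x * Dz Φ x * (ζ x.1.1 ^ 2 * recip ε x.1.1)) ^ 2
        + (Φ x ^ 2 * (ζ x.1.1 ^ 2 * recip ε x.1.1)) ^ 2 * recip ε x.1.1 ^ 2) * x.1.1 ∂box ε R a s
      ≤ ∫ x, (F x * Φ x ^ 3 * (ζ x.1.1 ^ 4 * recip ε x.1.1)
        - 3 / 2 * U x * recip ε x.1.1 * Φ x ^ 4 * (ζ x.1.1 ^ 4 * recip ε x.1.1)
        + U x * Φ x ^ 4 * ζ x.1.1 ^ 3 * ζ' x.1.1 * recip ε x.1.1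
        + ν * (2 * Φ x ^ 3 * Dr Φ x * ζ x.1.1 ^ 3 * ζ' x.1.1 * recip ε x.1.1
          + 3 * Φ x ^ 4 * ζ x.1.1 ^ 2 * ζ' x.1.1 ^ 2 * recip ε x.1.1
          - 2 * Φ x ^ 4 * ζ x.1.1 ^ 3 * ζ' x.1.1 * recip ε x.1.1 ^ 2)) ∂box ε R a s := by
  set q := recip ε with hq
  have hΦ1 : ContDiff ℝ 1 Φ := hΦ.of_le (by norm_num)
  have hD : ∀ e, ContDiff ℝ 1 (Dir e Φ) := fun e =>
    contDiff_Dir (n := 2) (m := 1) e hΦ (by norm_num)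
  have hc : ∀ {f} e, ContDiff ℝ 1 f → Continuous (Dir e f) := fun e hf =>
    (contDiff_Dir (n := 1) (m := 0) e hf (by norm_num)).continuous
  have k0 : Continuous Φ := hΦ.continuous
  have k1 : Continuous (Dr Φ) := hc _ hΦ1
  have k2 : Continuous (Dz Φ) := hc _ hΦ1
  have k3 : Continuous (Dt Φ) := hc _ hΦ1
  have k4 : Continuous (Dr (Dr Φ)) := hc _ (hD _)
  have k5 : Continuous (Dz (Dz Φ)) := hc _ (hD _)
  have k6 : Continuous U := hU.continuous
  have k7 : Continuous (Dr U) := hc _ hU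
  have k8 : Continuous V := hV.continuous
  have k9 : Continuous (Dz V) := hc _ hV
  have kζ : Continuous ζ := continuous_iff_continuousAt.2 fun r => (hζ r).continuousAt
  have kq : Continuous q := continuous_recip hε
  have hM : ∀ r ∈ Icc ε R, HasDerivAt (fun r => ζ r ^ 4 * q r)
      (4 * ζ r ^ 3 * ζ' r * q r - ζ r ^ 4 * q r ^ 2) r := fun r hr =>
    (((hζ r).fun_pow 4).fun_mul (hasDerivAt_recip hε hr.1)).congr_deriv (by
      simp only [Nat.cast_ofNat, Nat.add_one_sub_one, ← hq]; ring)
  have hM2 : ∀ r ∈ Icc ε R, HasDerivAt (fun r => ζ r ^ 4 * q r ^ 2)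
      (4 * ζ r ^ 3 * ζ' r * q r ^ 2 - 2 * ζ r ^ 4 * q r ^ 3) r := fun r hr =>
    (((hζ r).fun_pow 4).fun_mul ((hasDerivAt_recip hε hr.1).fun_pow 2)).congr_deriv (by
      simp only [Nat.cast_ofNat, Nat.add_one_sub_one, ← hq]; ring)
  have i1 := integral_box_dt (ε := ε) (R := R) (a := a) hs
    (A := fun x => 1 / 4 * Φ x ^ 4 * (ζ x.1.1 ^ 4 * q x.1.1))
    (A' := fun x => Φ x ^ 3 * Dt Φ x * (ζ x.1.1 ^ 4 * q x.1.1)) (by fun_prop) (by fun_prop)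
    (fun x t => ((((hasDerivAt_Dt hΦ1 x t).fun_pow 4).const_mul (1 / 4)).mul_const
      (ζ x.1 ^ 4 * q x.1)).congr_deriv (by
        simp only [Nat.cast_ofNat, Nat.add_one_sub_one]; ring))
  -- Once `3/4` of `|∇w|² + w² / r²` is split off, the viscous terms leave, up to `ζ'`, the exact
  -- derivative of `Φ⁴ ζ⁴ / r²` with factor `ν / 4`. It is added to the flux here.
  have i2 := integral_box_dr_nonneg (a := a) (s := s) hR.le
    (A := fun x => (1 / 4 * (U x * Φ x ^ 4)
      - ν * (Dr Φ x * Φ x ^ 3)) * (ζ x.1.1 ^ 4 * q x.1.1)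
      + ν / 4 * (Φ x ^ 4 * (ζ x.1.1 ^ 4 * q x.1.1 ^ 2)))
    (A' := fun x => (1 / 4 * (Dr U x * Φ x ^ 4 + U x * (4 * Φ x ^ 3 * Dr Φ x))
        - ν * (Dr (Dr Φ) x * Φ x ^ 3 + Dr Φ x * (3 * Φ x ^ 2 * Dr Φ x)))
        * (ζ x.1.1 ^ 4 * q x.1.1) + (1 / 4 * (U x * Φ x ^ 4) - ν * (Dr Φ x * Φ x ^ 3))
          * (4 * ζ x.1.1 ^ 3 * ζ' x.1.1 * q x.1.1 - ζ x.1.1 ^ 4 * q x.1.1 ^ 2)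
      + ν / 4 * (4 * Φ x ^ 3 * Dr Φ x * (ζ x.1.1 ^ 4 * q x.1.1 ^ 2) + Φ x ^ 4
          * (4 * ζ x.1.1 ^ 3 * ζ' x.1.1 * q x.1.1 ^ 2 - 2 * ζ x.1.1 ^ 4 * q x.1.1 ^ 3)))
    (by fun_prop)
    (fun r hr z t => ((((((hasDerivAt_Dr hU r z t).fun_mul ((hasDerivAt_Dr hΦ1 r z t).fun_pow
      4)).const_mul (1 / 4)).fun_sub (((hasDerivAt_Dr (hD _) r z t).fun_mul
      ((hasDerivAt_Dr hΦ1 r z t).fun_pow 3)).const_mul ν)).fun_mul (hM r hr)).fun_add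
      ((((hasDerivAt_Dr hΦ1 r z t).fun_pow 4).fun_mul (hM2 r hr)).const_mul
        (ν / 4))).congr_deriv (by
        simp only [Nat.cast_ofNat, Nat.add_one_sub_one]))
    -- At `r = ε` the slip condition `Φ_r = Φ / r` makes the flux `(-1 + 1/4) ν Φ⁴ ζ⁴ / r² ≤ 0`.
    -- This sign is the only reason for an inequality instead of an identity.
    (fun z hz t ht => by
      simp only [hζR, hUε z hz t ht, hΦε z hz t ht]
      have : 0 ≤ ν * (Φ ((ε, z), t) ^ 4 * (ζ ε ^ 4 * q ε ^ 2)) := by positivity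
      nlinarith)
  have i3 := integral_box_dz_eq_zero (ε := ε) (R := R) (s := s) ha.le
    (A := fun x => (1 / 4 * (V x * Φ x ^ 4)
      - ν * (Dz Φ x * Φ x ^ 3)) * (ζ x.1.1 ^ 4 * q x.1.1))
    (A' := fun x => (1 / 4 * (Dz V x * Φ x ^ 4 + V x * (4 * Φ x ^ 3 * Dz Φ x))
      - ν * (Dz (Dz Φ) x * Φ x ^ 3 + Dz Φ x * (3 * Φ x ^ 2 * Dz Φ x)))
        * (ζ x.1.1 ^ 4 * q x.1.1))
    (by fun_prop)
    (fun r z t => (((((hasDerivAt_Dz hV r z t).fun_mul ((hasDerivAt_Dz hΦ1 r z t).fun_pow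
      4)).const_mul (1 / 4)).fun_sub (((hasDerivAt_Dz (hD _) r z t).fun_mul
      ((hasDerivAt_Dz hΦ1 r z t).fun_pow 3)).const_mul ν)).mul_const
      (ζ r ^ 4 * q r)).congr_deriv (by simp only [Nat.cast_ofNat, Nat.add_one_sub_one]))
    (fun r hr t ht => by simp [hVa r hr t ht, hΦa r hr t ht])
  rw [← i1]
  refine (le_add_of_nonneg_right i2).trans ?_
  rw [← integral_const_mul, ← add_zero (∫ x, Φ x ^ 3 * Dt Φ x * _ ∂_), ← i3, ← integral_add
    (integrable_box (by fun_prop)) (integrable_box (by fun_prop)), ← integral_add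
    (integrable_box (by fun_prop)) (integrable_box (by fun_prop)),
    ← integral_add (integrable_box (by fun_prop)) (integrable_box (by fun_prop))]
  refine (integral_box_congr fun r hr z hz t ht => ?_).le
  have h1 := hdiv r hr z hz t ht
  have h2 := hF r hr z hz t ht
  have h3 : q r * r = 1 := recip_mul hε hr.1.le
  simp only at h1 h2 ⊢
  rw [h2]
  generalize q r = q at *
  linear_combination (1 / 4 * Φ ((r, z), t) ^ 4 * (ζ r ^ 4 * q)) * h1
    + (3 / 4 * ν * q * ((2 * Φ ((r, z), t) * Dr Φ ((r, z), t) * ζ r ^ 2 + Φ ((r, z), t) ^ 2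
        * (2 * ζ r * ζ' r - ζ r ^ 2 * q)) ^ 2 + (2 * Φ ((r, z), t) * Dz Φ ((r, z), t)
          * ζ r ^ 2) ^ 2 + Φ ((r, z), t) ^ 4 * ζ r ^ 4 * q ^ 2)) * h3

/-- Weighted estimate for `W = v_r ζ² / r`, from the elliptic equation
`W_zz + W_rr + 3 W_r / r = (χ ζ² / r)_z + P`. -/
lemma elliptic_estimate (hε : 0 < ε) (hR : ε < R) (ha : 0 < a)
    (hU : ContDiff ℝ 2 U) (hX : ContDiff ℝ 1 X)
    (hζ : ∀ r, HasDerivAt ζ (ζ' r) r) (hζ' : ∀ r, HasDerivAt ζ' (ζ'' r) r)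
    (hζ'' : Continuous ζ'') (hζR : ζ R = 0)
    (hX' : ∀ r ∈ Ioo ε R, ∀ z ∈ Ioo (-a) a, ∀ t ∈ Ioo 0 s, Dz X ((r, z), t)
      = Dz (Dz U) ((r, z), t) + Dr (Dr U) ((r, z), t) + Dr U ((r, z), t) * recip ε r
        - U ((r, z), t) * recip ε r ^ 2)
    (hUε : ∀ z ∈ Ioo (-a) a, ∀ t ∈ Ioo 0 s, U ((ε, z), t) = 0)
    (hUR : ∀ z ∈ Ioo (-a) a, ∀ t ∈ Ioo 0 s, U ((R, z), t) = 0)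
    (hUrε : ∀ z ∈ Ioo (-a) a, ∀ t ∈ Ioo 0 s, Dr U ((ε, z), t) = 0)
    (hUzε : ∀ z ∈ Ioo (-a) a, ∀ t ∈ Ioo 0 s, Dz U ((ε, z), t) = 0)
    (hUza : ∀ r ∈ Ioo ε R, ∀ t ∈ Ioo 0 s, Dz U ((r, -a), t) = 0 ∧ Dz U ((r, a), t) = 0) :
    ∫ x, (U x * (ζ x.1.1 ^ 2 * recip ε x.1.1)) ^ 2 * recip ε x.1.1 ^ 3 ∂box ε R a s
      ≤ 1 / 9 * ∫ x, (Dz X x * (ζ x.1.1 ^ 2 * recip ε x.1.1)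
        + (2 * Dr U x * (2 * ζ x.1.1 * ζ' x.1.1) * recip ε x.1.1
          + U x * ((2 * ζ' x.1.1 ^ 2 + 2 * ζ x.1.1 * ζ'' x.1.1) * recip ε x.1.1
            + 2 * ζ x.1.1 * ζ' x.1.1 * recip ε x.1.1 ^ 2))) ^ 2 * x.1.1 ∂box ε R a s := by
  set q := recip ε with hq
  have hU1 : ContDiff ℝ 1 U := hU.of_le (by norm_num)
  have hD : ∀ e, ContDiff ℝ 1 (Dir e U) := fun e =>
    contDiff_Dir (n := 2) (m := 1) e hU (by norm_num)
  have hc : ∀ {f} e, ContDiff ℝ 1 f → Continuous (Dir e f) := fun e hf =>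
    (contDiff_Dir (n := 1) (m := 0) e hf (by norm_num)).continuous
  have k0 : Continuous U := hU.continuous
  have k1 : Continuous (Dr U) := hc _ hU1
  have k2 : Continuous (Dz U) := hc _ hU1
  have k3 : Continuous (Dr (Dr U)) := hc _ (hD _)
  have k4 : Continuous (Dz (Dz U)) := hc _ (hD _)
  have k5 : Continuous (Dz (Dr U)) := hc _ (hD _)
  have k6 : Continuous (Dz X) := hc _ hX
  have kζ : Continuous ζ := continuous_iff_continuousAt.2 fun r => (hζ r).continuousAt
  have kζ' : Continuous ζ' := continuous_iff_continuousAt.2 fun r => (hζ' r).continuousAt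
  have kq : Continuous q := continuous_recip hε
  set m : ℝ → ℝ := fun r => ζ r ^ 2 * q r with hm
  set m' : ℝ → ℝ := fun r => 2 * ζ r * ζ' r * q r - ζ r ^ 2 * q r ^ 2 with hm'
  set m'' : ℝ → ℝ := fun r => (2 * ζ' r ^ 2 + 2 * ζ r * ζ'' r) * q r
    - 4 * ζ r * ζ' r * q r ^ 2 + 2 * ζ r ^ 2 * q r ^ 3 with hm''
  have km : Continuous m := by fun_prop
  have km' : Continuous m' := by fun_prop
  have km'' : Continuous m'' := by fun_prop
  have dm : ∀ r ∈ Icc ε R, HasDerivAt m (m' r) r := fun r hr =>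
    (((hζ r).fun_pow 2).fun_mul (hasDerivAt_recip hε hr.1)).congr_deriv (by
      simp only [Nat.cast_ofNat, Nat.add_one_sub_one, ← hq, hm']; ring)
  have dm' : ∀ r ∈ Icc ε R, HasDerivAt m' (m'' r) r := fun r hr =>
    (((((hζ r).const_mul 2).fun_mul (hζ' r)).fun_mul (hasDerivAt_recip hε hr.1)).fun_sub
      (((hζ r).fun_pow 2).fun_mul ((hasDerivAt_recip hε hr.1).fun_pow 2))).congr_deriv (by
      simp only [Nat.cast_ofNat, Nat.add_one_sub_one, ← hq, hm'']; ring)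
  have mR : m R = 0 := by simp [hm, hζR]
  have hWr : ∀ r ∈ Icc ε R, ∀ z t, HasDerivAt (fun x => U ((x, z), t) * m x)
      (Dr U ((r, z), t) * m r + U ((r, z), t) * m' r) r := fun r hr z t =>
    (hasDerivAt_Dr hU1 r z t).fun_mul (dm r hr)
  have hWrr : ∀ r ∈ Icc ε R, ∀ z t, HasDerivAt (fun x => Dr U ((x, z), t) * m x
      + U ((x, z), t) * m' x) (Dr (Dr U) ((r, z), t) * m r + 2 * Dr U ((r, z), t) * m' r
      + U ((r, z), t) * m'' r) r := fun r hr z t =>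
    (((hasDerivAt_Dr (hD _) r z t).fun_mul (dm r hr)).fun_add
      ((hasDerivAt_Dr hU1 r z t).fun_mul (dm' r hr))).congr_deriv (by ring)
  have hcomm : Dr (Dz U) = Dz (Dr U) := Dir_comm _ _ hU
  -- Hardy's inequality
  have i1 := integral_box_dr_eq_zero (a := a) (s := s) hR.le
    (A := fun x => (U x * m x.1.1) ^ 2 * q x.1.1 ^ 2)
    (A' := fun x => 2 * (U x * m x.1.1) * (Dr U x * m x.1.1 + U x * m' x.1.1) * q x.1.1 ^ 2
      - 2 * (U x * m x.1.1) ^ 2 * q x.1.1 ^ 3) (by fun_prop)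
    (fun r hr z t => (((hWr r hr z t).fun_pow 2).fun_mul
      ((hasDerivAt_recip hε hr.1).fun_pow 2)).congr_deriv (by
        simp only [Nat.cast_ofNat, Nat.add_one_sub_one, ← hq]; ring))
    (fun z hz t ht => by simp [hUε z hz t ht]) (fun z hz t ht => by simp [mR])
  have hardy : ∫ x, (U x * m x.1.1) ^ 2 * q x.1.1 ^ 3 ∂box ε R a s
      ≤ ∫ x, (Dr U x * m x.1.1 + U x * m' x.1.1) ^ 2 * q x.1.1 ∂box ε R a s := by
    rw [← sub_zero (∫ x, (_ + _) ^ 2 * _ ∂_), ← i1, ← integral_sub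
      (integrable_box (by fun_prop)) (integrable_box (by fun_prop))]
    refine integral_box_mono (by fun_prop) (by fun_prop) fun r hr z _ t _ => ?_
    have hq0 : 0 ≤ q r := by
      rw [hq, recip_eq hε hr.1.le]; exact inv_nonneg.2 (hε.trans hr.1).le
    have := mul_nonneg hq0 (sq_nonneg (Dr U ((r, z), t) * m r + U ((r, z), t) * m' r
      - U ((r, z), t) * m r * q r))
    simp only
    linarith
  -- Together with `i3` this says `∫ W_r (W_rr + W_zz) = 0`, because `W_r W_zz = (W_r W_z)_z - (W_z²
  -- / 2)_r`. At `r = ε` it needs `U_r = 0` as well as `U = 0`.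
  have i2 := integral_box_dr_eq_zero (a := a) (s := s) hR.le
    (A := fun x => 1 / 2 * (Dr U x * m x.1.1 + U x * m' x.1.1) ^ 2
      - 1 / 2 * (Dz U x * m x.1.1) ^ 2)
    (A' := fun x => (Dr U x * m x.1.1 + U x * m' x.1.1) * (Dr (Dr U) x * m x.1.1
        + 2 * Dr U x * m' x.1.1 + U x * m'' x.1.1)
      - Dz U x * m x.1.1 * (Dz (Dr U) x * m x.1.1 + Dz U x * m' x.1.1)) (by fun_prop)
    (fun r hr z t => ((((hWrr r hr z t).fun_pow 2).const_mul (1 / 2)).fun_sub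
      ((((hasDerivAt_Dr (hD _) r z t).fun_mul (dm r hr)).fun_pow 2).const_mul
        (1 / 2))).congr_deriv (by
        rw [hcomm]
        simp only [Nat.cast_ofNat, Nat.add_one_sub_one]; ring))
    (fun z hz t ht => by simp [hUε z hz t ht, hUrε z hz t ht, hUzε z hz t ht])
    (fun z hz t ht => by simp [mR, hUR z hz t ht])
  have i3 := integral_box_dz_eq_zero (ε := ε) (R := R) (s := s) ha.le
    (A := fun x => (Dz U x * m x.1.1) * (Dr U x * m x.1.1 + U x * m' x.1.1))
    (A' := fun x => (Dz (Dz U) x * m x.1.1) * (Dr U x * m x.1.1 + U x * m' x.1.1)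
      + (Dz U x * m x.1.1) * (Dz (Dr U) x * m x.1.1 + Dz U x * m' x.1.1)) (by fun_prop)
    (fun r z t => ((hasDerivAt_Dz (hD _) r z t).mul_const (m r)).fun_mul
      (((hasDerivAt_Dz (hD _) r z t).mul_const (m r)).fun_add
        ((hasDerivAt_Dz hU1 r z t).mul_const (m' r))))
    (fun r hr t ht => by simp [hUza r hr t ht])
  refine hardy.trans ?_
  set S : (ℝ × ℝ) × ℝ → ℝ := fun x => Dz X x * (ζ x.1.1 ^ 2 * q x.1.1)
    + (2 * Dr U x * (2 * ζ x.1.1 * ζ' x.1.1) * q x.1.1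
      + U x * ((2 * ζ' x.1.1 ^ 2 + 2 * ζ x.1.1 * ζ'' x.1.1) * q x.1.1
        + 2 * ζ x.1.1 * ζ' x.1.1 * q x.1.1 ^ 2)) with hS
  have kS : Continuous S := by fun_prop
  -- `S` is the right-hand side of the equation of `W`, so `W_r S` equals `W_r (W_rr + W_zz) + 3
  -- W_r² / r`. Young's inequality `W_r S ≤ (3/2) W_r² / r + (1/6) S² r` then gives the factor
  -- `1/9`.
  have key : ∫ x, (3 / 2 * ((Dr U x * m x.1.1 + U x * m' x.1.1) ^ 2 * q x.1.1)
      + (((Dr U x * m x.1.1 + U x * m' x.1.1) * (Dr (Dr U) x * m x.1.1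
        + 2 * Dr U x * m' x.1.1 + U x * m'' x.1.1)
      - Dz U x * m x.1.1 * (Dz (Dr U) x * m x.1.1 + Dz U x * m' x.1.1))
      + ((Dz (Dz U) x * m x.1.1) * (Dr U x * m x.1.1 + U x * m' x.1.1)
      + (Dz U x * m x.1.1) * (Dz (Dr U) x * m x.1.1 + Dz U x * m' x.1.1)))) ∂box ε R a s
      ≤ ∫ x, 1 / 6 * (S x ^ 2 * x.1.1) ∂box ε R a s := by
    refine integral_box_mono (by fun_prop) (by fun_prop) fun r hr z hz t ht => ?_
    have hq0 : 0 ≤ q r := by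
      rw [hq, recip_eq hε hr.1.le]; exact inv_nonneg.2 (hε.trans hr.1).le
    have h3 : q r * r = 1 := recip_mul hε hr.1.le
    have h1 := hX' r hr z hz t ht
    have hSW : S ((r, z), t) = Dz (Dz U) ((r, z), t) * m r + (Dr (Dr U) ((r, z), t) * m r
        + 2 * Dr U ((r, z), t) * m' r + U ((r, z), t) * m'' r)
        + 3 * q r * (Dr U ((r, z), t) * m r + U ((r, z), t) * m' r) := by
      simp only [hS, hm, hm', hm'', h1]
      ring
    have h4 := mul_nonneg hq0 (sq_nonneg (3 * (Dr U ((r, z), t) * m r + U ((r, z), t) * m' r)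
      - S ((r, z), t) * r))
    simp only
    generalize hw : Dr U ((r, z), t) * m r + U ((r, z), t) * m' r = w at *
    generalize S ((r, z), t) = σ at *
    generalize q r = q at *
    have h5 : q * (3 * w - σ * r) ^ 2 = 9 * (w ^ 2 * q) - 6 * σ * w + σ ^ 2 * r := by
      linear_combination (σ ^ 2 * r - 6 * σ * w) * h3
    rw [h5] at h4
    have h6 : w * σ = Dz (Dz U) ((r, z), t) * m r * w + w * (Dr (Dr U) ((r, z), t) * m r
        + 2 * Dr U ((r, z), t) * m' r + U ((r, z), t) * m'' r) + 3 * (w ^ 2 * q) := by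
      rw [hSW]; ring
    linarith
  rw [integral_add (integrable_box (by fun_prop)) (integrable_box (by fun_prop)),
    integral_add (integrable_box (by fun_prop)) (integrable_box (by fun_prop)), i2, i3,
    integral_const_mul, integral_const_mul] at key
  linarith

/-- Poincaré's inequality in the vertical direction. -/
lemma poincare_vertical (hε : 0 < ε) (ha : 0 < a) {G Gz : (ℝ × ℝ) × ℝ → ℝ}
    (hG : Continuous G) (hGz : Continuous Gz)
    (hd : ∀ r z t, HasDerivAt (fun x => G ((r, x), t)) (Gz ((r, z), t)) z)
    (hb : ∀ r ∈ Ioo ε R, ∀ t ∈ Ioo 0 s, G ((r, -a), t) = 0 ∧ G ((r, a), t) = 0) :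
    ∫ x, G x ^ 2 * x.1.1 ∂box ε R a s ≤ 4 * a ^ 2 * ∫ x, Gz x ^ 2 * x.1.1 ∂box ε R a s := by
  -- The flux `z G² r` vanishes at `z = ± a`. Pointwise, `(G + 2 z G_z)² ≥ 0` means `G² ≤ 2 (G² + 2
  -- z G G_z) + 4 z² G_z²`, whence the constant `4 a²`.
  have i := integral_box_dz_eq_zero (ε := ε) (R := R) (s := s) ha.le
    (A := fun x => x.1.2 * G x ^ 2 * x.1.1)
    (A' := fun x => (G x ^ 2 + x.1.2 * (2 * G x * Gz x)) * x.1.1) (by fun_prop)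
    (fun r z t => (((hasDerivAt_id' z).fun_mul ((hd r z t).fun_pow 2)).mul_const r).congr_deriv
      (by simp only [Nat.cast_ofNat, Nat.add_one_sub_one]; ring))
    (fun r hr t ht => by simp [hb r hr t ht])
  have key : ∫ x, G x ^ 2 * x.1.1 ∂box ε R a s ≤ ∫ x, (2 * ((G x ^ 2 + x.1.2 * (2 * G x * Gz x))
      * x.1.1) + 4 * a ^ 2 * (Gz x ^ 2 * x.1.1)) ∂box ε R a s := by
    refine integral_box_mono (by fun_prop) (by fun_prop) fun r hr z hz t _ => ?_
    have hr0 : 0 < r := hε.trans hr.1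
    simp only
    generalize G ((r, z), t) = g
    generalize Gz ((r, z), t) = w
    have hz2 : z ^ 2 ≤ a ^ 2 := sq_le_sq' hz.1.le hz.2.le
    have h1 : 0 ≤ (g + 2 * z * w) ^ 2 := sq_nonneg _
    have h2 : z ^ 2 * w ^ 2 ≤ a ^ 2 * w ^ 2 := mul_le_mul_of_nonneg_right hz2 (sq_nonneg _)
    have h3 : 0 ≤ g ^ 2 + 4 * z * g * w + 4 * a ^ 2 * w ^ 2 := by nlinarith
    have h4 := mul_nonneg hr0.le h3
    linarith
  rw [integral_add (integrable_box (by fun_prop)) (integrable_box (by fun_prop)),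
    integral_const_mul, integral_const_mul, i] at key
  linarith

end Identities

/-! ### Energy estimates -/

/-- A cut-off function near the axis with its derivatives and their bounds. -/
structure IsCutoff (C r₀ : ℝ) (ζ ζ' ζ'' : ℝ → ℝ) : Prop where
  hasDeriv : ∀ r, HasDerivAt ζ (ζ' r) r
  hasDeriv' : ∀ r, HasDerivAt ζ' (ζ'' r) r
  cont'' : Continuous ζ''
  bound : ∀ r, |ζ r| ≤ C
  bound' : ∀ r, |ζ' r| ≤ C * (1 / r₀)
  bound'' : ∀ r, |ζ'' r| ≤ C * (1 / r₀) ^ 2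
  zero : ∀ r, 2 * r₀ ≤ r → ζ r = 0
  zero' : ∀ r, r ≤ r₀ → ζ' r = 0
  zero'' : ∀ r, r ≤ r₀ → ζ'' r = 0

/-- What the estimates use about the flow `(U, Φ, V)`, its azimuthal vorticity `X`, the rotation
`F` of the meridional force and the azimuthal force `f`. -/
structure IsFlow (ν ε R a s : ℝ) (U V Φ X F f : (ℝ × ℝ) × ℝ → ℝ) : Prop where
  smooth_U : ContDiff ℝ 2 U
  smooth_V : ContDiff ℝ 2 V
  smooth_Φ : ContDiff ℝ 2 Φ
  smooth_X : ContDiff ℝ 2 X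
  cont_F : Continuous F
  cont_f : Continuous f
  div : ∀ r ∈ Ioo ε R, ∀ z ∈ Ioo (-a) a, ∀ t ∈ Ioo 0 s,
    Dr U ((r, z), t) + Dz V ((r, z), t) + U ((r, z), t) * recip ε r = 0
  vort : X = Dz U - Dr V
  vort_z : ∀ r ∈ Ioo ε R, ∀ z ∈ Ioo (-a) a, ∀ t ∈ Ioo 0 s, Dz X ((r, z), t)
    = Dz (Dz U) ((r, z), t) + Dr (Dr U) ((r, z), t) + Dr U ((r, z), t) * recip ε r
      - U ((r, z), t) * recip ε r ^ 2
  vort_eq : ∀ r ∈ Ioo ε R, ∀ z ∈ Ioo (-a) a, ∀ t ∈ Ioo 0 s, F ((r, z), t)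
    = Dt X ((r, z), t) + U ((r, z), t) * Dr X ((r, z), t) + V ((r, z), t) * Dz X ((r, z), t)
      - U ((r, z), t) * recip ε r * X ((r, z), t)
      - ν * (Dr (Dr X) ((r, z), t) + recip ε r * Dr X ((r, z), t) + Dz (Dz X) ((r, z), t)
        - recip ε r ^ 2 * X ((r, z), t))
      - 2 * recip ε r * Φ ((r, z), t) * Dz Φ ((r, z), t)
  swirl_eq : ∀ r ∈ Ioo ε R, ∀ z ∈ Ioo (-a) a, ∀ t ∈ Ioo 0 s, f ((r, z), t)
    = Dt Φ ((r, z), t) + U ((r, z), t) * Dr Φ ((r, z), t) + V ((r, z), t) * Dz Φ ((r, z), t)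
      + U ((r, z), t) * recip ε r * Φ ((r, z), t)
      - ν * (Dr (Dr Φ) ((r, z), t) + recip ε r * Dr Φ ((r, z), t) + Dz (Dz Φ) ((r, z), t))
      + ν * recip ε r ^ 2 * Φ ((r, z), t)
  U_inner : ∀ z ∈ Ioo (-a) a, ∀ t ∈ Ioo 0 s, U ((ε, z), t) = 0
  U_outer : ∀ z ∈ Ioo (-a) a, ∀ t ∈ Ioo 0 s, U ((R, z), t) = 0
  Ur_inner : ∀ z ∈ Ioo (-a) a, ∀ t ∈ Ioo 0 s, Dr U ((ε, z), t) = 0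
  Uz_inner : ∀ z ∈ Ioo (-a) a, ∀ t ∈ Ioo 0 s, Dz U ((ε, z), t) = 0
  Uz_flat : ∀ r ∈ Ioo ε R, ∀ t ∈ Ioo 0 s, Dz U ((r, -a), t) = 0 ∧ Dz U ((r, a), t) = 0
  V_flat : ∀ r ∈ Ioo ε R, ∀ t ∈ Ioo 0 s, V ((r, -a), t) = 0 ∧ V ((r, a), t) = 0
  X_inner : ∀ z ∈ Ioo (-a) a, ∀ t ∈ Ioo 0 s, X ((ε, z), t) = 0
  X_flat : ∀ r ∈ Ioo ε R, ∀ t ∈ Ioo 0 s, X ((r, -a), t) = 0 ∧ X ((r, a), t) = 0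
  Φr_inner : ∀ z ∈ Ioo (-a) a, ∀ t ∈ Ioo 0 s, Dr Φ ((ε, z), t) = Φ ((ε, z), t) * recip ε ε
  Φz_flat : ∀ r ∈ Ioo ε R, ∀ t ∈ Ioo 0 s, Dz Φ ((r, -a), t) = 0 ∧ Dz Φ ((r, a), t) = 0

lemma IsFlow.mono {ν ε R a s T : ℝ} {U V Φ X F f : (ℝ × ℝ) × ℝ → ℝ}
    (h : IsFlow ν ε R a T U V Φ X F f) (hs : s ≤ T) : IsFlow ν ε R a s U V Φ X F f := by
  have hI : ∀ {t}, t ∈ Ioo 0 s → t ∈ Ioo 0 T := fun ht => ⟨ht.1, ht.2.trans_le hs⟩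
  exact
  { h with
    div := fun r hr z hz t ht => h.div r hr z hz t (hI ht)
    vort_z := fun r hr z hz t ht => h.vort_z r hr z hz t (hI ht)
    vort_eq := fun r hr z hz t ht => h.vort_eq r hr z hz t (hI ht)
    swirl_eq := fun r hr z hz t ht => h.swirl_eq r hr z hz t (hI ht)
    U_inner := fun z hz t ht => h.U_inner z hz t (hI ht)
    U_outer := fun z hz t ht => h.U_outer z hz t (hI ht)
    Ur_inner := fun z hz t ht => h.Ur_inner z hz t (hI ht)
    Uz_inner := fun z hz t ht => h.Uz_inner z hz t (hI ht)
    Uz_flat := fun r hr t ht => h.Uz_flat r hr t (hI ht)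
    V_flat := fun r hr t ht => h.V_flat r hr t (hI ht)
    X_inner := fun z hz t ht => h.X_inner z hz t (hI ht)
    X_flat := fun r hr t ht => h.X_flat r hr t (hI ht)
    Φr_inner := fun z hz t ht => h.Φr_inner z hz t (hI ht)
    Φz_flat := fun r hr t ht => h.Φz_flat r hr t (hI ht) }

lemma IsSolution.isFlow {ν R a T ε : ℝ} {vr vφ vz p fr fφ fz ψ : Field}
    (h : IsSolution ν R a T ε vr vφ vz p fr fφ fz) (hψ : IsStreamFunction R a T ε vr vz ψ)
    (ha : 0 < a) (hε : 0 < ε) (hR : ε < R) :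
    IsFlow ν ε R a T (unc vr) (unc vz) (unc vφ) (vort vr vz) (vortForce ν ε vr vφ vz)
      (swirlForce ν ε vr vφ vz) := by
  have hr3 : ContDiff ℝ 3 (unc vr) := h.smooth_r.contDiff_unc
  have hz3 : ContDiff ℝ 3 (unc vz) := h.smooth_z.contDiff_unc
  have hφ3 : ContDiff ℝ 3 (unc vφ) := h.smooth_φ.contDiff_unc
  have hr2 : ContDiff ℝ 2 (unc vr) := hr3.of_le (by norm_num)
  have hz2 : ContDiff ℝ 2 (unc vz) := hz3.of_le (by norm_num)
  have hφ2 : ContDiff ℝ 2 (unc vφ) := hφ3.of_le (by norm_num)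
  have hDr : ∀ e, ContDiff ℝ 2 (Dir e (unc vr)) := fun e =>
    contDiff_Dir (n := 3) (m := 2) e hr3 (by norm_num)
  have hDz : ∀ e, ContDiff ℝ 2 (Dir e (unc vz)) := fun e =>
    contDiff_Dir (n := 3) (m := 2) e hz3 (by norm_num)
  have hX : ContDiff ℝ 2 (vort vr vz) := (hDr _).sub (hDz _)
  have hc : ∀ {f} e, ContDiff ℝ 2 f → Continuous (Dir e f) := fun e hf =>
    (contDiff_Dir (n := 2) (m := 1) e hf (by norm_num)).continuous
  have hcc : ∀ {f} e e', ContDiff ℝ 2 f → Continuous (Dir e (Dir e' f)) := fun e e' hf =>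
    (contDiff_Dir (n := 1) (m := 0) e (contDiff_Dir (n := 2) (m := 1) e' hf (by norm_num))
      (by norm_num)).continuous
  have kq := continuous_recip hε
  have k1 := hr3.continuous
  have k2 := hz3.continuous
  have k3 := hφ3.continuous
  have k4 := hX.continuous
  refine
  { smooth_U := hr2
    smooth_V := hz2
    smooth_Φ := hφ2
    smooth_X := hX
    cont_F := ?_
    cont_f := ?_
    div := fun r hr z hz t ht => h.div_eq hε hr hz ht
    vort := rfl
    vort_z := ?_
    vort_eq := fun r hr z hz t ht => rfl
    swirl_eq := fun r hr z hz t ht => rfl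
    U_inner := fun z hz t ht => (h.bc_lateral ε (Or.inr rfl) z hz t ht).1
    U_outer := fun z hz t ht => (h.bc_lateral R (Or.inl rfl) z hz t ht).1
    Ur_inner := fun z hz t ht => Dr_vr_inner h hψ ha hε hR hz ht
    Uz_inner := fun z hz t ht => Dz_vr_lateral h (Or.inr rfl) hz ht
    Uz_flat := fun r hr t ht => ⟨Dz_vr_flat h hr (Or.inl rfl) ht, Dz_vr_flat h hr (Or.inr rfl) ht⟩
    V_flat := fun r hr t ht => ⟨(h.bc_flat r hr _ (Or.inl rfl) t ht).1,
      (h.bc_flat r hr _ (Or.inr rfl) t ht).1⟩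
    X_inner := fun z hz t ht => vort_lateral h (Or.inr rfl) hz ht
    X_flat := fun r hr t ht => ⟨vort_flat h hr (Or.inl rfl) ht, vort_flat h hr (Or.inr rfl) ht⟩
    Φr_inner := fun z hz t ht => Dr_vφ_inner h hε hz ht
    Φz_flat := fun r hr t ht =>
      ⟨Dz_vφ_flat h hr (Or.inl rfl) ht, Dz_vφ_flat h hr (Or.inr rfl) ht⟩ }
  · have j1 := hc ((1, 0), 0) hX
    have j2 := hc ((0, 1), 0) hX
    have j3 := hc ((0, 0), 1) hX
    have j4 := hcc ((1, 0), 0) ((1, 0), 0) hX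
    have j5 := hcc ((0, 1), 0) ((0, 1), 0) hX
    have j6 := hc ((0, 1), 0) hφ2
    unfold vortForce
    fun_prop
  · have j1 := hc ((1, 0), 0) hφ2
    have j2 := hc ((0, 1), 0) hφ2
    have j3 := hc ((0, 0), 1) hφ2
    have j4 := hcc ((1, 0), 0) ((1, 0), 0) hφ2
    have j5 := hcc ((0, 1), 0) ((0, 1), 0) hφ2
    unfold swirlForce
    fun_prop
  -- The derivative in `r` of the divergence equation eliminates `v_{z,rz}` from `χ_z`.
  · intro r hr z hz t ht
    have h1 : ∀ {f : (ℝ × ℝ) × ℝ → ℝ}, ContDiff ℝ 2 f → ContDiff ℝ 1 f := fun hf => hf.of_le (by norm_num)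
    have key : HasDerivAt (fun x => Dr (unc vr) ((x, z), t) + Dz (unc vz) ((x, z), t)
        + unc vr ((x, z), t) * recip ε x) _ r :=
      ((hasDerivAt_Dr (h1 (hDr _)) r z t).fun_add (hasDerivAt_Dr (h1 (hDz _)) r z t)).fun_add
        ((hasDerivAt_Dr (h1 hr2) r z t).fun_mul (hasDerivAt_recip hε hr.1.le))
    have h0 := key.unique ((hasDerivAt_const r (0 : ℝ)).congr_of_eventuallyEq (by
      filter_upwards [Ioo_mem_nhds hr.1 hr.2] with x hx using h.div_eq hε hx hz ht))
    have c1 : Dz (Dr (unc vz)) = Dr (Dz (unc vz)) := Dir_comm _ _ hz2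
    rw [vort, show Dz (Dz (unc vr) - Dr (unc vz)) = Dz (Dz (unc vr)) - Dz (Dr (unc vz)) from
      Dir_sub _ (h1 (hDr _)) (h1 (hDz _)), c1, Pi.sub_apply]
    linarith

/-! ### Energy estimates: absorption of force, stretching and cut-off terms -/

section Estimates

variable {ν ε R a s r₀ C d : ℝ} {U V Φ X F f : (ℝ × ℝ) × ℝ → ℝ} {ζ ζ' ζ'' : ℝ → ℝ}

lemma IsCutoff.continuous (hζ : IsCutoff C r₀ ζ ζ' ζ'') : Continuous ζ :=
  continuous_iff_continuousAt.2 fun r => (hζ.hasDeriv r).continuousAt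

lemma IsCutoff.continuous' (hζ : IsCutoff C r₀ ζ ζ' ζ'') : Continuous ζ' :=
  continuous_iff_continuousAt.2 fun r => (hζ.hasDeriv' r).continuousAt

/-- Beyond `2 r₀` the function is locally zero; at `2 r₀` itself continuity of `ζ'` is used. -/
lemma IsCutoff.zero_right' (hζ : IsCutoff C r₀ ζ ζ' ζ'') {r : ℝ} (hr : 2 * r₀ ≤ r) : ζ' r = 0 := by
  have h1 : ∀ x ∈ Ioo (2 * r₀) (r + 1), ζ' x = 0 := fun x hx => by
    refine (hζ.hasDeriv x).unique ((hasDerivAt_const x (0 : ℝ)).congr_of_eventuallyEq ?_)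
    filter_upwards [lt_mem_nhds hx.1] with y hy using hζ.zero y hy.le
  rcases hr.eq_or_lt with h | h
  · rw [← h]
    exact eq_left_of_eqOn_Ioo (g := fun _ => 0) hζ.continuous' continuous_const (by linarith) h1
  · exact h1 r ⟨h, by linarith⟩

lemma integral_box_eq_of_support {r₁ r₂ : ℝ} (h₁ : ε ≤ r₁) (h₂ : r₂ ≤ R)
    {g : (ℝ × ℝ) × ℝ → ℝ} (hg : ∀ r z t, r ≤ r₁ ∨ r₂ ≤ r → g ((r, z), t) = 0) :
    ∫ x, g x ∂box ε R a s = ∫ x, g x ∂box r₁ r₂ a s := by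
  rw [box_eq, box_eq]
  refine (setIntegral_eq_of_subset_of_forall_sdiff_eq_zero ((measurableSet_Ioo.prod
    measurableSet_Ioo).prod measurableSet_Ioo) (prod_mono (prod_mono (Ioo_subset_Ioo h₁ h₂) le_rfl)
    le_rfl) ?_)
  rintro ⟨⟨r, z⟩, t⟩ ⟨hx, hx'⟩
  refine hg r z t ?_
  by_contra hcon
  push Not at hcon
  exact hx' ⟨⟨hcon, hx.1.2⟩, hx.2⟩

lemma integral_box_mono_radii {r₁ r₂ : ℝ} (h₁ : ε ≤ r₁) (h₂ : r₂ ≤ R)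
    {g : (ℝ × ℝ) × ℝ → ℝ} (hg : Continuous g)
    (h0 : ∀ r ∈ Ioo ε R, ∀ z ∈ Ioo (-a) a, ∀ t ∈ Ioo 0 s, 0 ≤ g ((r, z), t)) :
    ∫ x, g x ∂box r₁ r₂ a s ≤ ∫ x, g x ∂box ε R a s := by
  refine integral_mono_measure ?_ ?_ (integrable_box hg)
  · rw [box_eq, box_eq]
    exact Measure.restrict_mono (prod_mono (prod_mono (Ioo_subset_Ioo h₁ h₂) le_rfl) le_rfl) le_rfl
  · filter_upwards [ae_box] with p hp using h0 _ hp.1 _ hp.2.1 _ hp.2.2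

/-- Estimate for `χ ζ² / r` in terms of the swirl, the force and lower-order terms. -/
lemma vorticity_estimate (h : IsFlow ν ε R a s U V Φ X F f) (hζ : IsCutoff C r₀ ζ ζ' ζ'')
    (hν : 0 < ν) (hε : 0 < ε) (hr₀ : ε < r₀) (hR : 2 * r₀ < R) (ha : 0 < a) (hs : 0 ≤ s) :
    1 / 2 * ∫ x, (X (x, s) * (ζ x.1 ^ 2 * recip ε x.1)) ^ 2 * x.1 ∂rect ε R a
      + 9 / 20 * ν * ∫ x, ((Dr X x * (ζ x.1.1 ^ 2 * recip ε x.1.1) + X x * (2 * ζ x.1.1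
          * ζ' x.1.1 * recip ε x.1.1 - ζ x.1.1 ^ 2 * recip ε x.1.1 ^ 2)) ^ 2
        + (Dz X x * (ζ x.1.1 ^ 2 * recip ε x.1.1)) ^ 2) * x.1.1 ∂box ε R a s
      ≤ 1 / 2 * ∫ x, (X (x, 0) * (ζ x.1 ^ 2 * recip ε x.1)) ^ 2 * x.1 ∂rect ε R a
        + 1 / (2 * ν) * ∫ x, (Φ x ^ 2 * (ζ x.1.1 ^ 2 * recip ε x.1.1)) ^ 2 * recip ε x.1.1 ^ 2
          * x.1.1 ∂box ε R a s
        + 20 * a ^ 2 / ν * ∫ x, (F x * (ζ x.1.1 ^ 2 * recip ε x.1.1)) ^ 2 * x.1.1 ∂box ε R a s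
        + 8 * ν * C ^ 4 * (1 / r₀) ^ 4 * ∫ x, X x ^ 2 * x.1.1 ∂box ε R a s
        + 2 * C ^ 4 * (1 / r₀) ^ 3
          * ∫ x, |U x| * |X x| ^ 2 * x.1.1 ∂box r₀ (2 * r₀) a s := by
  have hεR : ε < R := by linarith
  have hX1 : ContDiff ℝ 1 X := h.smooth_X.of_le (by norm_num)
  have key := vorticity_energy hε hεR ha hs (h.smooth_U.of_le (by norm_num))
    (h.smooth_V.of_le (by norm_num)) (h.smooth_Φ.of_le (by norm_num)) h.smooth_X h.cont_F
    hζ.hasDeriv hζ.continuous' (hζ.zero R hR.le) h.div h.vort_eq h.X_inner h.X_flat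
  have hσ0 : 0 < 1 / r₀ := by have := hε.trans hr₀; positivity
  have hσ : ∀ r, r₀ ≤ r → recip ε r ≤ 1 / r₀ := fun r hr => by
    rw [recip_eq hε (hr₀.le.trans hr), ← one_div]
    exact one_div_le_one_div_of_le (hε.trans hr₀) hr
  set q := recip ε with hq
  have hq0 : ∀ r, ε < r → 0 < q r := fun r hr => by
    rw [hq, recip_eq hε hr.le]; exact inv_pos.2 (hε.trans hr)
  have hq1 : ∀ r, ε < r → q r * r = 1 := fun r hr => recip_mul hε hr.le
  set σ := 1 / r₀ with hσdef
  have kq : Continuous q := continuous_recip hε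
  have kζ := hζ.continuous
  have kζ' := hζ.continuous'
  have k0 : Continuous X := hX1.continuous
  have k1 : Continuous (Dr X) :=
    (contDiff_Dir (n := 1) (m := 0) _ hX1 (by norm_num)).continuous
  have k2 : Continuous (Dz X) :=
    (contDiff_Dir (n := 1) (m := 0) _ hX1 (by norm_num)).continuous
  have kU := h.smooth_U.continuous
  have kΦ := h.smooth_Φ.continuous
  have kF := h.cont_F
  have poin := poincare_vertical (ε := ε) (R := R) (s := s) hε ha
    (G := fun x => X x * (ζ x.1.1 ^ 2 * q x.1.1)) (Gz := fun x => Dz X x * (ζ x.1.1 ^ 2 * q x.1.1))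
    (by fun_prop) (by fun_prop) (fun r z t => (hasDerivAt_Dz hX1 r z t).mul_const
      (ζ r ^ 2 * q r))
    (fun r hr t ht => by simp [h.X_flat r hr t ht])
  have hslice : ∀ τ, ∫ x, 1 / 2 * X (x, τ) ^ 2 * (ζ x.1 ^ 4 * q x.1) ∂rect ε R a
      = 1 / 2 * ∫ x, (X (x, τ) * (ζ x.1 ^ 2 * q x.1)) ^ 2 * x.1 ∂rect ε R a := by
    intro τ
    rw [← integral_const_mul]
    refine integral_congr_ae ?_
    filter_upwards [ae_rect] with x hx
    linear_combination (-(1 / 2) * X (x, τ) ^ 2 * ζ x.1 ^ 4 * q x.1) * hq1 _ hx.1.1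
  rw [hslice, hslice] at key
  have hC : 0 ≤ C := (abs_nonneg _).trans (hζ.bound 0)
  -- pointwise bounds for the right-hand side of the energy identity
  have hb : ∫ x, (F x * X x * (ζ x.1.1 ^ 4 * q x.1.1)
        + 2 * U x * X x ^ 2 * ζ x.1.1 ^ 3 * ζ' x.1.1 * q x.1.1
        - 4 * ν * X x ^ 2 * q x.1.1 ^ 2 * ζ x.1.1 ^ 2
          * (ζ x.1.1 * ζ' x.1.1 - x.1.1 * ζ' x.1.1 ^ 2)
        - Φ x ^ 2 * ζ x.1.1 ^ 2 * q x.1.1 ^ 2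
          * (Dz X x * (ζ x.1.1 ^ 2 * q x.1.1)) * x.1.1) ∂box ε R a s
      ≤ ∫ x, (20 * a ^ 2 / ν * ((F x * (ζ x.1.1 ^ 2 * q x.1.1)) ^ 2 * x.1.1)
        + ν / (80 * a ^ 2) * ((X x * (ζ x.1.1 ^ 2 * q x.1.1)) ^ 2 * x.1.1)
        + 2 * |U x| * |X x| ^ 2 * |ζ x.1.1 ^ 3 * ζ' x.1.1| * q x.1.1
        + 8 * ν * C ^ 4 * σ ^ 4 * (X x ^ 2 * x.1.1)
        + ν / 2 * ((Dz X x * (ζ x.1.1 ^ 2 * q x.1.1)) ^ 2 * x.1.1)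
        + 1 / (2 * ν) * ((Φ x ^ 2 * (ζ x.1.1 ^ 2 * q x.1.1)) ^ 2 * q x.1.1 ^ 2 * x.1.1))
        ∂box ε R a s := by
    refine integral_box_mono (by fun_prop) (by fun_prop) fun r hr z _ t _ => ?_
    have hr0 : 0 < r := hε.trans hr.1
    have hqr := hq1 r hr.1
    have hq00 := hq0 r hr.1
    simp only
    -- The weights are chosen so that the second term, after Poincaré's inequality with constant `4
    -- a²`, costs `ν / 20` of the dissipation.
    have b1 : F ((r, z), t) * X ((r, z), t) * (ζ r ^ 4 * q r)
        ≤ 20 * a ^ 2 / ν * ((F ((r, z), t) * (ζ r ^ 2 * q r)) ^ 2 * r)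
          + ν / (80 * a ^ 2) * ((X ((r, z), t) * (ζ r ^ 2 * q r)) ^ 2 * r) := by
      have e1 : F ((r, z), t) * X ((r, z), t) * (ζ r ^ 4 * q r)
          = (F ((r, z), t) * (ζ r ^ 2 * q r)) * (X ((r, z), t) * (ζ r ^ 2 * q r)) * r := by
        linear_combination (-F ((r, z), t) * X ((r, z), t) * ζ r ^ 4 * q r) * hqr
      rw [e1]
      generalize F ((r, z), t) * (ζ r ^ 2 * q r) = α
      generalize X ((r, z), t) * (ζ r ^ 2 * q r) = β
      have e2 : 20 * a ^ 2 / ν * (α ^ 2 * r) + ν / (80 * a ^ 2) * (β ^ 2 * r) - α * β * r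
          = (40 * a ^ 2 * α - ν * β) ^ 2 * r / (80 * a ^ 2 * ν) := by
        field_simp
        ring
      have e3 : 0 ≤ (40 * a ^ 2 * α - ν * β) ^ 2 * r / (80 * a ^ 2 * ν) := by positivity
      linarith
    have b2 : 2 * U ((r, z), t) * X ((r, z), t) ^ 2 * ζ r ^ 3 * ζ' r * q r
        ≤ 2 * |U ((r, z), t)| * |X ((r, z), t)| ^ 2 * |ζ r ^ 3 * ζ' r| * q r := by
      rw [sq_abs]
      refine (le_abs_self _).trans (le_of_eq ?_)
      simp only [abs_mul, abs_pow, abs_two, abs_of_pos hq00, sq_abs]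
      ring
    -- Either `ζ' = 0`, or `r ≥ r₀` and every `1 / r` is at most `1 / r₀`. Inserting `q r = 1`
    -- restores the weight `r` of the measure.
    have b3 : -(4 * ν * X ((r, z), t) ^ 2 * q r ^ 2 * ζ r ^ 2 * (ζ r * ζ' r - r * ζ' r ^ 2))
        ≤ 8 * ν * C ^ 4 * σ ^ 4 * (X ((r, z), t) ^ 2 * r) := by
      rcases le_total r r₀ with hrr | hrr
      · rw [hζ.zero' r hrr]
        simp only [mul_zero, ne_eq, OfNat.ofNat_ne_zero, not_false_eq_true, zero_pow, sub_zero,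
          neg_zero]
        positivity
      · have hz1 := hζ.bound r
        have hz2 := hζ.bound' r
        have hqσ := hσ r hrr
        have c1 : |q r ^ 2 * ζ r ^ 2 * (ζ r * ζ' r - r * ζ' r ^ 2)| ≤ 2 * C ^ 4 * σ ^ 4 * r := by
          calc |q r ^ 2 * ζ r ^ 2 * (ζ r * ζ' r - r * ζ' r ^ 2)|
              = q r ^ 2 * |ζ r| ^ 2 * |ζ r * ζ' r - r * ζ' r ^ 2| := by
                rw [abs_mul, abs_mul, abs_pow, abs_pow, abs_of_pos hq00]
            _ ≤ q r ^ 2 * |ζ r| ^ 2 * (|ζ r| * |ζ' r| + r * |ζ' r| ^ 2) := by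
                gcongr
                refine (abs_sub _ _).trans (le_of_eq ?_)
                rw [abs_mul, abs_mul, abs_pow, abs_of_pos hr0]
            _ ≤ q r ^ 2 * C ^ 2 * (C * (C * σ) + r * (C * σ) ^ 2) := by gcongr
            _ = C ^ 4 * σ * q r ^ 2 * (q r * r) + C ^ 4 * σ ^ 2 * q r ^ 2 * r := by
                rw [hqr]; ring
            _ = C ^ 4 * σ * q r ^ 3 * r + C ^ 4 * σ ^ 2 * q r ^ 2 * r := by ring
            _ ≤ C ^ 4 * σ * σ ^ 3 * r + C ^ 4 * σ ^ 2 * σ ^ 2 * r := by gcongr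
            _ = _ := by ring
        have c2 := (neg_abs_le (q r ^ 2 * ζ r ^ 2 * (ζ r * ζ' r - r * ζ' r ^ 2)))
        have c3 : -(q r ^ 2 * ζ r ^ 2 * (ζ r * ζ' r - r * ζ' r ^ 2)) ≤ 2 * C ^ 4 * σ ^ 4 * r := by
          linarith
        have c4 : 0 ≤ 4 * ν * X ((r, z), t) ^ 2 := by positivity
        have := mul_le_mul_of_nonneg_left c3 c4
        linarith
    have b4 : -(Φ ((r, z), t) ^ 2 * ζ r ^ 2 * q r ^ 2
          * (Dz X ((r, z), t) * (ζ r ^ 2 * q r)) * r)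
        ≤ ν / 2 * ((Dz X ((r, z), t) * (ζ r ^ 2 * q r)) ^ 2 * r)
          + 1 / (2 * ν) * ((Φ ((r, z), t) ^ 2 * (ζ r ^ 2 * q r)) ^ 2 * q r ^ 2 * r) := by
      rw [show Φ ((r, z), t) ^ 2 * ζ r ^ 2 * q r ^ 2 = Φ ((r, z), t) ^ 2 * (ζ r ^ 2 * q r) * q r by
        ring, ← mul_pow]
      generalize Φ ((r, z), t) ^ 2 * (ζ r ^ 2 * q r) * q r = α
      generalize Dz X ((r, z), t) * (ζ r ^ 2 * q r) = β
      have e2 : ν / 2 * (β ^ 2 * r) + 1 / (2 * ν) * (α ^ 2 * r) + α * β * r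
          = (ν * β + α) ^ 2 * r / (2 * ν) := by
        field_simp
        ring
      have e3 : 0 ≤ (ν * β + α) ^ 2 * r / (2 * ν) := by positivity
      linarith
    linarith
  have hring : ∫ x, 2 * |U x| * |X x| ^ 2 * |ζ x.1.1 ^ 3 * ζ' x.1.1| * q x.1.1 ∂box ε R a s
      ≤ 2 * C ^ 4 * σ ^ 3 * ∫ x, |U x| * |X x| ^ 2 * x.1.1 ∂box r₀ (2 * r₀) a s := by
    rw [integral_box_eq_of_support hr₀.le hR.le (fun r z t hr => by
      have : ζ' r = 0 := hr.elim (hζ.zero' r) hζ.zero_right'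
      simp [this]), ← integral_const_mul]
    refine integral_box_mono (by fun_prop) (by fun_prop) fun r hr z _ t _ => ?_
    have hεr : ε < r := hr₀.trans hr.1
    have hr0 : 0 < r := hε.trans hεr
    have hqr := hq1 r hεr
    have hq00 := hq0 r hεr
    have hqσ := hσ r hr.1.le
    have hz1 := hζ.bound r
    have hz2 := hζ.bound' r
    simp only
    calc 2 * |U ((r, z), t)| * |X ((r, z), t)| ^ 2 * |ζ r ^ 3 * ζ' r| * q r
        = 2 * (|ζ r| ^ 3 * |ζ' r|) * (q r * (q r * r))
          * (|U ((r, z), t)| * |X ((r, z), t)| ^ 2) := by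
          rw [hqr, abs_mul, abs_pow]; ring
      _ = 2 * (|ζ r| ^ 3 * |ζ' r|) * q r ^ 2 * (|U ((r, z), t)| * |X ((r, z), t)| ^ 2 * r) := by
          ring
      _ ≤ 2 * (C ^ 3 * (C * σ)) * σ ^ 2 * (|U ((r, z), t)| * |X ((r, z), t)| ^ 2 * r) := by
          gcongr
      _ = _ := by ring
  rw [integral_add (integrable_box (by fun_prop)) (integrable_box (by fun_prop)),
    integral_add (integrable_box (by fun_prop)) (integrable_box (by fun_prop)),
    integral_add (integrable_box (by fun_prop)) (integrable_box (by fun_prop)),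
    integral_add (integrable_box (by fun_prop)) (integrable_box (by fun_prop)),
    integral_add (integrable_box (by fun_prop)) (integrable_box (by fun_prop)),
    integral_const_mul, integral_const_mul, integral_const_mul, integral_const_mul,
    integral_const_mul] at hb
  have hgz : ∫ x, (Dz X x * (ζ x.1.1 ^ 2 * q x.1.1)) ^ 2 * x.1.1 ∂box ε R a s
      ≤ ∫ x, ((Dr X x * (ζ x.1.1 ^ 2 * q x.1.1) + X x * (2 * ζ x.1.1
          * ζ' x.1.1 * q x.1.1 - ζ x.1.1 ^ 2 * q x.1.1 ^ 2)) ^ 2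
        + (Dz X x * (ζ x.1.1 ^ 2 * q x.1.1)) ^ 2) * x.1.1 ∂box ε R a s := by
    refine integral_box_mono (by fun_prop) (by fun_prop) fun r hr z _ t _ => ?_
    have hr0 : 0 < r := hε.trans hr.1
    simp only
    gcongr
    exact le_add_of_nonneg_left (sq_nonneg _)
  have hp2 : ν / (80 * a ^ 2) * ∫ x, (X x * (ζ x.1.1 ^ 2 * q x.1.1)) ^ 2 * x.1.1 ∂box ε R a s
      ≤ ν / 20 * ∫ x, (Dz X x * (ζ x.1.1 ^ 2 * q x.1.1)) ^ 2 * x.1.1 ∂box ε R a s := by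
    refine (mul_le_mul_of_nonneg_left poin (by positivity)).trans (le_of_eq ?_)
    field_simp
    ring
  -- In all `1/2 + 1/20 = 11/20` of the dissipation is spent, so `9/20` is left.
  have hp3 := mul_le_mul_of_nonneg_left hgz (show 0 ≤ 11 / 20 * ν by positivity)
  linarith

/-- With `q = 1 / r`, the force is paired as `f ζ / √r` against `w^(3/2)`, the quantities that
Hölder's inequality with exponents `20/11` and `20/9` separates. -/
lemma swirl_force_bound {q r : ℝ} (hq00 : 0 < q) (hqr : q * r = 1) (α φ y : ℝ) :
    α * φ ^ 3 * (y ^ 4 * q)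
        ≤ |α * (y * √q)| * (φ ^ 2 * (y ^ 2 * |q|)) ^ (3 / 2 : ℝ) * r := by
  have hsq : √q * √q = q := Real.mul_self_sqrt hq00.le
  have e1 : (φ ^ 2 * (y ^ 2 * |q|)) ^ (3 / 2 : ℝ)
      = φ ^ 2 * (y ^ 2 * q) * (|φ| * |y| * √q) := by
    rw [abs_of_pos hq00, show (3 / 2 : ℝ) = 1 + 1 / 2 by norm_num,
      Real.rpow_add_of_nonneg (by positivity) (by norm_num) (by norm_num), Real.rpow_one,
      ← Real.sqrt_eq_rpow, ← mul_assoc, Real.sqrt_mul (by positivity),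
      ← mul_pow, Real.sqrt_sq_eq_abs, abs_mul]
  have e2 : |y| * |y| = y ^ 2 := by rw [← abs_mul, ← pow_two, abs_of_nonneg (sq_nonneg _)]
  have e3 : |φ ^ 3| = φ ^ 2 * |φ| := by rw [abs_pow, pow_succ, sq_abs]
  refine (le_abs_self _).trans (le_of_eq ?_)
  rw [e1, abs_mul, abs_mul, abs_mul, abs_mul, abs_of_pos hq00, e3, abs_mul,
    abs_of_nonneg (Real.sqrt_nonneg _), abs_of_nonneg (by positivity : (0 : ℝ) ≤ y ^ 4)]
  calc |α| * (φ ^ 2 * |φ|) * (y ^ 4 * q)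
      = |α| * (φ ^ 2 * |φ|) * (y ^ 2 * y ^ 2 * (q * (q * r))) := by rw [hqr]; ring
    _ = |α| * (φ ^ 2 * |φ|) * (y ^ 2 * (|y| * |y|) * (√q * √q * (q * r))) := by
        rw [hsq, e2]
    _ = _ := by ring

/-- The only use of the smallness of the swirl. Since `φ² = u² q²` with `u = r φ`, the left side is
`-(3/2) u² W Y r`, where `W` and `Y` here denote `v_r ζ² / r³` and `w / r`. Where the cut-off `y` is
nonzero, `(3/2) u² ≤ (6/5) ν²`, and the square of `3 ν |W| - |Y|` gives the two constants. -/
lemma swirl_stretch_bound {q r ν φ y : ℝ} (hr0 : 0 < r) (hqr : q * r = 1) (hν : 0 < ν) (w : ℝ)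
    (hk : y = 0 ∨ (r * φ) ^ 2 ≤ 4 / 5 * ν ^ 2) :
    -(3 / 2 * w * q * φ ^ 4 * (y ^ 4 * q))
        ≤ 9 / 5 * ν ^ 3 * ((w * (y ^ 2 * q)) ^ 2 * q ^ 3)
          + ν / 5 * ((φ ^ 2 * (y ^ 2 * q)) ^ 2 * q ^ 2 * r) := by
  rcases hk with rfl | hk
  · simp
  · set W := w * (y ^ 2 * q) * q ^ 2 with hW
    set Y := φ ^ 2 * (y ^ 2 * q) * q with hY
    have e1 : 3 / 2 * w * q * φ ^ 4 * (y ^ 4 * q) = 3 / 2 * (r * φ) ^ 2 * (W * Y) * r := by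
      rw [hW, hY]
      have e : q ^ 5 * r ^ 3 = q ^ 2 := by
        calc q ^ 5 * r ^ 3 = q ^ 2 * (q * r) ^ 3 := by ring
          _ = q ^ 2 := by rw [hqr]; ring
      linear_combination (-3 / 2 * w * φ ^ 4 * y ^ 4) * e
    have e2 : (w * (y ^ 2 * q)) ^ 2 * q ^ 3 = W ^ 2 * r := by
      rw [hW]
      linear_combination (-(w * (y ^ 2 * q)) ^ 2 * q ^ 3) * hqr
    have e3 : (φ ^ 2 * (y ^ 2 * q)) ^ 2 * q ^ 2 * r = Y ^ 2 * r := by rw [hY]; ring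
    rw [e1, e2, e3]
    have e4 : -(3 / 2 * (r * φ) ^ 2 * (W * Y)) ≤ 6 / 5 * ν ^ 2 * |W * Y| := by
      calc -(3 / 2 * (r * φ) ^ 2 * (W * Y)) ≤ 3 / 2 * (r * φ) ^ 2 * |W * Y| := by
            rw [← mul_neg]
            exact mul_le_mul_of_nonneg_left (neg_le_abs _) (by positivity)
        _ ≤ 3 / 2 * (4 / 5 * ν ^ 2) * |W * Y| := by gcongr
        _ = _ := by ring
    have e5 : 6 / 5 * ν ^ 2 * |W * Y| ≤ 9 / 5 * ν ^ 3 * W ^ 2 + ν / 5 * Y ^ 2 := by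
      rw [abs_mul, ← sq_abs W, ← sq_abs Y]
      have : 0 ≤ ν / 5 * (3 * ν * |W| - |Y|) ^ 2 := by positivity
      linarith
    have := mul_le_mul_of_nonneg_right (e4.trans e5) hr0.le
    linarith

/-- Two or three factors `φ` are written as `u / r` with `|u| ≤ d`, which leaves quadratic
expressions controlled by the dissipation of `v`. The remaining powers of `1 / r` are harmless where
`y' ≠ 0`. The convective term yields `d³`, the viscous ones `d²`. -/
lemma swirl_cutoff_bound {q r ν φ y y' C σ d : ℝ} (hq00 : 0 < q) (hr0 : 0 < r) (hqr : q * r = 1)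
    (hν : 0 < ν) (hC : 0 ≤ C) (hσ0 : 0 < σ) (w φr : ℝ) (hu : |r * φ| ≤ d) (hz1 : |y| ≤ C)
    (hz2 : |y'| ≤ C * σ) (hz : y' = 0 ∨ q ≤ σ) :
    w * φ ^ 4 * y ^ 3 * y' * q
        + ν * (2 * φ ^ 3 * φr * y ^ 3 * y' * q + 3 * φ ^ 4 * y ^ 2 * y' ^ 2 * q
          - 2 * φ ^ 4 * y ^ 3 * y' * q ^ 2)
        ≤ C ^ 4 * σ ^ 4 * (d ^ 3 + 6 * ν * d ^ 2)
          * ((w ^ 2 * q ^ 2 + φ ^ 2 * q ^ 2 + φr ^ 2) * r) := by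
  have hd0 : 0 ≤ d := (abs_nonneg _).trans hu
  have hφu : φ = (r * φ) * q := by linear_combination (-φ) * hqr
  rcases hz with rfl | hqσ
  · simp only [mul_zero, zero_mul, ne_eq, OfNat.ofNat_ne_zero, not_false_eq_true, zero_pow,
      sub_zero, add_zero]
    positivity
  · set u := r * φ with hu'
    set A := φ * q with hA
    set B := w * q with hB
    have hz3 : |y ^ 3 * y'| ≤ C ^ 4 * σ := by
      calc |y ^ 3 * y'| = |y| ^ 3 * |y'| := by rw [abs_mul, abs_pow]
        _ ≤ C ^ 3 * (C * σ) := by gcongr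
        _ = _ := by ring
    have hz4 : |y ^ 2 * y' ^ 2| ≤ C ^ 4 * σ ^ 2 := by
      calc |y ^ 2 * y' ^ 2| = |y| ^ 2 * |y'| ^ 2 := by rw [abs_mul, abs_pow, abs_pow]
        _ ≤ C ^ 2 * (C * σ) ^ 2 := by gcongr
        _ = _ := by ring
    have hφA : φ = u * q := hφu
    have c1 : w * φ ^ 4 * y ^ 3 * y' * q ≤ C ^ 4 * σ ^ 4 * d ^ 3 * (|B| * |A|) * r := by
      have e : w * φ ^ 4 * y ^ 3 * y' * q
          = (y ^ 3 * y') * u ^ 3 * (B * A) * (q ^ 3 * r) := by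
        have e0 : w * φ ^ 4 * y ^ 3 * y' * q
          = w * φ * (u * q) ^ 3 * (y ^ 3 * y') * q := by rw [← hφA]; ring
        rw [e0, hB, hA]
        linear_combination (-(w * φ * (u * q) ^ 3 * (y ^ 3 * y') * q)) * hqr
      rw [e]
      refine (le_abs_self _).trans ?_
      calc |(y ^ 3 * y') * u ^ 3 * (B * A) * (q ^ 3 * r)|
          = |y ^ 3 * y'| * |u| ^ 3 * (|B| * |A|) * (q ^ 3 * r) := by
            rw [abs_mul, abs_mul (_ * _) (B * A), abs_mul (y ^ 3 * y'), abs_pow u,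
              abs_mul B, abs_of_pos (by positivity : 0 < q ^ 3 * r)]
        _ ≤ (C ^ 4 * σ) * d ^ 3 * (|B| * |A|) * (σ ^ 3 * r) := by gcongr
        _ = _ := by ring
    have c2 : 2 * φ ^ 3 * φr * y ^ 3 * y' * q
        ≤ C ^ 4 * σ ^ 4 * d ^ 2 * (2 * (|A| * |φr|)) * r := by
      have e : 2 * φ ^ 3 * φr * y ^ 3 * y' * q
          = (y ^ 3 * y') * u ^ 2 * (2 * (A * φr)) * (q ^ 3 * r) := by
        have e0 : 2 * φ ^ 3 * φr * y ^ 3 * y' * q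
          = 2 * φ * (u * q) ^ 2 * φr * (y ^ 3 * y') * q := by rw [← hφA]; ring
        rw [e0, hA]
        linear_combination (-(2 * φ * (u * q) ^ 2 * φr * (y ^ 3 * y') * q)) * hqr
      rw [e]
      refine (le_abs_self _).trans ?_
      calc |(y ^ 3 * y') * u ^ 2 * (2 * (A * φr)) * (q ^ 3 * r)|
          = |y ^ 3 * y'| * |u| ^ 2 * (2 * (|A| * |φr|)) * (q ^ 3 * r) := by
            rw [abs_mul, abs_mul (_ * _) (2 * (A * φr)), abs_mul (y ^ 3 * y'), abs_pow u,
              abs_mul 2, abs_two, abs_mul A, abs_of_pos (by positivity : 0 < q ^ 3 * r)]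
        _ ≤ (C ^ 4 * σ) * d ^ 2 * (2 * (|A| * |φr|)) * (σ ^ 3 * r) := by gcongr
        _ = _ := by ring
    have c3 : 3 * φ ^ 4 * y ^ 2 * y' ^ 2 * q
        ≤ C ^ 4 * σ ^ 4 * d ^ 2 * (3 * |A| ^ 2) * r := by
      have e : 3 * φ ^ 4 * y ^ 2 * y' ^ 2 * q
          = (y ^ 2 * y' ^ 2) * u ^ 2 * (3 * A ^ 2) * (q ^ 2 * r) := by
        have e0 : 3 * φ ^ 4 * y ^ 2 * y' ^ 2 * q
          = 3 * φ ^ 2 * (u * q) ^ 2 * (y ^ 2 * y' ^ 2) * q := by rw [← hφA]; ring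
        rw [e0, hA]
        linear_combination (-(3 * φ ^ 2 * (u * q) ^ 2 * (y ^ 2 * y' ^ 2) * q)) * hqr
      rw [e]
      refine (le_abs_self _).trans ?_
      calc |(y ^ 2 * y' ^ 2) * u ^ 2 * (3 * A ^ 2) * (q ^ 2 * r)|
          = |y ^ 2 * y' ^ 2| * |u| ^ 2 * (3 * |A| ^ 2) * (q ^ 2 * r) := by
            rw [abs_mul, abs_mul (_ * _) (3 * A ^ 2), abs_mul (y ^ 2 * y' ^ 2), abs_pow u,
              abs_mul 3, abs_pow A, abs_of_pos (by positivity : 0 < q ^ 2 * r),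
              abs_of_pos (by norm_num : (0 : ℝ) < 3)]
        _ ≤ (C ^ 4 * σ ^ 2) * d ^ 2 * (3 * |A| ^ 2) * (σ ^ 2 * r) := by gcongr
        _ = _ := by ring
    have c4 : -(2 * φ ^ 4 * y ^ 3 * y' * q ^ 2)
        ≤ C ^ 4 * σ ^ 4 * d ^ 2 * (2 * |A| ^ 2) * r := by
      have e : 2 * φ ^ 4 * y ^ 3 * y' * q ^ 2
          = (y ^ 3 * y') * u ^ 2 * (2 * A ^ 2) * (q ^ 3 * r) := by
        have e0 : 2 * φ ^ 4 * y ^ 3 * y' * q ^ 2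
          = 2 * φ ^ 2 * (u * q) ^ 2 * (y ^ 3 * y') * q ^ 2 := by rw [← hφA]; ring
        rw [e0, hA]
        linear_combination (-(2 * φ ^ 2 * (u * q) ^ 2 * (y ^ 3 * y') * q ^ 2)) * hqr
      rw [e]
      refine (neg_le_abs _).trans ?_
      calc |(y ^ 3 * y') * u ^ 2 * (2 * A ^ 2) * (q ^ 3 * r)|
          = |y ^ 3 * y'| * |u| ^ 2 * (2 * |A| ^ 2) * (q ^ 3 * r) := by
            rw [abs_mul, abs_mul (_ * _) (2 * A ^ 2), abs_mul (y ^ 3 * y'), abs_pow u,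
              abs_mul 2, abs_pow A, abs_of_pos (by positivity : 0 < q ^ 3 * r), abs_two]
        _ ≤ (C ^ 4 * σ) * d ^ 2 * (2 * |A| ^ 2) * (σ ^ 3 * r) := by gcongr
        _ = _ := by ring
    have hsum : w ^ 2 * q ^ 2 + φ ^ 2 * q ^ 2 + φr ^ 2 = |B| ^ 2 + |A| ^ 2 + |φr| ^ 2 := by
      rw [sq_abs, sq_abs, sq_abs, hA, hB]; ring
    rw [hsum]
    have p1 : |B| * |A| ≤ |B| ^ 2 + |A| ^ 2 + |φr| ^ 2 := by
      nlinarith [sq_nonneg (|B| - |A|), sq_nonneg |B|, sq_nonneg |A|, sq_nonneg |φr|]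
    have p2 : 2 * (|A| * |φr|) + 3 * |A| ^ 2 + 2 * |A| ^ 2
        ≤ 6 * (|B| ^ 2 + |A| ^ 2 + |φr| ^ 2) := by
      nlinarith [sq_nonneg (|A| - |φr|), sq_nonneg |B|, sq_nonneg |A|, sq_nonneg |φr|]
    have q1 := mul_le_mul_of_nonneg_left p1
      (show 0 ≤ C ^ 4 * σ ^ 4 * d ^ 3 * r by positivity)
    have q2 := mul_le_mul_of_nonneg_left p2
      (show 0 ≤ ν * (C ^ 4 * σ ^ 4 * d ^ 2 * r) by positivity)
    have q3 := mul_le_mul_of_nonneg_left (add_le_add (add_le_add c2 c3) c4) hν.le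
    linarith

/-- Estimate for `v_φ² ζ² / r` for small swirl. -/
lemma swirl_estimate (h : IsFlow ν ε R a s U V Φ X F f) (hζ : IsCutoff C r₀ ζ ζ' ζ'')
    (hν : 0 < ν) (hε : 0 < ε) (hr₀ : ε < r₀) (hR : 2 * r₀ < R) (ha : 0 < a) (hs : 0 ≤ s)
    (hd : ∀ r ∈ Ioo ε R, ∀ z ∈ Ioo (-a) a, ∀ t ∈ Ioo 0 s, |r * Φ ((r, z), t)| ≤ d)
    (hκ : ∀ r ∈ Ioo ε (2 * r₀), ∀ z ∈ Ioo (-a) a, ∀ t ∈ Ioo 0 s,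
      (r * Φ ((r, z), t)) ^ 2 ≤ 4 / 5 * ν ^ 2) :
    1 / 4 * ∫ x, (Φ (x, s) ^ 2 * (ζ x.1 ^ 2 * recip ε x.1)) ^ 2 * x.1 ∂rect ε R a
      + 3 / 4 * ν * ∫ x, ((2 * Φ x * Dr Φ x * (ζ x.1.1 ^ 2 * recip ε x.1.1) + Φ x ^ 2
          * (2 * ζ x.1.1 * ζ' x.1.1 * recip ε x.1.1 - ζ x.1.1 ^ 2 * recip ε x.1.1 ^ 2)) ^ 2
        + (2 * Φ x * Dz Φ x * (ζ x.1.1 ^ 2 * recip ε x.1.1)) ^ 2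
        + (Φ x ^ 2 * (ζ x.1.1 ^ 2 * recip ε x.1.1)) ^ 2 * recip ε x.1.1 ^ 2) * x.1.1 ∂box ε R a s
      ≤ 1 / 4 * ∫ x, (Φ (x, 0) ^ 2 * (ζ x.1 ^ 2 * recip ε x.1)) ^ 2 * x.1 ∂rect ε R a
        + ∫ x, |f x * (ζ x.1.1 * √(recip ε x.1.1))|
          * (Φ x ^ 2 * (ζ x.1.1 ^ 2 * |recip ε x.1.1|)) ^ (3 / 2 : ℝ) * x.1.1 ∂box ε R a s
        + 9 / 5 * ν ^ 3 * ∫ x, (U x * (ζ x.1.1 ^ 2 * recip ε x.1.1)) ^ 2 * recip ε x.1.1 ^ 3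
          ∂box ε R a s
        + ν / 5 * ∫ x, (Φ x ^ 2 * (ζ x.1.1 ^ 2 * recip ε x.1.1)) ^ 2 * recip ε x.1.1 ^ 2
          * x.1.1 ∂box ε R a s
        + C ^ 4 * (1 / r₀) ^ 4 * (d ^ 3 + 6 * ν * d ^ 2) * ∫ x, (U x ^ 2 * recip ε x.1.1 ^ 2
          + Φ x ^ 2 * recip ε x.1.1 ^ 2 + Dr Φ x ^ 2) * x.1.1 ∂box ε R a s := by
  have hεR : ε < R := by linarith
  have hΦ1 : ContDiff ℝ 1 Φ := h.smooth_Φ.of_le (by norm_num)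
  have key := swirl_energy hν.le hε hεR ha hs (h.smooth_U.of_le (by norm_num))
    (h.smooth_V.of_le (by norm_num)) h.smooth_Φ h.cont_f
    hζ.hasDeriv hζ.continuous' (hζ.zero R hR.le) h.div h.swirl_eq h.U_inner h.Φr_inner h.V_flat
    h.Φz_flat
  have hσ0 : 0 < 1 / r₀ := by have := hε.trans hr₀; positivity
  have hσ : ∀ r, r₀ ≤ r → recip ε r ≤ 1 / r₀ := fun r hr => by
    rw [recip_eq hε (hr₀.le.trans hr), ← one_div]
    exact one_div_le_one_div_of_le (hε.trans hr₀) hr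
  set q := recip ε with hq
  have hq0 : ∀ r, ε < r → 0 < q r := fun r hr => by
    rw [hq, recip_eq hε hr.le]; exact inv_pos.2 (hε.trans hr)
  have hq1 : ∀ r, ε < r → q r * r = 1 := fun r hr => recip_mul hε hr.le
  set σ := 1 / r₀ with hσdef
  have kq : Continuous q := continuous_recip hε
  have kζ := hζ.continuous
  have kζ' := hζ.continuous'
  have k1 : Continuous (Dr Φ) :=
    (contDiff_Dir (n := 1) (m := 0) _ hΦ1 (by norm_num)).continuous
  have kU := h.smooth_U.continuous
  have kΦ := h.smooth_Φ.continuous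
  have kf := h.cont_f
  have khp : Continuous fun x : (ℝ × ℝ) × ℝ =>
      (Φ x ^ 2 * (ζ x.1.1 ^ 2 * |q x.1.1|)) ^ (3 / 2 : ℝ) :=
    (by fun_prop : Continuous fun x : (ℝ × ℝ) × ℝ =>
      Φ x ^ 2 * (ζ x.1.1 ^ 2 * |q x.1.1|)).rpow_const fun x => Or.inr (by norm_num)
  have hslice : ∀ τ, ∫ x, 1 / 4 * Φ (x, τ) ^ 4 * (ζ x.1 ^ 4 * q x.1) ∂rect ε R a
      = 1 / 4 * ∫ x, (Φ (x, τ) ^ 2 * (ζ x.1 ^ 2 * q x.1)) ^ 2 * x.1 ∂rect ε R a := by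
    intro τ
    rw [← integral_const_mul]
    refine integral_congr_ae ?_
    filter_upwards [ae_rect] with x hx
    linear_combination (-(1 / 4) * Φ (x, τ) ^ 4 * ζ x.1 ^ 4 * q x.1) * hq1 _ hx.1.1
  rw [hslice, hslice] at key
  have hC : 0 ≤ C := (abs_nonneg _).trans (hζ.bound 0)
  have hb : ∫ x, (f x * Φ x ^ 3 * (ζ x.1.1 ^ 4 * q x.1.1)
        - 3 / 2 * U x * q x.1.1 * Φ x ^ 4 * (ζ x.1.1 ^ 4 * q x.1.1)
        + U x * Φ x ^ 4 * ζ x.1.1 ^ 3 * ζ' x.1.1 * q x.1.1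
        + ν * (2 * Φ x ^ 3 * Dr Φ x * ζ x.1.1 ^ 3 * ζ' x.1.1 * q x.1.1
          + 3 * Φ x ^ 4 * ζ x.1.1 ^ 2 * ζ' x.1.1 ^ 2 * q x.1.1
          - 2 * Φ x ^ 4 * ζ x.1.1 ^ 3 * ζ' x.1.1 * q x.1.1 ^ 2)) ∂box ε R a s
      ≤ ∫ x, (|f x * (ζ x.1.1 * √(q x.1.1))|
          * (Φ x ^ 2 * (ζ x.1.1 ^ 2 * |q x.1.1|)) ^ (3 / 2 : ℝ) * x.1.1
        + 9 / 5 * ν ^ 3 * ((U x * (ζ x.1.1 ^ 2 * q x.1.1)) ^ 2 * q x.1.1 ^ 3)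
        + ν / 5 * ((Φ x ^ 2 * (ζ x.1.1 ^ 2 * q x.1.1)) ^ 2 * q x.1.1 ^ 2 * x.1.1)
        + C ^ 4 * σ ^ 4 * (d ^ 3 + 6 * ν * d ^ 2) * ((U x ^ 2 * q x.1.1 ^ 2
          + Φ x ^ 2 * q x.1.1 ^ 2 + Dr Φ x ^ 2) * x.1.1)) ∂box ε R a s := by
    refine integral_box_mono (by fun_prop) (by fun_prop) fun r hr z hz t ht => ?_
    have hr0 : 0 < r := hε.trans hr.1
    have hqr := hq1 r hr.1
    have hq00 := hq0 r hr.1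
    have hu := hd r hr z hz t ht
    have hκ' := fun h2 => hκ r ⟨hr.1, h2⟩ z hz t ht
    simp only
    generalize f ((r, z), t) = α
    generalize hφ : Φ ((r, z), t) = φ at *
    generalize U ((r, z), t) = w
    generalize Dr Φ ((r, z), t) = φr
    have b1 := swirl_force_bound hq00 hqr α φ (ζ r)
    have b2 := swirl_stretch_bound (φ := φ) (y := ζ r) hr0 hqr hν w
      ((le_or_gt (2 * r₀) r).imp (hζ.zero r) hκ')
    have b3 := swirl_cutoff_bound hq00 hr0 hqr hν hC hσ0 w φr hu (hζ.bound r) (hζ.bound' r)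
      ((le_total r r₀).imp (hζ.zero' r) (hσ r))
    linarith
  replace hb := key.trans hb
  rw [integral_add (integrable_box (by fun_prop)) (integrable_box (by fun_prop)),
    integral_add (integrable_box (by fun_prop)) (integrable_box (by fun_prop)),
    integral_add (integrable_box (by fun_prop)) (integrable_box (by fun_prop)),
    integral_const_mul, integral_const_mul, integral_const_mul] at hb
  linarith

/-- The weighted norm of the radial velocity is controlled by the vertical derivative of
`χ ζ² / r`. -/
lemma radial_estimate (h : IsFlow ν ε R a s U V Φ X F f) (hζ : IsCutoff C r₀ ζ ζ' ζ'')
    (hε : 0 < ε) (hr₀ : ε < r₀) (hR : 2 * r₀ < R) (ha : 0 < a) :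
    ∫ x, (U x * (ζ x.1.1 ^ 2 * recip ε x.1.1)) ^ 2 * recip ε x.1.1 ^ 3 ∂box ε R a s
      ≤ 11 / 90 * ∫ x, ((Dr X x * (ζ x.1.1 ^ 2 * recip ε x.1.1) + X x * (2 * ζ x.1.1
          * ζ' x.1.1 * recip ε x.1.1 - ζ x.1.1 ^ 2 * recip ε x.1.1 ^ 2)) ^ 2
        + (Dz X x * (ζ x.1.1 ^ 2 * recip ε x.1.1)) ^ 2) * x.1.1 ∂box ε R a s
      + 88 * C ^ 4 * (1 / r₀) ^ 4
        * ∫ x, (Dr U x ^ 2 + U x ^ 2 * recip ε x.1.1 ^ 2) * x.1.1 ∂box ε R a s := by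
  have hεR : ε < R := by linarith
  have hX1 : ContDiff ℝ 1 X := h.smooth_X.of_le (by norm_num)
  have hU1 : ContDiff ℝ 1 U := h.smooth_U.of_le (by norm_num)
  have key := elliptic_estimate hε hεR ha h.smooth_U hX1 hζ.hasDeriv hζ.hasDeriv' hζ.cont''
    (hζ.zero R hR.le) h.vort_z h.U_inner h.U_outer h.Ur_inner h.Uz_inner h.Uz_flat
  have hσ0 : 0 < 1 / r₀ := by have := hε.trans hr₀; positivity
  have hσ : ∀ r, r₀ ≤ r → recip ε r ≤ 1 / r₀ := fun r hr => by
    rw [recip_eq hε (hr₀.le.trans hr), ← one_div]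
    exact one_div_le_one_div_of_le (hε.trans hr₀) hr
  set q := recip ε with hq
  have hq0 : ∀ r, ε < r → 0 < q r := fun r hr => by
    rw [hq, recip_eq hε hr.le]; exact inv_pos.2 (hε.trans hr)
  set σ := 1 / r₀ with hσdef
  have kq : Continuous q := continuous_recip hε
  have kζ := hζ.continuous
  have kζ' := hζ.continuous'
  have kζ'' := hζ.cont''
  have k0 : Continuous X := hX1.continuous
  have k1 : Continuous (Dr X) :=
    (contDiff_Dir (n := 1) (m := 0) _ hX1 (by norm_num)).continuous
  have k2 : Continuous (Dz X) :=
    (contDiff_Dir (n := 1) (m := 0) _ hX1 (by norm_num)).continuous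
  have kU := h.smooth_U.continuous
  have k3 : Continuous (Dr U) :=
    (contDiff_Dir (n := 1) (m := 0) _ hU1 (by norm_num)).continuous
  have hC : 0 ≤ C := (abs_nonneg _).trans (hζ.bound 0)
  refine key.trans ?_
  rw [← integral_const_mul, ← integral_const_mul, ← integral_const_mul, ← integral_add
    (integrable_box (by fun_prop)) (integrable_box (by fun_prop))]
  refine integral_box_mono (by fun_prop) (by fun_prop) fun r hr z _ t _ => ?_
  have hr0 : 0 < r := hε.trans hr.1
  have hq00 := hq0 r hr.1
  simp only
  set P := 2 * Dr U ((r, z), t) * (2 * ζ r * ζ' r) * q r + U ((r, z), t)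
    * ((2 * ζ' r ^ 2 + 2 * ζ r * ζ'' r) * q r + 2 * ζ r * ζ' r * q r ^ 2) with hP
  -- Every term of `P` contains a derivative of the cut-off, so `P = 0` for `r ≤ r₀`. The two
  -- coefficients are at most `4 C² σ²` and `6 C² σ²`, and `72 = 2 · 6²`.
  have hP2 : P ^ 2 ≤ 72 * C ^ 4 * σ ^ 4
      * (Dr U ((r, z), t) ^ 2 + U ((r, z), t) ^ 2 * q r ^ 2) := by
    rcases le_total r r₀ with hrr | hrr
    · have : P = 0 := by rw [hP, hζ.zero' r hrr, hζ.zero'' r hrr]; ring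
      rw [this, zero_pow two_ne_zero]
      positivity
    · have hz1 := hζ.bound r
      have hz2 := hζ.bound' r
      have hz3 := hζ.bound'' r
      have hqσ := hσ r hrr
      have d1 : |4 * (ζ r * ζ' r) * q r| ≤ 4 * C ^ 2 * σ ^ 2 := by
        calc |4 * (ζ r * ζ' r) * q r| = 4 * (|ζ r| * |ζ' r|) * q r := by
              rw [abs_mul, abs_mul, abs_mul, abs_of_pos hq00,
                abs_of_pos (by norm_num : (0 : ℝ) < 4)]
          _ ≤ 4 * (C * (C * σ)) * σ := by gcongr
          _ = _ := by ring
      have d2 : |2 * ζ' r ^ 2 + 2 * (ζ r * ζ'' r) + 2 * (ζ r * ζ' r) * q r|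
          ≤ 6 * C ^ 2 * σ ^ 2 := by
        calc |2 * ζ' r ^ 2 + 2 * (ζ r * ζ'' r) + 2 * (ζ r * ζ' r) * q r|
            ≤ |2 * ζ' r ^ 2| + |2 * (ζ r * ζ'' r)| + |2 * (ζ r * ζ' r) * q r| := abs_add_three _ _ _
          _ = 2 * |ζ' r| ^ 2 + 2 * (|ζ r| * |ζ'' r|) + 2 * (|ζ r| * |ζ' r|) * q r := by
              rw [abs_mul, abs_mul, abs_mul, abs_mul, abs_mul, abs_mul, abs_of_pos hq00, abs_two,
                abs_pow]
          _ ≤ 2 * (C * σ) ^ 2 + 2 * (C * (C * σ ^ 2)) + 2 * (C * (C * σ)) * σ := by gcongr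
          _ = _ := by ring
      have e1 : P = (4 * (ζ r * ζ' r) * q r) * Dr U ((r, z), t)
          + (2 * ζ' r ^ 2 + 2 * (ζ r * ζ'' r) + 2 * (ζ r * ζ' r) * q r)
            * (U ((r, z), t) * q r) := by rw [hP]; ring
      have s1 : (4 * (ζ r * ζ' r) * q r) ^ 2 ≤ (4 * C ^ 2 * σ ^ 2) ^ 2 :=
        sq_le_sq' (neg_le_of_abs_le d1) (le_of_abs_le d1)
      have s2 : (2 * ζ' r ^ 2 + 2 * (ζ r * ζ'' r) + 2 * (ζ r * ζ' r) * q r) ^ 2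
          ≤ (6 * C ^ 2 * σ ^ 2) ^ 2 :=
        sq_le_sq' (neg_le_of_abs_le d2) (le_of_abs_le d2)
      rw [e1]
      generalize 4 * (ζ r * ζ' r) * q r = κ₁ at *
      generalize 2 * ζ' r ^ 2 + 2 * (ζ r * ζ'' r) + 2 * (ζ r * ζ' r) * q r = κ₂ at *
      generalize Dr U ((r, z), t) = y₁
      rw [← mul_pow]
      generalize U ((r, z), t) * q r = y₂
      have t1 := mul_le_mul_of_nonneg_right s1 (sq_nonneg y₁)
      have t2 := mul_le_mul_of_nonneg_right s2 (sq_nonneg y₂)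
      have t3 : (κ₁ * y₁ + κ₂ * y₂) ^ 2 ≤ 2 * (κ₁ ^ 2 * y₁ ^ 2) + 2 * (κ₂ ^ 2 * y₂ ^ 2) := by
        nlinarith [sq_nonneg (κ₁ * y₁ - κ₂ * y₂)]
      have t4 : 0 ≤ C ^ 4 * σ ^ 4 * y₁ ^ 2 := by positivity
      nlinarith
  generalize Dz X ((r, z), t) * (ζ r ^ 2 * q r) = g at *
  generalize (Dr X ((r, z), t) * (ζ r ^ 2 * q r) + X ((r, z), t) * (2 * ζ r * ζ' r * q r
    - ζ r ^ 2 * q r ^ 2)) = g' at *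
  generalize P = P at *
  -- The principal constant may grow only slightly, from `1/9` to `11/90`, since it enters the loop;
  -- the price falls on `P`, which is lower order.
  have h1 : (g + P) ^ 2 ≤ 11 / 10 * g ^ 2 + 11 * P ^ 2 := by
    nlinarith [sq_nonneg (g - 10 * P)]
  have h2 : 1 / 9 * (g + P) ^ 2 ≤ 11 / 90 * (g' ^ 2 + g ^ 2) + 88 * C ^ 4 * σ ^ 4
      * (Dr U ((r, z), t) ^ 2 + U ((r, z), t) ^ 2 * q r ^ 2) := by
    nlinarith [sq_nonneg g']
  have := mul_le_mul_of_nonneg_right h2 hr0.le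
  linarith

end Estimates

/-! ### Lower-order terms by interpolation, and closing the loop -/

section Closing

variable {ν ε R a s t r₀ C d : ℝ} {U V Φ X F f : (ℝ × ℝ) × ℝ → ℝ} {ζ ζ' ζ'' : ℝ → ℝ}

/-- Makes the energy of the squared swirl continuous in time, so that its maximum over `[0, t]` is
attained. -/
lemma continuous_integral_rect {g : (ℝ × ℝ) × ℝ → ℝ} (hg : Continuous g) :
    Continuous fun τ => ∫ x, g (x, τ) ∂rect ε R a := by
  have e : rect ε R a = volume.restrict (Icc ε R ×ˢ Icc (-a) a) := by
    rw [rect, Measure.restrict_congr_set Ioo_ae_eq_Icc, Measure.restrict_congr_set Ioo_ae_eq_Icc,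
      Measure.prod_restrict, Measure.volume_eq_prod]
  rw [e]
  exact continuous_parametric_integral_of_continuous (f := fun τ x => g (x, τ))
    (by fun_prop) (isCompact_Icc.prod isCompact_Icc)

/-- Young's inequality in the form needed for the azimuthal force. -/
lemma young_three {H E L κ : ℝ} (hH : 0 ≤ H) (hE : 0 ≤ E) (hL : 0 ≤ L) (hκ : 0 ≤ κ) (hν : 0 < ν) :
    L * (κ * H ^ (2 / 3 : ℝ) * E) ^ (9 / 20 : ℝ) ≤ H / 20 + ν * E / 20
      + 1 / 4 * (κ ^ (9 / 20 : ℝ) * 6 ^ (3 / 10 : ℝ) * (9 / ν) ^ (9 / 20 : ℝ)) ^ 4 * L ^ 4 := by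
  set c := κ ^ (9 / 20 : ℝ) * 6 ^ (3 / 10 : ℝ) * (9 / ν) ^ (9 / 20 : ℝ) with hc
  have hc0 : 0 ≤ c := by positivity
  -- The exponents `3/10`, `9/20`, `1/4` add up to one. Dividing by `6` and `9` turns these weights
  -- into the small coefficients `1/20` of `H` and of `ν E`; the constant `c` compensates.
  have key := Real.geom_mean_le_arith_mean3_weighted (w₁ := 3 / 10) (w₂ := 9 / 20) (w₃ := 1 / 4)
    (p₁ := H / 6) (p₂ := ν * E / 9) (p₃ := (c * L) ^ 4) (by norm_num) (by norm_num) (by norm_num)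
    (by positivity) (by positivity) (by positivity) (by norm_num)
  have e3 : ((c * L) ^ 4) ^ (1 / 4 : ℝ) = c * L := by
    rw [← Real.rpow_natCast, ← Real.rpow_mul (by positivity)]
    norm_num
  have e1 : H ^ (3 / 10 : ℝ) = 6 ^ (3 / 10 : ℝ) * (H / 6) ^ (3 / 10 : ℝ) := by
    rw [← Real.mul_rpow (by norm_num) (by positivity)]
    congr 1
    ring
  have e2 : E ^ (9 / 20 : ℝ) = (9 / ν) ^ (9 / 20 : ℝ) * (ν * E / 9) ^ (9 / 20 : ℝ) := by
    rw [← Real.mul_rpow (by positivity) (by positivity)]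
    congr 1
    field_simp
  have e4 : (κ * H ^ (2 / 3 : ℝ) * E) ^ (9 / 20 : ℝ)
      = κ ^ (9 / 20 : ℝ) * H ^ (3 / 10 : ℝ) * E ^ (9 / 20 : ℝ) := by
    rw [Real.mul_rpow (by positivity) hE, Real.mul_rpow hκ (by positivity), ← Real.rpow_mul hH]
    norm_num
  rw [e3] at key
  calc L * (κ * H ^ (2 / 3 : ℝ) * E) ^ (9 / 20 : ℝ)
      = (H / 6) ^ (3 / 10 : ℝ) * (ν * E / 9) ^ (9 / 20 : ℝ) * (c * L) := by
        rw [e4, e1, e2, hc]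
        ring
    _ ≤ _ := key
    _ = _ := by ring

/-- The constant of the parabolic interpolation inequality. -/
def interpConst (R a : ℝ) : ℝ := (3 * (5 + R / (2 * a)) ^ 2) ^ (2 / 3 : ℝ)

lemma interpConst_nonneg : 0 ≤ interpConst R a := by
  unfold interpConst; positivity

/-- The convective cut-off term. -/
lemma convective_bound (h : IsFlow ν ε R a t U V Φ X F f) (hε : 0 < ε) (hr₀ : ε < r₀)
    (hR : 2 * r₀ < R) (ha : 0 < a) (hd : 0 ≤ d)
    (hsup : ∀ᵐ τ ∂volume.restrict (Ioo 0 t), ∫ x, U (x, τ) ^ 2 * x.1 ∂rect ε R a ≤ d ^ 2)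
    (hdis : ∫ x, (Dr U x ^ 2 + Dz U x ^ 2 + U x ^ 2 * recip ε x.1.1 ^ 2) * x.1.1 ∂box ε R a t
      ≤ d ^ 2) :
    ∫ x, |U x| * |X x| ^ 2 * x.1.1 ∂box r₀ (2 * r₀) a t ≤ interpConst R a ^ (3 / 10 : ℝ) * d
      * (∫ x, |X x| ^ (20 / 7 : ℝ) * x.1.1 ∂box r₀ (2 * r₀) a t) ^ (7 / 10 : ℝ) := by
  have hεR : ε < R := by linarith
  have hU1 : ContDiff ℝ 1 U := h.smooth_U.of_le (by norm_num)
  have kU : Continuous U := h.smooth_U.continuous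
  have kX : Continuous X := h.smooth_X.continuous
  have h103 := integral_box_rpow_le (s := t) hε hεR.le ha (continuous_recip hε)
    (fun r hr => recip_mul hε hr.1) kU
    ((contDiff_Dir (n := 1) (m := 0) _ hU1 (by norm_num)).continuous)
    ((contDiff_Dir (n := 1) (m := 0) _ hU1 (by norm_num)).continuous)
    (fun r _ z t => hasDerivAt_Dr hU1 r z t) (fun r z t => hasDerivAt_Dz hU1 r z t)
    h.U_outer (sq_nonneg d) hsup
  have kU' : Continuous fun x => |U x| ^ (10 / 3 : ℝ) :=
    kU.abs.rpow_const fun x => Or.inr (by norm_num)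
  have hmono : ∫ x, |U x| ^ (10 / 3 : ℝ) * x.1.1 ∂box r₀ (2 * r₀) a t
      ≤ ∫ x, |U x| ^ (10 / 3 : ℝ) * x.1.1 ∂box ε R a t :=
    integral_box_mono_radii hr₀.le hR.le (by fun_prop) fun r hr z _ τ _ => by
      have := hε.trans hr.1
      positivity
  have hN : ∫ x, |U x| ^ (10 / 3 : ℝ) * x.1.1 ∂box r₀ (2 * r₀) a t
      ≤ interpConst R a * (d ^ 2) ^ (2 / 3 : ℝ) * d ^ 2 := by
    refine hmono.trans (h103.trans ?_)
    exact mul_le_mul_of_nonneg_left hdis (by have := @interpConst_nonneg R a; positivity)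
  -- `|U|` is taken in `L_{10/3}` and `X²` in `L_{10/7}`, that is, `X` in `L_{20/7}`.
  have hol := integral_box_mul_le (ε := r₀) (R := 2 * r₀) (a := a) (s := t) (p := 10 / 3)
    (q := 10 / 7) (Real.holderConjugate_iff.2 ⟨by norm_num, by norm_num⟩) (hε.trans hr₀)
    (f := fun x => |U x|) (g := fun x => |X x| ^ 2)
    (by fun_prop) (by fun_prop) (fun x => abs_nonneg _) (fun x => by positivity)
  have e1 : ∫ x, (|X x| ^ 2) ^ (10 / 7 : ℝ) * x.1.1 ∂box r₀ (2 * r₀) a t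
      = ∫ x, |X x| ^ (20 / 7 : ℝ) * x.1.1 ∂box r₀ (2 * r₀) a t := by
    refine integral_congr_ae (Filter.Eventually.of_forall fun x => ?_)
    simp only
    rw [← Real.rpow_natCast, ← Real.rpow_mul (abs_nonneg _)]
    norm_num
  rw [e1] at hol
  refine hol.trans ?_
  have hQ0 : 0 ≤ ∫ x, |X x| ^ (20 / 7 : ℝ) * x.1.1 ∂box r₀ (2 * r₀) a t :=
    integral_box_weight_nonneg (hε.trans hr₀) fun x => by positivity
  have hN0 : 0 ≤ ∫ x, |U x| ^ (10 / 3 : ℝ) * x.1.1 ∂box r₀ (2 * r₀) a t :=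
    integral_box_weight_nonneg (hε.trans hr₀) fun x => by positivity
  -- The slice energy and the dissipation, both at most `d²`, combine to exactly one power of `d`.
  have hdd : ((d ^ 2) ^ (2 / 3 : ℝ) * d ^ 2) ^ (3 / 10 : ℝ) = d := by
    have : (d ^ 2) ^ (2 / 3 : ℝ) * d ^ 2 = d ^ (10 / 3 : ℝ) := by
      rw [← Real.rpow_natCast, ← Real.rpow_mul hd, ← Real.rpow_add_of_nonneg hd (by norm_num)
        (by norm_num)]
      norm_num
    rw [this, ← Real.rpow_mul hd]
    norm_num
  calc _ ≤ (interpConst R a * (d ^ 2) ^ (2 / 3 : ℝ) * d ^ 2) ^ (1 / (10 / 3) : ℝ)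
        * (∫ x, |X x| ^ (20 / 7 : ℝ) * x.1.1 ∂box r₀ (2 * r₀) a t) ^ (1 / (10 / 7) : ℝ) := by
        gcongr
    _ = _ := by
        rw [mul_assoc (interpConst R a), show (1 / (10 / 3) : ℝ) = 3 / 10 by norm_num,
          Real.mul_rpow interpConst_nonneg (by positivity), hdd]
        norm_num

/-- The term with the azimuthal force. -/
lemma force_bound (h : IsFlow ν ε R a s U V Φ X F f) (hζ : IsCutoff C r₀ ζ ζ' ζ'')
    (hε : 0 < ε) (hr₀ : ε < r₀) (hR : 2 * r₀ < R) (ha : 0 < a) {H : ℝ} (hH0 : 0 ≤ H)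
    (hH : ∀ τ ∈ Ioo 0 s,
      ∫ x, (Φ (x, τ) ^ 2 * (ζ x.1 ^ 2 * recip ε x.1)) ^ 2 * x.1 ∂rect ε R a ≤ H) :
    ∫ x, |f x * (ζ x.1.1 * √(recip ε x.1.1))|
        * (Φ x ^ 2 * (ζ x.1.1 ^ 2 * |recip ε x.1.1|)) ^ (3 / 2 : ℝ) * x.1.1 ∂box ε R a s
      ≤ (∫ x, |f x * (ζ x.1.1 * √(recip ε x.1.1))| ^ (20 / 11 : ℝ) * x.1.1 ∂box ε R a s)
          ^ (11 / 20 : ℝ) * (interpConst R a * H ^ (2 / 3 : ℝ)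
        * ∫ x, ((2 * Φ x * Dr Φ x * (ζ x.1.1 ^ 2 * recip ε x.1.1) + Φ x ^ 2
          * (2 * ζ x.1.1 * ζ' x.1.1 * recip ε x.1.1 - ζ x.1.1 ^ 2 * recip ε x.1.1 ^ 2)) ^ 2
        + (2 * Φ x * Dz Φ x * (ζ x.1.1 ^ 2 * recip ε x.1.1)) ^ 2
        + (Φ x ^ 2 * (ζ x.1.1 ^ 2 * recip ε x.1.1)) ^ 2 * recip ε x.1.1 ^ 2) * x.1.1
          ∂box ε R a s) ^ (9 / 20 : ℝ) := by
  have hεR : ε < R := by linarith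
  have hΦ1 : ContDiff ℝ 1 Φ := h.smooth_Φ.of_le (by norm_num)
  set q := recip ε with hq
  have kq : Continuous q := continuous_recip hε
  have kζ := hζ.continuous
  have kζ' := hζ.continuous'
  have kΦ := h.smooth_Φ.continuous
  have kf := h.cont_f
  have k1 : Continuous (Dr Φ) :=
    (contDiff_Dir (n := 1) (m := 0) _ hΦ1 (by norm_num)).continuous
  have k2 : Continuous (Dz Φ) :=
    (contDiff_Dir (n := 1) (m := 0) _ hΦ1 (by norm_num)).continuous
  have khp : Continuous fun x : (ℝ × ℝ) × ℝ =>
      (Φ x ^ 2 * (ζ x.1.1 ^ 2 * |q x.1.1|)) ^ (3 / 2 : ℝ) :=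
    (by fun_prop : Continuous fun x : (ℝ × ℝ) × ℝ =>
      Φ x ^ 2 * (ζ x.1.1 ^ 2 * |q x.1.1|)).rpow_const fun x => Or.inr (by norm_num)
  have hm : ∀ r ∈ Icc ε R, HasDerivAt (fun r => ζ r ^ 2 * q r)
      (2 * ζ r * ζ' r * q r - ζ r ^ 2 * q r ^ 2) r := fun r hr =>
    (((hζ.hasDeriv r).fun_pow 2).fun_mul (hasDerivAt_recip hε hr.1)).congr_deriv (by
      simp only [Nat.cast_ofNat, Nat.add_one_sub_one, ← hq]; ring)
  have h103 := integral_box_rpow_le (s := s) (H := H) hε hεR.le ha kq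
    (fun r hr => recip_mul hε hr.1) (f := fun x => Φ x ^ 2 * (ζ x.1.1 ^ 2 * q x.1.1))
    (fr := fun x => 2 * Φ x * Dr Φ x * (ζ x.1.1 ^ 2 * q x.1.1) + Φ x ^ 2
          * (2 * ζ x.1.1 * ζ' x.1.1 * q x.1.1 - ζ x.1.1 ^ 2 * q x.1.1 ^ 2))
    (fz := fun x => 2 * Φ x * Dz Φ x * (ζ x.1.1 ^ 2 * q x.1.1))
    (by fun_prop) (by fun_prop) (by fun_prop)
    (fun r hr z t => (((hasDerivAt_Dr hΦ1 r z t).fun_pow 2).fun_mul (hm r hr)).congr_deriv (by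
      simp only [Nat.cast_ofNat, Nat.add_one_sub_one]; ring))
    (fun r z t => (((hasDerivAt_Dz hΦ1 r z t).fun_pow 2).mul_const (ζ r ^ 2 * q r)).congr_deriv (by
      simp only [Nat.cast_ofNat, Nat.add_one_sub_one]; ring))
    (fun z _ t _ => by simp [hζ.zero R hR.le]) hH0
    (by filter_upwards [ae_restrict_mem measurableSet_Ioo] with τ hτ using hH τ hτ)
  -- The conjugate exponent of `20/11` is `20/9`, and `(3/2)(20/9) = 10/3` is the exponent of the
  -- interpolation inequality.
  have hol := integral_box_mul_le (ε := ε) (R := R) (a := a) (s := s) (p := 20 / 11)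
    (q := 20 / 9) (Real.holderConjugate_iff.2 ⟨by norm_num, by norm_num⟩) hε
    (f := fun x => |f x * (ζ x.1.1 * √(q x.1.1))|)
    (by fun_prop) khp (fun x => abs_nonneg _) (fun x => by positivity)
  have e1 : ∫ x, ((Φ x ^ 2 * (ζ x.1.1 ^ 2 * |q x.1.1|)) ^ (3 / 2 : ℝ)) ^ (20 / 9 : ℝ) * x.1.1
      ∂box ε R a s = ∫ x, |Φ x ^ 2 * (ζ x.1.1 ^ 2 * q x.1.1)| ^ (10 / 3 : ℝ) * x.1.1
        ∂box ε R a s := by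
    refine integral_congr_ae (Filter.Eventually.of_forall fun x => ?_)
    simp only
    rw [← Real.rpow_mul (by positivity), abs_mul, abs_mul, abs_of_nonneg (sq_nonneg (Φ x)),
      abs_of_nonneg (sq_nonneg (ζ _))]
    norm_num
  rw [e1] at hol
  refine hol.trans ?_
  rw [show (1 / (20 / 11) : ℝ) = 11 / 20 by norm_num, show (1 / (20 / 9) : ℝ) = 9 / 20 by norm_num]
  refine mul_le_mul_of_nonneg_left ?_ (Real.rpow_nonneg (integral_box_weight_nonneg hε
    fun x => by positivity) _)
  exact Real.rpow_le_rpow (integral_box_weight_nonneg hε fun x => by positivity) h103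
    (by norm_num)

/-- How the two energy inequalities are closed: `y, x` stand for the energy and the dissipation
of the weighted vorticity, `h, e` for those of the weighted squared swirl. -/
lemma closing_arith {y x w h e z g : ℝ → ℝ} {R₁ h₀ b z₀ l : ℝ} (hν : 0 < ν) (ht : 0 ≤ t)
    (hh : ContinuousOn h (Icc 0 t)) (hy : ∀ s ∈ Icc 0 t, 0 ≤ y s)
    (he : ∀ s ∈ Icc 0 t, 0 ≤ e s) (hh0 : ∀ s ∈ Icc 0 t, 0 ≤ h s)
    (hwe : ∀ s ∈ Icc 0 t, w s ≤ e s)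
    (hA : ∀ s ∈ Icc 0 t, 1 / 2 * y s + 9 / 20 * ν * x s ≤ R₁ + 1 / (2 * ν) * w s)
    (hB : ∀ s ∈ Icc 0 t, 1 / 4 * h s + 3 / 4 * ν * e s
      ≤ 1 / 4 * h₀ + g s + 9 / 5 * ν ^ 3 * z s + ν / 5 * w s + b)
    (hZ : ∀ s ∈ Icc 0 t, z s ≤ 11 / 90 * x s + z₀)
    (hg : ∀ H, 0 ≤ H → (∀ s ∈ Icc 0 t, h s ≤ H) → ∀ s ∈ Icc 0 t, g s ≤ H / 20 + ν * e s / 20 + l) :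
    ∀ s ∈ Icc 0 t, 1 / 2 * y s + 9 / 20 * ν * x s
      ≤ R₁ + 5 / 2 / ν ^ 2
        * (1 / 4 * h₀ + 1 / 2 * ν ^ 2 * max R₁ 0 + 9 / 5 * ν ^ 3 * z₀ + b + l) := by
  -- The force bound involves the supremum of `h` over all times. It is absorbed by using the
  -- inequality at the time where `h` is largest.
  obtain ⟨s₀, hs₀, hmax⟩ := isCompact_Icc.exists_isMaxOn (nonempty_Icc.2 ht) hh
  have hmax' : ∀ s ∈ Icc 0 t, h s ≤ h s₀ := fun s hs => hmax hs
  set S := 1 / 4 * h₀ + 1 / 2 * ν ^ 2 * max R₁ 0 + 9 / 5 * ν ^ 3 * z₀ + b + l with hS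
  -- Inserting `hA` and `hZ` into `hB`: `(9/5)(11/90)(20/9) = 22/45 < 1/2`, so the `z` term costs at
  -- most `ν² max R₁ 0 / 2` and `(11/45) ν w`, apart from the `z₀` term. With `ν w / 5` and the `ν e
  -- / 20` of the force this is `(89/180) ν e < ν e / 2`, out of the available `(3/4) ν e`.
  have key : ∀ s ∈ Icc 0 t, 1 / 4 * h s + 1 / 4 * ν * e s ≤ S + h s₀ / 20 := by
    intro s hs
    have h1 : 9 / 20 * ν ^ 3 * x s ≤ ν ^ 2 * max R₁ 0 + 1 / 2 * ν * w s := by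
      have := mul_le_mul_of_nonneg_left
        (((le_add_of_nonneg_left (by have := hy s hs; positivity)).trans (hA s hs)).trans
          (add_le_add_left (le_max_left R₁ 0) _)) (sq_nonneg ν)
      calc 9 / 20 * ν ^ 3 * x s = ν ^ 2 * (9 / 20 * ν * x s) := by ring
        _ ≤ _ := this
        _ = _ := by field_simp
    have h2 := mul_le_mul_of_nonneg_left (hZ s hs) (show 0 ≤ 9 / 5 * ν ^ 3 by positivity)
    have h3 := hg (h s₀) (hh0 _ hs₀) hmax' s hs
    have h4 := mul_le_mul_of_nonneg_left (hwe s hs) hν.le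
    have h5 := hB s hs
    have h6 : 0 ≤ ν * e s := mul_nonneg hν.le (he s hs)
    have h7 : 0 ≤ ν ^ 2 * max R₁ 0 := mul_nonneg (sq_nonneg ν) (le_max_right _ _)
    linarith
  intro s hs
  -- At `s₀` itself: `h / 4 ≤ S + h / 20`. Returning this to `key` bounds `ν w` by `5 S` at every
  -- time.
  have hH : h s₀ ≤ 5 * S := by
    have := key s₀ hs₀
    have := mul_nonneg hν.le (he s₀ hs₀)
    linarith
  have hE : ν * w s ≤ 5 * S := by
    have := key s hs
    have := hh0 s hs
    have := mul_le_mul_of_nonneg_left (hwe s hs) hν.le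
    linarith
  refine (hA s hs).trans (add_le_add_right ?_ _)
  calc 1 / (2 * ν) * w s = 1 / (2 * ν ^ 2) * (ν * w s) := by field_simp
    _ ≤ 1 / (2 * ν ^ 2) * (5 * S) := by gcongr
    _ = _ := by field_simp

/-- The constant of the energy estimate of the weighted vorticity. -/
lemma closing_constants {ν a C κ l₀ σ d₅ d₆ Q y₀ f₀ l h₀ y x : ℝ} (hν : 0 < ν)
    (hκ : 0 ≤ κ) (hl₀ : 0 ≤ l₀) (hσ0 : 0 ≤ σ) (hd₅ : 0 ≤ d₅) (hd₆ : 0 ≤ d₆) (hQ0 : 0 ≤ Q)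
    (hy₀ : 0 ≤ y₀) (hf₀ : 0 ≤ f₀) (hl : 0 ≤ l) (hh₀ : 0 ≤ h₀) (hy : 0 ≤ y) (hx : 0 ≤ x)
    (h : 1 / 2 * y + 9 / 20 * ν * x ≤ (1 / 2 * y₀ + 20 * a ^ 2 / ν * f₀
        + 8 * ν * C ^ 4 * σ ^ 4 * (2 * d₅ ^ 2) + 2 * C ^ 4 * σ ^ 3 * (κ * d₅ * Q))
      + 5 / 2 / ν ^ 2 * (1 / 4 * h₀ + 1 / 2 * ν ^ 2 * (1 / 2 * y₀ + 20 * a ^ 2 / ν * f₀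
        + 8 * ν * C ^ 4 * σ ^ 4 * (2 * d₅ ^ 2) + 2 * C ^ 4 * σ ^ 3 * (κ * d₅ * Q))
        + 9 / 5 * ν ^ 3 * (88 * C ^ 4 * σ ^ 4 * (1 * d₅ ^ 2))
        + C ^ 4 * σ ^ 4 * (d₆ ^ 3 + 6 * ν * d₆ ^ 2) * (1 * d₅ ^ 2) + l₀ * l)) :
    y + x ≤ ((2 + 20 / (9 * ν)) * ((1 / 2 + 20 * a ^ 2 / ν + 16 * ν * C ^ 4 + 2 * C ^ 4 * κ)
      + 5 / 2 / ν ^ 2 * (1 / 4 + 1 / 2 * ν ^ 2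
        * (1 / 2 + 20 * a ^ 2 / ν + 16 * ν * C ^ 4 + 2 * C ^ 4 * κ)
        + 9 / 5 * ν ^ 3 * (88 * C ^ 4) + C ^ 4 * (1 + 6 * ν) + l₀)) + 1)
      * (y₀ + f₀ + l + h₀
        + (1 + σ) ^ 4 * (d₅ ^ 2 * (1 + (1 + d₆) * d₆ ^ 2) + d₅ * Q)) := by
  set R₁ := 1 / 2 * y₀ + 20 * a ^ 2 / ν * f₀
        + 8 * ν * C ^ 4 * σ ^ 4 * (2 * d₅ ^ 2) + 2 * C ^ 4 * σ ^ 3 * (κ * d₅ * Q) with hR₁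
  set m₁ := 1 / 2 + 20 * a ^ 2 / ν + 16 * ν * C ^ 4 + 2 * C ^ 4 * κ with hm₁
  set m₂ := 1 / 4 + 1 / 2 * ν ^ 2 * m₁ + 9 / 5 * ν ^ 3 * (88 * C ^ 4) + C ^ 4 * (1 + 6 * ν) + l₀
    with hm₂
  set P := (1 + σ) ^ 4 * (d₅ ^ 2 * (1 + (1 + d₆) * d₆ ^ 2) + d₅ * Q) with hP
  have hP0 : 0 ≤ P := by positivity
  have hm₁0 : 0 ≤ m₁ := by positivity
  have hm₂0 : 0 ≤ m₂ := by positivity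
  clear_value R₁ m₁ m₂ P
  obtain ⟨T, hT⟩ : ∃ T, T = y₀ + f₀ + l + h₀ + P := ⟨_, rfl⟩
  rw [← hT]
  have hT0 : 0 ≤ T := by rw [hT]; positivity
  have hσ3 : σ ^ 3 ≤ (1 + σ) ^ 4 :=
    (pow_le_pow_left₀ hσ0 (le_add_of_nonneg_left zero_le_one) 3).trans (pow_le_pow_right₀ (le_add_of_nonneg_right hσ0) (by norm_num))
  have hσ4 : σ ^ 4 ≤ (1 + σ) ^ 4 := pow_le_pow_left₀ hσ0 (le_add_of_nonneg_left zero_le_one) 4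
  have p1 : σ ^ 4 * d₅ ^ 2 ≤ P := by
    rw [hP]
    refine mul_le_mul hσ4 ?_ (by positivity) (by positivity)
    have : 0 ≤ d₅ ^ 2 * ((1 + d₆) * d₆ ^ 2) := by positivity
    have : 0 ≤ d₅ * Q := by positivity
    linarith only [‹0 ≤ d₅ ^ 2 * ((1 + d₆) * d₆ ^ 2)›, this]
  have p2 : σ ^ 3 * (d₅ * Q) ≤ P := by
    rw [hP]
    exact mul_le_mul hσ3 (le_add_of_nonneg_left (by positivity)) (by positivity) (by positivity)
  -- `1 + (1 + d₆) d₆²` is `1 + d₆² + d₆³`, so it dominates both the convective power `d₆³` and the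
  -- viscous power `d₆²`.
  have p3 : σ ^ 4 * ((d₆ ^ 3 + 6 * ν * d₆ ^ 2) * d₅ ^ 2) ≤ (1 + 6 * ν) * P := by
    calc σ ^ 4 * ((d₆ ^ 3 + 6 * ν * d₆ ^ 2) * d₅ ^ 2)
        ≤ (1 + σ) ^ 4 * ((1 + 6 * ν) * (d₅ ^ 2 * (1 + (1 + d₆) * d₆ ^ 2) + d₅ * Q)) := by
          refine mul_le_mul hσ4 ?_ (by positivity) (by positivity)
          have : d₆ ^ 3 + 6 * ν * d₆ ^ 2 ≤ (1 + 6 * ν) * (1 + (1 + d₆) * d₆ ^ 2) := by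
            have : 0 ≤ ν * d₆ ^ 3 := by positivity
            nlinarith only [this, hν, sq_nonneg d₆]
          have e1 := mul_le_mul_of_nonneg_right this (sq_nonneg d₅)
          have e2 : 0 ≤ (1 + 6 * ν) * (d₅ * Q) := by positivity
          linarith only [e1, e2]
      _ = _ := by rw [hP]; ring
  have hR₁T : R₁ ≤ m₁ * T := by
    have e1 := mul_le_mul_of_nonneg_left p1 (show 0 ≤ 16 * ν * C ^ 4 by positivity)
    have e2 := mul_le_mul_of_nonneg_left p2 (show 0 ≤ 2 * C ^ 4 * κ by positivity)
    have f1 : y₀ ≤ T := by linarith only [hT, hy₀, hf₀, hl, hh₀, hP0]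
    have f2 : f₀ ≤ T := by linarith only [hT, hy₀, hf₀, hl, hh₀, hP0]
    have f3 : P ≤ T := by linarith only [hT, hy₀, hf₀, hl, hh₀]
    have g1 := mul_le_mul_of_nonneg_left f2 (show 0 ≤ 20 * a ^ 2 / ν by positivity)
    have g2 := mul_le_mul_of_nonneg_left f3 (show 0 ≤ 16 * ν * C ^ 4 by positivity)
    have g3 := mul_le_mul_of_nonneg_left f3 (show 0 ≤ 2 * C ^ 4 * κ by positivity)
    rw [hR₁, hm₁]
    linarith only [e1, e2, f1, g1, g2, g3]
  have hST : 1 / 4 * h₀ + 1 / 2 * ν ^ 2 * R₁ + 9 / 5 * ν ^ 3 * (88 * C ^ 4 * σ ^ 4 * (1 * d₅ ^ 2))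
      + C ^ 4 * σ ^ 4 * (d₆ ^ 3 + 6 * ν * d₆ ^ 2) * (1 * d₅ ^ 2) + l₀ * l ≤ m₂ * T := by
    have f1 : h₀ ≤ T := by linarith only [hT, hy₀, hf₀, hl, hh₀, hP0]
    have f2 : l ≤ T := by linarith only [hT, hy₀, hf₀, hl, hh₀, hP0]
    have f3 : P ≤ T := by linarith only [hT, hy₀, hf₀, hl, hh₀]
    have g1 := mul_le_mul_of_nonneg_left hR₁T (show 0 ≤ 1 / 2 * ν ^ 2 by positivity)
    have g2 := mul_le_mul_of_nonneg_left (p1.trans f3)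
      (show 0 ≤ 9 / 5 * ν ^ 3 * (88 * C ^ 4) by positivity)
    have g3 := mul_le_mul_of_nonneg_left
      (p3.trans (mul_le_mul_of_nonneg_left f3 (show 0 ≤ 1 + 6 * ν by positivity)))
      (show 0 ≤ C ^ 4 by positivity)
    have g4 := mul_le_mul_of_nonneg_left f2 hl₀
    rw [hm₂]
    linarith only [f1, g1, g2, g3, g4]
  set W := R₁ + 5 / 2 / ν ^ 2 * (1 / 4 * h₀ + 1 / 2 * ν ^ 2 * R₁
    + 9 / 5 * ν ^ 3 * (88 * C ^ 4 * σ ^ 4 * (1 * d₅ ^ 2))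
      + C ^ 4 * σ ^ 4 * (d₆ ^ 3 + 6 * ν * d₆ ^ 2) * (1 * d₅ ^ 2) + l₀ * l) with hW
  have hWT : W ≤ (m₁ + 5 / 2 / ν ^ 2 * m₂) * T := by
    have := mul_le_mul_of_nonneg_left hST (show 0 ≤ 5 / 2 / ν ^ 2 by positivity)
    rw [hW, add_mul, mul_assoc (5 / 2 / ν ^ 2)]
    exact add_le_add hR₁T this
  clear_value W
  have y1 : y ≤ 2 * W := by
    have := mul_nonneg hν.le hx
    linarith only [h, this]
  have x1 : x ≤ 20 / (9 * ν) * W := by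
    have e : 9 / 20 * ν * x ≤ W := by linarith only [h, hy]
    calc x = 20 / (9 * ν) * (9 / 20 * ν * x) := by field_simp
      _ ≤ _ := by gcongr
  have e := mul_le_mul_of_nonneg_left hWT (show 0 ≤ 2 + 20 / (9 * ν) by positivity)
  calc y + x ≤ (2 + 20 / (9 * ν)) * W := by linarith only [y1, x1]
    _ ≤ _ := e
    _ ≤ _ := by linarith only [hT0]

set_option maxHeartbeats 1000000 in
/-- The energy estimate of the weighted vorticity. -/
theorem vorticity_bound (hν : 0 < ν) (ha : 0 < a) (R C : ℝ) :
    ∃ M : ℝ, 1 ≤ M ∧ ∀ {ε r₀ t d₅ d₆ : ℝ} {U V Φ X F f : (ℝ × ℝ) × ℝ → ℝ} {ζ ζ' ζ'' : ℝ → ℝ},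
      IsFlow ν ε R a t U V Φ X F f → IsCutoff C r₀ ζ ζ' ζ'' → 0 < ε → ε < r₀ → 2 * r₀ < R →
      0 ≤ t → 0 ≤ d₅ → 0 ≤ d₆ →
      (∀ᵐ τ ∂volume.restrict (Ioo 0 t), ∫ x, U (x, τ) ^ 2 * x.1 ∂rect ε R a ≤ d₅ ^ 2) →
      ∫ x, (Dr U x ^ 2 + Dz U x ^ 2 + Dr V x ^ 2 + Dr Φ x ^ 2 + U x ^ 2 * recip ε x.1.1 ^ 2
        + Φ x ^ 2 * recip ε x.1.1 ^ 2) * x.1.1 ∂box ε R a t ≤ d₅ ^ 2 →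
      (∀ r ∈ Ioo ε R, ∀ z ∈ Ioo (-a) a, ∀ τ ∈ Ioo 0 t, |r * Φ ((r, z), τ)| ≤ d₆) →
      (∀ r ∈ Ioo ε (2 * r₀), ∀ z ∈ Ioo (-a) a, ∀ τ ∈ Ioo 0 t,
        (r * Φ ((r, z), τ)) ^ 2 ≤ 4 / 5 * ν ^ 2) →
      ∀ s ∈ Icc 0 t, ∫ x, (X (x, s) * (ζ x.1 ^ 2 * recip ε x.1)) ^ 2 * x.1 ∂rect ε R a
        + ∫ x, ((Dr X x * (ζ x.1.1 ^ 2 * recip ε x.1.1) + X x * (2 * ζ x.1.1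
          * ζ' x.1.1 * recip ε x.1.1 - ζ x.1.1 ^ 2 * recip ε x.1.1 ^ 2)) ^ 2
        + (Dz X x * (ζ x.1.1 ^ 2 * recip ε x.1.1)) ^ 2) * x.1.1 ∂box ε R a s
      ≤ M * (∫ x, (X (x, 0) * (ζ x.1 ^ 2 * recip ε x.1)) ^ 2 * x.1 ∂rect ε R a
        + ∫ x, (F x * (ζ x.1.1 ^ 2 * recip ε x.1.1)) ^ 2 * x.1.1 ∂box ε R a t
        + ((∫ x, |f x * (ζ x.1.1 * √(recip ε x.1.1))| ^ (20 / 11 : ℝ) * x.1.1 ∂box ε R a t)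
          ^ (11 / 20 : ℝ)) ^ 4
        + ∫ x, (Φ (x, 0) ^ 2 * (ζ x.1 ^ 2 * recip ε x.1)) ^ 2 * x.1 ∂rect ε R a
        + (1 + 1 / r₀) ^ 4 * (d₅ ^ 2 * (1 + (1 + d₆) * d₆ ^ 2) + d₅
          * (∫ x, |X x| ^ (20 / 7 : ℝ) * x.1.1 ∂box r₀ (2 * r₀) a t) ^ (7 / 10 : ℝ))) := by
  set κ := interpConst R a with hκdef
  have hκ0 : 0 ≤ κ := interpConst_nonneg
  set κ' := κ ^ (3 / 10 : ℝ) with hκ'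
  have hκ'0 : 0 ≤ κ' := by positivity
  set l₀ := 1 / 4 * (κ ^ (9 / 20 : ℝ) * 6 ^ (3 / 10 : ℝ) * (9 / ν) ^ (9 / 20 : ℝ)) ^ 4 with hl₀
  have hl0 : 0 ≤ l₀ := by positivity
  set m₁ := 1 / 2 + 20 * a ^ 2 / ν + 16 * ν * C ^ 4 + 2 * C ^ 4 * κ' with hm₁
  have hm₁0 : 0 ≤ m₁ := by positivity
  set m₂ := 1 / 4 + 1 / 2 * ν ^ 2 * m₁ + 9 / 5 * ν ^ 3 * (88 * C ^ 4) + C ^ 4 * (1 + 6 * ν) + l₀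
    with hm₂
  have hm₂0 : 0 ≤ m₂ := by positivity
  -- `2` and `20 / (9 ν)` are the reciprocals of the coefficients `1/2` and `9 ν / 20` on the left
  -- of the closed inequality; the final `+ 1` only ensures `1 ≤ M`.
  refine ⟨(2 + 20 / (9 * ν)) * (m₁ + 5 / 2 / ν ^ 2 * m₂) + 1,
    le_add_of_nonneg_left (by positivity), ?_⟩
  intro ε r₀ t d₅ d₆ U V Φ X F f ζ ζ' ζ'' h hζ hε hr₀ hR ht hd₅ hd₆ hsup hdis hd hκ
  have hεR : ε < R := by linarith
  have hr₀0 : 0 < r₀ := hε.trans hr₀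
  have hU1 : ContDiff ℝ 1 U := h.smooth_U.of_le (by norm_num)
  have hV1 : ContDiff ℝ 1 V := h.smooth_V.of_le (by norm_num)
  have hX1 : ContDiff ℝ 1 X := h.smooth_X.of_le (by norm_num)
  have hΦ1 : ContDiff ℝ 1 Φ := h.smooth_Φ.of_le (by norm_num)
  have kq : Continuous (recip ε) := continuous_recip hε
  have kζ := hζ.continuous
  have kζ' := hζ.continuous'
  have kU := hU1.continuous
  have kΦ := hΦ1.continuous
  have kX := hX1.continuous
  have kF := h.cont_F
  have kf := h.cont_f
  have kD : ∀ e {g : (ℝ × ℝ) × ℝ → ℝ}, ContDiff ℝ 1 g → Continuous (Dir e g) := fun e g hg =>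
    (contDiff_Dir (n := 1) (m := 0) e hg (by norm_num)).continuous
  have kUr : Continuous (Dr U) := kD _ hU1
  have kUz : Continuous (Dz U) := kD _ hU1
  have kVr : Continuous (Dr V) := kD _ hV1
  have kΦr : Continuous (Dr Φ) := kD _ hΦ1
  have kΦz : Continuous (Dz Φ) := kD _ hΦ1
  have kXr : Continuous (Dr X) := kD _ hX1
  have kXz : Continuous (Dz X) := kD _ hX1
  have hpos : ∀ r ∈ Ioo ε R, 0 < r := fun r hr => hε.trans hr.1
  set σ := 1 / r₀ with hσ
  have hσ0 : 0 < σ := by positivity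
  set Q := (∫ x, |X x| ^ (20 / 7 : ℝ) * x.1.1 ∂box r₀ (2 * r₀) a t) ^ (7 / 10 : ℝ) with hQ
  have hQ0 : 0 ≤ Q :=
    Real.rpow_nonneg (integral_box_weight_nonneg hr₀0 fun x => by positivity) _
  set y : ℝ → ℝ := fun s => ∫ x, (X (x, s) * (ζ x.1 ^ 2 * recip ε x.1)) ^ 2 * x.1 ∂rect ε R a
    with hy
  set H : ℝ → ℝ := fun s =>
    ∫ x, (Φ (x, s) ^ 2 * (ζ x.1 ^ 2 * recip ε x.1)) ^ 2 * x.1 ∂rect ε R a with hH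
  set I : ℝ → ℝ := fun s => ∫ x, ((Dr X x * (ζ x.1.1 ^ 2 * recip ε x.1.1) + X x * (2 * ζ x.1.1
          * ζ' x.1.1 * recip ε x.1.1 - ζ x.1.1 ^ 2 * recip ε x.1.1 ^ 2)) ^ 2
        + (Dz X x * (ζ x.1.1 ^ 2 * recip ε x.1.1)) ^ 2) * x.1.1 ∂box ε R a s with hI
  set 𝓕 : ℝ → ℝ := fun s =>
    ∫ x, (F x * (ζ x.1.1 ^ 2 * recip ε x.1.1)) ^ 2 * x.1.1 ∂box ε R a s with h𝓕
  set L : ℝ → ℝ := fun s => (∫ x, |f x * (ζ x.1.1 * √(recip ε x.1.1))| ^ (20 / 11 : ℝ) * x.1.1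
    ∂box ε R a s) ^ (11 / 20 : ℝ) with hL
  set Y : ℝ → ℝ := fun s => ∫ x, (Φ x ^ 2 * (ζ x.1.1 ^ 2 * recip ε x.1.1)) ^ 2
    * recip ε x.1.1 ^ 2 * x.1.1 ∂box ε R a s with hY
  set E : ℝ → ℝ := fun s =>
    ∫ x, ((2 * Φ x * Dr Φ x * (ζ x.1.1 ^ 2 * recip ε x.1.1) + Φ x ^ 2
          * (2 * ζ x.1.1 * ζ' x.1.1 * recip ε x.1.1 - ζ x.1.1 ^ 2 * recip ε x.1.1 ^ 2)) ^ 2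
        + (2 * Φ x * Dz Φ x * (ζ x.1.1 ^ 2 * recip ε x.1.1)) ^ 2
        + (Φ x ^ 2 * (ζ x.1.1 ^ 2 * recip ε x.1.1)) ^ 2 * recip ε x.1.1 ^ 2) * x.1.1 ∂box ε R a s
    with hE
  set P := (1 + σ) ^ 4 * (d₅ ^ 2 * (1 + (1 + d₆) * d₆ ^ 2) + d₅ * Q) with hP
  have hy0 : ∀ s, 0 ≤ y s := fun s => integral_rect_weight_nonneg hε fun x => sq_nonneg _
  have hH0 : ∀ s, 0 ≤ H s := fun s => integral_rect_weight_nonneg hε fun x => sq_nonneg _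
  have hI0 : ∀ s, 0 ≤ I s := fun s => integral_box_weight_nonneg hε fun x => by positivity
  have hE0 : ∀ s, 0 ≤ E s := fun s => integral_box_weight_nonneg hε fun x => by positivity
  have h𝓕0 : ∀ s, 0 ≤ 𝓕 s := fun s => integral_box_weight_nonneg hε fun x => sq_nonneg _
  have hL0 : ∀ s, 0 ≤ L s := fun s =>
    Real.rpow_nonneg (integral_box_weight_nonneg hε fun x => by positivity) _
  have hL1 : ∀ s ∈ Icc 0 t, L s ≤ L t := fun s hs => by
    refine Real.rpow_le_rpow (integral_box_weight_nonneg hε fun x => by positivity)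
      (integral_box_mono_time hs.2 ?_ fun r hr z _ τ _ => ?_) (by norm_num)
    · exact ((by fun_prop : Continuous fun x : (ℝ × ℝ) × ℝ =>
        |f x * (ζ x.1.1 * √(recip ε x.1.1))|).rpow_const fun x => Or.inr (by norm_num)).mul
        (by fun_prop)
    · have := hpos r hr
      positivity
  have h𝓕1 : ∀ s ∈ Icc 0 t, 𝓕 s ≤ 𝓕 t := fun s hs =>
    integral_box_mono_time hs.2 (by fun_prop) fun r hr z _ τ _ => by
      have := hpos r hr
      positivity
  have hdiss : ∀ s ∈ Icc 0 t, ∀ {g : (ℝ × ℝ) × ℝ → ℝ} {k : ℝ}, Continuous g → 0 ≤ k →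
      (∀ x, g x ≤ k * (Dr U x ^ 2 + Dz U x ^ 2 + Dr V x ^ 2 + Dr Φ x ^ 2
        + U x ^ 2 * recip ε x.1.1 ^ 2 + Φ x ^ 2 * recip ε x.1.1 ^ 2)) →
      ∫ x, g x * x.1.1 ∂box ε R a s ≤ k * d₅ ^ 2 := by
    intro s hs g k hg hk hle
    calc ∫ x, g x * x.1.1 ∂box ε R a s
        ≤ ∫ x, k * ((Dr U x ^ 2 + Dz U x ^ 2 + Dr V x ^ 2 + Dr Φ x ^ 2
        + U x ^ 2 * recip ε x.1.1 ^ 2 + Φ x ^ 2 * recip ε x.1.1 ^ 2) * x.1.1) ∂box ε R a s :=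
          integral_box_mono (by fun_prop) (by fun_prop) fun r hr z _ τ _ => by
            rw [← mul_assoc]
            exact mul_le_mul_of_nonneg_right (hle _) (hpos r hr).le
      _ = k * ∫ x, (Dr U x ^ 2 + Dz U x ^ 2 + Dr V x ^ 2 + Dr Φ x ^ 2
        + U x ^ 2 * recip ε x.1.1 ^ 2 + Φ x ^ 2 * recip ε x.1.1 ^ 2) * x.1.1 ∂box ε R a s :=
          integral_const_mul _ _
      _ ≤ k * d₅ ^ 2 := by
          refine mul_le_mul_of_nonneg_left ((integral_box_mono_time hs.2 (by fun_prop)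
            fun r hr z _ τ _ => ?_).trans hdis) hk
          have := hpos r hr
          positivity
  -- `(v_{r,z} - v_{z,r})² ≤ 2 (v_{r,z}² + v_{z,r}²)`, and both squares belong to the dissipation of
  -- `v`.
  have hXX : ∀ s ∈ Icc 0 t, ∫ x, X x ^ 2 * x.1.1 ∂box ε R a s ≤ 2 * d₅ ^ 2 := fun s hs =>
    hdiss s hs (by fun_prop) (by norm_num) fun x => by
      rw [h.vort, Pi.sub_apply]
      linarith only [sq_nonneg (Dz U x + Dr V x), sq_nonneg (Dr U x), sq_nonneg (Dr Φ x),
        mul_nonneg (sq_nonneg (U x)) (sq_nonneg (recip ε x.1.1)),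
        mul_nonneg (sq_nonneg (Φ x)) (sq_nonneg (recip ε x.1.1))]
  have hconv : ∀ s ∈ Icc 0 t, ∫ x, |U x| * |X x| ^ 2 * x.1.1 ∂box r₀ (2 * r₀) a s
      ≤ κ' * d₅ * Q := fun s hs => by
    refine (integral_box_mono_time hs.2 (by fun_prop) fun r hr z _ τ _ => ?_).trans
      (convective_bound h hε hr₀ hR ha hd₅ hsup ?_)
    · have := hr₀0.trans hr.1
      positivity
    · have := hdiss t ⟨ht, le_rfl⟩ (g := fun x => Dr U x ^ 2 + Dz U x ^ 2
        + U x ^ 2 * recip ε x.1.1 ^ 2) (k := 1) (by fun_prop) zero_le_one fun x => by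
          linarith only [sq_nonneg (Dr V x), sq_nonneg (Dr Φ x), mul_nonneg (sq_nonneg (Φ x)) (sq_nonneg (recip ε x.1.1))]
      rwa [one_mul] at this
  set R₁ := 1 / 2 * y 0 + 20 * a ^ 2 / ν * 𝓕 t + 8 * ν * C ^ 4 * σ ^ 4 * (2 * d₅ ^ 2)
    + 2 * C ^ 4 * σ ^ 3 * (κ' * d₅ * Q) with hR₁
  have hR₁0 : 0 ≤ R₁ := by
    have := hy0 0
    have := h𝓕0 t
    positivity
  have hA : ∀ s ∈ Icc 0 t, 1 / 2 * y s + 9 / 20 * ν * I s ≤ R₁ + 1 / (2 * ν) * Y s := fun s hs => by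
    have e := vorticity_estimate (h.mono hs.2) hζ hν hε hr₀ hR ha hs.1
    have e1 := mul_le_mul_of_nonneg_left (hXX s hs) (show 0 ≤ 8 * ν * C ^ 4 * σ ^ 4 by positivity)
    have e2 := mul_le_mul_of_nonneg_left (hconv s hs) (show 0 ≤ 2 * C ^ 4 * σ ^ 3 by positivity)
    have e3 := mul_le_mul_of_nonneg_left (h𝓕1 s hs) (show 0 ≤ 20 * a ^ 2 / ν by positivity)
    refine e.trans ?_
    calc _ ≤ 1 / 2 * y 0 + 1 / (2 * ν) * Y s + 20 * a ^ 2 / ν * 𝓕 t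
          + 8 * ν * C ^ 4 * σ ^ 4 * (2 * d₅ ^ 2) + 2 * C ^ 4 * σ ^ 3 * (κ' * d₅ * Q) :=
          add_le_add (add_le_add (add_le_add_right e3 _) e1) e2
      _ = _ := by rw [hR₁]; ring
  have hIoo : ∀ {s}, s ∈ Icc 0 t → ∀ τ ∈ Ioo 0 s, τ ∈ Ioo 0 t := fun hs τ hτ =>
    ⟨hτ.1, hτ.2.trans_le hs.2⟩
  have hB : ∀ s ∈ Icc 0 t, 1 / 4 * H s + 3 / 4 * ν * E s ≤ 1 / 4 * H 0
      + ∫ x, |f x * (ζ x.1.1 * √(recip ε x.1.1))|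
          * (Φ x ^ 2 * (ζ x.1.1 ^ 2 * |recip ε x.1.1|)) ^ (3 / 2 : ℝ) * x.1.1 ∂box ε R a s
      + 9 / 5 * ν ^ 3 * ∫ x, (U x * (ζ x.1.1 ^ 2 * recip ε x.1.1)) ^ 2 * recip ε x.1.1 ^ 3
          ∂box ε R a s + ν / 5 * Y s + C ^ 4 * σ ^ 4 * (d₆ ^ 3 + 6 * ν * d₆ ^ 2) * (1 * d₅ ^ 2) :=
    fun s hs => by
    have e := swirl_estimate (h.mono hs.2) hζ hν hε hr₀ hR ha hs.1
      (fun r hr z hz τ hτ => hd r hr z hz τ (hIoo hs τ hτ))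
      (fun r hr z hz τ hτ => hκ r hr z hz τ (hIoo hs τ hτ))
    have e1 := mul_le_mul_of_nonneg_left (hdiss s hs (g := fun x => U x ^ 2 * recip ε x.1.1 ^ 2
          + Φ x ^ 2 * recip ε x.1.1 ^ 2 + Dr Φ x ^ 2) (k := 1) (by fun_prop) zero_le_one fun x => by
          linarith only [sq_nonneg (Dr V x), sq_nonneg (Dr U x), sq_nonneg (Dz U x)])
      (show 0 ≤ C ^ 4 * σ ^ 4 * (d₆ ^ 3 + 6 * ν * d₆ ^ 2) by positivity)
    exact e.trans (add_le_add_right e1 _)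
  have hZ : ∀ s ∈ Icc 0 t, ∫ x, (U x * (ζ x.1.1 ^ 2 * recip ε x.1.1)) ^ 2 * recip ε x.1.1 ^ 3
          ∂box ε R a s ≤ 11 / 90 * I s + 88 * C ^ 4 * σ ^ 4 * (1 * d₅ ^ 2) := fun s hs => by
    have e := radial_estimate (h.mono hs.2) hζ hε hr₀ hR ha
    have e1 := mul_le_mul_of_nonneg_left (hdiss s hs (g := fun x => Dr U x ^ 2
          + U x ^ 2 * recip ε x.1.1 ^ 2) (k := 1) (by fun_prop) zero_le_one fun x => by
          linarith only [sq_nonneg (Dr V x), sq_nonneg (Dz U x), sq_nonneg (Dr Φ x),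
            mul_nonneg (sq_nonneg (Φ x)) (sq_nonneg (recip ε x.1.1))])
      (show 0 ≤ 88 * C ^ 4 * σ ^ 4 by positivity)
    exact e.trans (add_le_add_right e1 _)
  have hg : ∀ K, 0 ≤ K → (∀ s ∈ Icc 0 t, H s ≤ K) → ∀ s ∈ Icc 0 t,
      ∫ x, |f x * (ζ x.1.1 * √(recip ε x.1.1))|
          * (Φ x ^ 2 * (ζ x.1.1 ^ 2 * |recip ε x.1.1|)) ^ (3 / 2 : ℝ) * x.1.1 ∂box ε R a s
      ≤ K / 20 + ν * E s / 20 + l₀ * L t ^ 4 := fun K hK0 hK s hs => by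
    have e := force_bound (h.mono hs.2) hζ hε hr₀ hR ha hK0
      (fun τ hτ => hK τ ⟨hτ.1.le, hτ.2.le.trans hs.2⟩)
    refine e.trans ((young_three hK0 (hE0 s) (hL0 s) hκ0 hν).trans ?_)
    have := pow_le_pow_left₀ (hL0 s) (hL1 s hs) 4
    exact add_le_add_right (mul_le_mul_of_nonneg_left this hl0) _
  have hcH : Continuous H := continuous_integral_rect
    (g := fun p => (Φ p ^ 2 * (ζ p.1.1 ^ 2 * recip ε p.1.1)) ^ 2 * p.1.1) (by fun_prop)
  have hYE : ∀ s, Y s ≤ E s := fun s => integral_box_mono (by fun_prop) (by fun_prop)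
    fun r hr z _ τ _ => mul_le_mul_of_nonneg_right (le_add_of_nonneg_left (by positivity))
      (hpos r hr).le
  have key := closing_arith hν ht hcH.continuousOn (fun s _ => hy0 s) (fun s _ => hE0 s)
    (fun s _ => hH0 s) (fun s _ => hYE s) hA hB hZ hg
  intro s hs
  have key1 := key s hs
  rw [max_eq_left hR₁0] at key1
  exact closing_constants hν hκ'0 hl0 hσ0.le hd₅ hd₆ hQ0 (hy0 0) (h𝓕0 t)
    (pow_nonneg (hL0 t) 4) (hH0 0) (hy0 s) (hI0 s) key1

end Closing

/-! ### The cut-off function -/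

section Cutoff

variable {f : ℝ → ℝ} {c : ℝ}

/-- Uses the one-sided derivative along `Iic s`, so the endpoint `s = 1` is included; the lemma can
then be applied again to the derivative. -/
lemma deriv_eq_zero_of_left (hf : Differentiable ℝ f) (h : ∀ s ≤ 1, f s = c) :
    ∀ s ≤ 1, deriv f s = 0 := fun s hs =>
  (uniqueDiffWithinAt_Iic s).eq_deriv _ (hf s).hasDerivAt.hasDerivWithinAt
    ((hasDerivWithinAt_const s (Iic s) c).congr (fun x hx => h x (le_trans hx hs)) (h s hs))

lemma deriv_eq_zero_of_right (hf : Differentiable ℝ f) (h : ∀ s, 2 ≤ s → f s = c) :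
    ∀ s, 2 ≤ s → deriv f s = 0 := fun s hs =>
  (uniqueDiffWithinAt_Ici s).eq_deriv _ (hf s).hasDerivAt.hasDerivWithinAt
    ((hasDerivWithinAt_const s (Ici s) c).congr (fun x hx => h x (le_trans hs hx)) (h s hs))

lemma exists_abs_le_of_eventually_const {c' : ℝ} (hf : Continuous f) (h : ∀ s ≤ 1, f s = c)
    (h' : ∀ s, 2 ≤ s → f s = c') : ∃ B, 0 ≤ B ∧ ∀ s, |f s| ≤ B := by
  obtain ⟨B, hB⟩ := (isCompact_Icc (a := (1 : ℝ)) (b := 2)).exists_bound_of_continuousOn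
    hf.continuousOn
  have h1 := hB 1 ⟨le_rfl, one_le_two⟩
  refine ⟨B, (norm_nonneg _).trans h1, fun s => ?_⟩
  rcases le_total s 1 with hs | hs
  · rwa [h s hs, ← h 1 le_rfl]
  rcases le_total 2 s with hs2 | hs2
  · rw [h' s hs2, ← h' 2 le_rfl]
    exact hB 2 ⟨one_le_two, le_rfl⟩
  · exact hB s ⟨hs, hs2⟩

/-- `Z`, `Z'`, `Z''` are constant on either side of `[1, 2]`, hence bounded, and each derivative of
`Z (r / r₀)` brings a factor `1 / r₀`. So `C` depends on the profile alone. -/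
lemma IsProfile.exists_isCutoff {Z : ℝ → ℝ} (hZ : IsProfile Z) : ∃ C, ∀ r₀, 0 < r₀ →
    IsCutoff C r₀ (cutoff Z r₀) (fun r => deriv Z (r / r₀) * (1 / r₀))
      (fun r => deriv (deriv Z) (r / r₀) * (1 / r₀) * (1 / r₀)) := by
  have hZ0 := hZ.smooth
  have hZ1 : ContDiff ℝ (⊤ : ℕ∞) (deriv Z) := (contDiff_infty_iff_deriv.1 hZ0).2
  have hZ2 : ContDiff ℝ (⊤ : ℕ∞) (deriv (deriv Z)) := (contDiff_infty_iff_deriv.1 hZ1).2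
  have d0 : Differentiable ℝ Z := (contDiff_infty_iff_deriv.1 hZ0).1
  have d1 : Differentiable ℝ (deriv Z) := (contDiff_infty_iff_deriv.1 hZ1).1
  have l1 := deriv_eq_zero_of_left d0 hZ.one
  have l2 := deriv_eq_zero_of_left d1 l1
  have r1 := deriv_eq_zero_of_right d0 hZ.zero
  have r2 := deriv_eq_zero_of_right d1 r1
  obtain ⟨B₀, h₀, hB₀⟩ := exists_abs_le_of_eventually_const hZ0.continuous hZ.one hZ.zero
  obtain ⟨B₁, h₁, hB₁⟩ := exists_abs_le_of_eventually_const hZ1.continuous l1 r1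
  obtain ⟨B₂, h₂, hB₂⟩ := exists_abs_le_of_eventually_const hZ2.continuous l2 r2
  refine ⟨B₀ + B₁ + B₂, fun r₀ hr₀ => ?_⟩
  have hd : ∀ r : ℝ, HasDerivAt (fun x => x / r₀) (1 / r₀) r := fun r =>
    (hasDerivAt_id r).div_const r₀
  have hle : ∀ r, r ≤ r₀ → r / r₀ ≤ 1 := fun r hr => (div_le_one hr₀).2 hr
  have hσ : 0 < 1 / r₀ := by positivity
  have hc := hZ2.continuous
  exact
  { hasDeriv := fun r => (d0 _).hasDerivAt.comp r (hd r)
    hasDeriv' := fun r => ((d1 _).hasDerivAt.comp r (hd r)).mul_const _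
    cont'' := by fun_prop
    bound := fun r => (hB₀ _).trans (by linarith)
    bound' := fun r => by
      rw [abs_mul, abs_of_pos hσ]
      exact mul_le_mul_of_nonneg_right ((hB₁ _).trans (by linarith)) hσ.le
    bound'' := fun r => by
      rw [mul_assoc, ← sq, abs_mul, abs_of_pos (pow_pos hσ 2)]
      exact mul_le_mul_of_nonneg_right ((hB₂ _).trans (by linarith)) (sq_nonneg _)
    zero := fun r hr => hZ.zero _ ((le_div_iff₀ hr₀).2 hr)
    zero' := fun r hr => by rw [l1 _ (hle r hr), zero_mul]
    zero'' := fun r hr => by rw [l2 _ (hle r hr), zero_mul, zero_mul] }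

end Cutoff

/-! ### The estimate in terms of the norms -/

section Conclusion

variable {ν ε R a s t T r₀ C d : ℝ} {vr vφ vz p fr fφ fz ψ : Field} {ζ ζ' ζ'' : ℝ → ℝ}

lemma le_ofReal_sqrt {x : ℝ≥0∞} {K : ℝ} (hK : 0 ≤ K) (h : x ^ 2 ≤ ENNReal.ofReal K) :
    x ≤ ENNReal.ofReal √K := by
  rwa [← ENNReal.pow_le_pow_left_iff two_ne_zero, ← ENNReal.ofReal_pow (Real.sqrt_nonneg K),
    Real.sq_sqrt hK]

/-- The norms carry the factor `2π` of the angle and the energy estimates do not; wherever a norm is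
an upper bound, the factor is simply dropped. -/
lemma le_two_pi_mul {x : ℝ} (hx : 0 ≤ x) : x ≤ 2 * Real.pi * x :=
  le_mul_of_one_le_left hx (by have := Real.pi_gt_three; linarith)

lemma rot_eq (hr : ContDiff ℝ 1 (unc vr)) (hz : ContDiff ℝ 1 (unc vz)) (r z t : ℝ) :
    rot vr vz r z t = vort vr vz ((r, z), t) := by
  rw [rot, dz_eq hr, dr_eq hz]
  rfl

lemma ae_energy_le (hε : 0 < ε) (hr : ContDiff ℝ 1 (unc vr)) (hφ : ContDiff ℝ 1 (unc vφ))
    (hz : ContDiff ℝ 1 (unc vz)) (hV : vecNormV ε R a T vr vφ vz ^ 2 ≤ ENNReal.ofReal (d ^ 2)) :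
    ∀ᵐ τ ∂volume.restrict (Ioo 0 T), ∫ x, unc vr (x, τ) ^ 2 * x.1 ∂rect ε R a ≤ d ^ 2 := by
  filter_upwards [ENNReal.ae_le_essSup
    (f := fun s => normX 2 ε R a (vecAbs vr vφ vz) s)] with τ hτ
  have k1 := hr.continuous
  have k2 := hφ.continuous
  have k3 := hz.continuous
  have h1 := (pow_le_pow_left₀ zero_le (hτ.trans le_self_add) 2).trans hV
  rw [normX_two_sq hε (G := fun x => √(unc vr (x, τ) ^ 2 + unc vφ (x, τ) ^ 2 + unc vz (x, τ) ^ 2))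
    (by fun_prop) (fun r _ z _ => rfl), ENNReal.ofReal_le_ofReal_iff (sq_nonneg d)] at h1
  refine le_trans ?_ ((le_two_pi_mul (integral_rect_weight_nonneg hε fun x => sq_nonneg _)).trans
    h1)
  refine integral_mono_ae (integrable_rect (by fun_prop)) (integrable_rect (by fun_prop)) ?_
  filter_upwards [ae_rect] with x hx
  refine mul_le_mul_of_nonneg_right ?_ (hε.trans hx.1.1).le
  rw [Real.sq_sqrt (by positivity)]
  linarith [sq_nonneg (unc vφ (x, τ)), sq_nonneg (unc vz (x, τ))]

lemma dissipation_le (hε : 0 < ε) (hr : ContDiff ℝ 1 (unc vr)) (hφ : ContDiff ℝ 1 (unc vφ))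
    (hz : ContDiff ℝ 1 (unc vz)) (hV : vecNormV ε R a T vr vφ vz ^ 2 ≤ ENNReal.ofReal (d ^ 2)) :
    ∫ x, (Dr (unc vr) x ^ 2 + Dz (unc vr) x ^ 2 + Dr (unc vz) x ^ 2 + Dr (unc vφ) x ^ 2
      + unc vr x ^ 2 * recip ε x.1.1 ^ 2 + unc vφ x ^ 2 * recip ε x.1.1 ^ 2) * x.1.1 ∂box ε R a T
      ≤ d ^ 2 := by
  have k1 := hr.continuous
  have k2 := hφ.continuous
  have k3 := hz.continuous
  have kq := continuous_recip hε
  have kD : ∀ e {g : (ℝ × ℝ) × ℝ → ℝ}, ContDiff ℝ 1 g → Continuous (Dir e g) := fun e g hg =>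
    (contDiff_Dir (n := 1) (m := 0) e hg (by norm_num)).continuous
  have j1 := kD ((1, 0), 0) hr
  have j2 := kD ((0, 1), 0) hr
  have j3 := kD ((1, 0), 0) hφ
  have j4 := kD ((0, 1), 0) hφ
  have j5 := kD ((1, 0), 0) hz
  have j6 := kD ((0, 1), 0) hz
  have h1 := (pow_le_pow_left₀ zero_le le_add_self 2).trans hV
  rw [normXT_two_sq hε (G := fun x => √(Dr (unc vr) x ^ 2 + Dz (unc vr) x ^ 2
      + (Dr (unc vφ) x ^ 2 + Dz (unc vφ) x ^ 2) + (Dr (unc vz) x ^ 2 + Dz (unc vz) x ^ 2)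
      + unc vr x ^ 2 * recip ε x.1.1 ^ 2 + unc vφ x ^ 2 * recip ε x.1.1 ^ 2))
    (by fun_prop) ?_, ENNReal.ofReal_le_ofReal_iff (sq_nonneg d)] at h1
  · refine le_trans ?_ ((le_two_pi_mul (integral_box_weight_nonneg hε fun x => sq_nonneg _)).trans
      h1)
    refine integral_box_mono (by fun_prop) (by fun_prop) fun r hr z _ τ _ => ?_
    refine mul_le_mul_of_nonneg_right ?_ (hε.trans hr.1).le
    rw [Real.sq_sqrt (by positivity)]
    linarith [sq_nonneg (Dz (unc vφ) ((r, z), τ)), sq_nonneg (Dz (unc vz) ((r, z), τ))]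
  · intro r hr' z _ τ _
    simp only [vecGradAbs, gradAbs]
    rw [Real.sq_sqrt (by positivity), Real.sq_sqrt (by positivity), Real.sq_sqrt (by positivity),
      dr_eq hr, dz_eq hr, dr_eq hφ, dz_eq hφ, dr_eq hz, dz_eq hz, recip_eq hε hr'.1.le, inv_pow,
      div_eq_mul_inv, div_eq_mul_inv]
    rfl

lemma swirl_abs_le (hε : 0 < ε) (hφ : ContDiff ℝ 1 (unc vφ)) (hd : 0 ≤ d)
    (h : normXT ∞ ε R a T (swirl vφ) ≤ ENNReal.ofReal d) :
    ∀ r ∈ Ioo ε R, ∀ z ∈ Ioo (-a) a, ∀ τ ∈ Ioo 0 T, |r * unc vφ ((r, z), τ)| ≤ d :=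
  abs_le_of_normXT_top_le hε hd (G := fun x => x.1.1 * unc vφ x)
    (by have := hφ.continuous; fun_prop) (fun _ _ _ _ _ _ => rfl) h

lemma chiOverR_eq (hε : 0 < ε) (hr : ContDiff ℝ 1 (unc vr)) (hz : ContDiff ℝ 1 (unc vz))
    {r : ℝ} (h : ε < r) (z t : ℝ) : chiOverR ζ vr vz r z t
      = vort vr vz ((r, z), t) * (ζ r ^ 2 * recip ε r) := by
  rw [chiOverR, cut, rot_eq hr hz, recip_eq hε h.le, div_eq_mul_inv]

lemma dr_chiOverR (hε : 0 < ε) (hr : ContDiff ℝ 1 (unc vr)) (hz : ContDiff ℝ 1 (unc vz))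
    (hX : ContDiff ℝ 1 (vort vr vz)) (hζ : IsCutoff C r₀ ζ ζ' ζ'') {r : ℝ} (h : ε < r) (z t : ℝ) :
    dr (chiOverR ζ vr vz) r z t = Dr (vort vr vz) ((r, z), t) * (ζ r ^ 2 * recip ε r)
      + vort vr vz ((r, z), t) * (2 * ζ r * ζ' r * recip ε r - ζ r ^ 2 * recip ε r ^ 2) := by
  have h1 : HasDerivAt (fun x => vort vr vz ((x, z), t) * (ζ x ^ 2 * recip ε x)) _ r :=
    (hasDerivAt_Dr hX r z t).fun_mul (((hζ.hasDeriv r).fun_pow 2).fun_mul (hasDerivAt_recip hε h.le))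
  refine (h1.congr_of_eventuallyEq ?_).deriv.trans ?_
  · filter_upwards [lt_mem_nhds h] with x hx using chiOverR_eq hε hr hz hx z t
  · simp only [Nat.cast_ofNat, Nat.add_one_sub_one]
    ring

lemma dz_chiOverR (hε : 0 < ε) (hr : ContDiff ℝ 1 (unc vr)) (hz : ContDiff ℝ 1 (unc vz))
    (hX : ContDiff ℝ 1 (vort vr vz)) {r : ℝ} (h : ε < r) (z t : ℝ) :
    dz (chiOverR ζ vr vz) r z t = Dz (vort vr vz) ((r, z), t) * (ζ r ^ 2 * recip ε r) := by
  have e : (fun x => chiOverR ζ vr vz r x t)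
      = fun x => vort vr vz ((r, x), t) * (ζ r ^ 2 * recip ε r) :=
    funext fun x => chiOverR_eq hε hr hz h x t
  rw [dz, e]
  exact ((hasDerivAt_Dz hX r z t).mul_const _).deriv

/-- Each of the two summands of the norm is at most `√(2πK)`, and the square of their sum is at most
`4 · 2πK`. -/
lemma normV_chiOverR_sq_le (hε : 0 < ε) (hr : ContDiff ℝ 1 (unc vr)) (hz : ContDiff ℝ 1 (unc vz))
    (hX : ContDiff ℝ 1 (vort vr vz)) (hζ : IsCutoff C r₀ ζ ζ' ζ'') {K : ℝ}
    (hK : 0 ≤ K) (hy : ∀ s ∈ Ioo 0 t,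
      ∫ x, (vort vr vz (x, s) * (ζ x.1 ^ 2 * recip ε x.1)) ^ 2 * x.1 ∂rect ε R a ≤ K)
    (hI : ∫ x, ((Dr (vort vr vz) x * (ζ x.1.1 ^ 2 * recip ε x.1.1) + vort vr vz x * (2 * ζ x.1.1
          * ζ' x.1.1 * recip ε x.1.1 - ζ x.1.1 ^ 2 * recip ε x.1.1 ^ 2)) ^ 2
        + (Dz (vort vr vz) x * (ζ x.1.1 ^ 2 * recip ε x.1.1)) ^ 2) * x.1.1 ∂box ε R a t ≤ K) :
    normV ε R a t (chiOverR ζ vr vz) ^ 2 ≤ ENNReal.ofReal (8 * Real.pi * K) := by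
  have kX := hX.continuous
  have kq := continuous_recip hε
  have kζ := hζ.continuous
  have kζ' := hζ.continuous'
  have kD : ∀ e {g : (ℝ × ℝ) × ℝ → ℝ}, ContDiff ℝ 1 g → Continuous (Dir e g) := fun e g hg =>
    (contDiff_Dir (n := 1) (m := 0) e hg (by norm_num)).continuous
  have j1 := kD ((1, 0), 0) hX
  have j2 := kD ((0, 1), 0) hX
  have h2K : 0 ≤ 2 * Real.pi * K := by positivity
  have h1 : essSup (fun s => normX 2 ε R a (chiOverR ζ vr vz) s) (volume.restrict (Ioo 0 t))
      ≤ ENNReal.ofReal √(2 * Real.pi * K) := by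
    refine essSup_le_of_ae_le _ ?_
    filter_upwards [ae_restrict_mem measurableSet_Ioo] with s hs
    refine le_ofReal_sqrt h2K ?_
    rw [normX_two_sq hε (G := fun x => vort vr vz (x, s) * (ζ x.1 ^ 2 * recip ε x.1))
      (by fun_prop) (fun r hr' z _ => chiOverR_eq hε hr hz hr'.1 z s)]
    exact ENNReal.ofReal_le_ofReal (mul_le_mul_of_nonneg_left (hy s hs) (by positivity))
  have h2 : normXT 2 ε R a t (gradAbs (chiOverR ζ vr vz))
      ≤ ENNReal.ofReal √(2 * Real.pi * K) := by
    refine le_ofReal_sqrt h2K ?_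
    rw [normXT_two_sq hε (G := fun x => √((Dr (vort vr vz) x * (ζ x.1.1 ^ 2 * recip ε x.1.1)
        + vort vr vz x * (2 * ζ x.1.1
          * ζ' x.1.1 * recip ε x.1.1 - ζ x.1.1 ^ 2 * recip ε x.1.1 ^ 2)) ^ 2
        + (Dz (vort vr vz) x * (ζ x.1.1 ^ 2 * recip ε x.1.1)) ^ 2)) (by fun_prop)
      (fun r hr' z _ τ _ => by
        rw [gradAbs, dr_chiOverR hε hr hz hX hζ hr'.1, dz_chiOverR hε hr hz hX hr'.1])]
    refine ENNReal.ofReal_le_ofReal (mul_le_mul_of_nonneg_left (le_trans (le_of_eq ?_) hI)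
      (by positivity))
    refine integral_congr_ae (Filter.Eventually.of_forall fun x => ?_)
    simp only
    rw [Real.sq_sqrt (by positivity)]
  calc normV ε R a t (chiOverR ζ vr vz) ^ 2
      ≤ (ENNReal.ofReal √(2 * Real.pi * K) + ENNReal.ofReal √(2 * Real.pi * K)) ^ 2 :=
        pow_le_pow_left₀ zero_le (add_le_add h1 h2) 2
    _ = ENNReal.ofReal (8 * Real.pi * K) := by
        rw [← ENNReal.ofReal_add (Real.sqrt_nonneg _) (Real.sqrt_nonneg _),
          ← ENNReal.ofReal_pow (by positivity), ← two_mul, mul_pow, Real.sq_sqrt h2K]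
        congr 1
        ring

lemma le_normX_chiOverR_sq (hε : 0 < ε) (hr : ContDiff ℝ 1 (unc vr)) (hz : ContDiff ℝ 1 (unc vz))
    (hX : Continuous (vort vr vz)) (hζ : Continuous ζ) :
    ENNReal.ofReal (∫ x, (vort vr vz (x, s) * (ζ x.1 ^ 2 * recip ε x.1)) ^ 2 * x.1 ∂rect ε R a)
      ≤ normX 2 ε R a (chiOverR ζ vr vz) s ^ 2 := by
  have kq := continuous_recip hε
  rw [normX_two_sq hε (G := fun x => vort vr vz (x, s) * (ζ x.1 ^ 2 * recip ε x.1))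
      (by fun_prop) (fun r hr' z _ => chiOverR_eq hε hr hz hr'.1 z s)]
  exact ENNReal.ofReal_le_ofReal
    (le_two_pi_mul (integral_rect_weight_nonneg hε fun x => sq_nonneg _))

lemma le_normXT_forceOverR_sq (hε : 0 < ε) {F : (ℝ × ℝ) × ℝ → ℝ} (hF : Continuous F)
    (hζ : Continuous ζ)
    (h : ∀ r ∈ Ioo ε R, ∀ z ∈ Ioo (-a) a, ∀ τ ∈ Ioo 0 t, rot fr fz r z τ = F ((r, z), τ)) :
    ENNReal.ofReal (∫ x, (F x * (ζ x.1.1 ^ 2 * recip ε x.1.1)) ^ 2 * x.1.1 ∂box ε R a t)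
      ≤ normXT 2 ε R a t (forceOverR ζ fr fz) ^ 2 := by
  have kq := continuous_recip hε
  rw [normXT_two_sq hε (G := fun x => F x * (ζ x.1.1 ^ 2 * recip ε x.1.1))
      (by fun_prop) (fun r hr z hz τ hτ => by
        rw [forceOverR, cut, h r hr z hz τ hτ, recip_eq hε hr.1.le, div_eq_mul_inv])]
  exact ENNReal.ofReal_le_ofReal
    (le_two_pi_mul (integral_box_weight_nonneg hε fun x => sq_nonneg _))

lemma le_normXT_overSqrtR_pow (hε : 0 < ε) {g : Field} {f : (ℝ × ℝ) × ℝ → ℝ} (hf : Continuous f)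
    (hζ : Continuous ζ)
    (h : ∀ r ∈ Ioo ε R, ∀ z ∈ Ioo (-a) a, ∀ τ ∈ Ioo 0 t, g r z τ = f ((r, z), τ)) :
    ENNReal.ofReal (((∫ x, |f x * (ζ x.1.1 * √(recip ε x.1.1))| ^ (20 / 11 : ℝ) * x.1.1
      ∂box ε R a t) ^ (11 / 20 : ℝ)) ^ 4) ≤ normXT (20 / 11) ε R a t (overSqrtR ζ g) ^ 4 := by
  have kq := continuous_recip hε
  have h0 : 0 ≤ ∫ x, |f x * (ζ x.1.1 * √(recip ε x.1.1))| ^ (20 / 11 : ℝ) * x.1.1 ∂box ε R a t :=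
    integral_box_weight_nonneg hε fun x => by positivity
  rw [normXT_eq hε (q := 20 / 11) (by simp) (by norm_num)
      (G := fun x => f x * (ζ x.1.1 * √(recip ε x.1.1))) (by fun_prop) (fun r hr z hz τ hτ => by
        rw [overSqrtR, cut, h r hr z hz τ hτ, recip_eq hε hr.1.le, Real.sqrt_inv, div_eq_mul_inv]),
    ← ENNReal.ofReal_pow (by positivity), show (1 / (20 / 11) : ℝ) = 11 / 20 by norm_num]
  exact ENNReal.ofReal_le_ofReal (pow_le_pow_left₀ (by positivity)
    (Real.rpow_le_rpow h0 (le_two_pi_mul h0) (by norm_num)) 4)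

lemma le_normX_overSqrtR_pow (hε : 0 < ε) {g : Field} (hg : Continuous (unc g))
    (hζ : Continuous ζ) :
    ENNReal.ofReal (∫ x, (unc g (x, s) ^ 2 * (ζ x.1 ^ 2 * recip ε x.1)) ^ 2 * x.1 ∂rect ε R a)
      ≤ normX 4 ε R a (overSqrtR ζ g) s ^ 4 := by
  have kq := continuous_recip hε
  have e : ∫ x, |unc g (x, s) * (ζ x.1 * √(recip ε x.1))| ^ (4 : ℝ) * x.1 ∂rect ε R a
      = ∫ x, (unc g (x, s) ^ 2 * (ζ x.1 ^ 2 * recip ε x.1)) ^ 2 * x.1 ∂rect ε R a := by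
    refine integral_congr_ae ?_
    filter_upwards [ae_rect] with x hx
    have hq : 0 ≤ recip ε x.1 := by
      rw [recip_eq hε hx.1.1.le]
      exact inv_nonneg.2 (hε.trans hx.1.1).le
    rw [show (4 : ℝ) = ((4 : ℕ) : ℝ) by norm_num, Real.rpow_natCast, show 4 = 2 * 2 by norm_num,
      pow_mul, sq_abs, mul_pow, mul_pow (ζ x.1), Real.sq_sqrt hq]
  have h0 : 0 ≤ ∫ x, (unc g (x, s) ^ 2 * (ζ x.1 ^ 2 * recip ε x.1)) ^ 2 * x.1 ∂rect ε R a :=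
    integral_rect_weight_nonneg hε fun x => sq_nonneg _
  rw [normX_eq hε (q := 4) (by simp) (by norm_num)
      (G := fun x => unc g (x, s) * (ζ x.1 * √(recip ε x.1))) (by fun_prop) (fun r hr z _ => by
        rw [overSqrtR, cut, recip_eq hε hr.1.le, Real.sqrt_inv, div_eq_mul_inv]; rfl),
    e, ← ENNReal.ofReal_pow (by positivity), ← Real.rpow_natCast _ 4,
    ← Real.rpow_mul (by positivity)]
  refine ENNReal.ofReal_le_ofReal ((le_two_pi_mul h0).trans (le_of_eq ?_))
  norm_num

lemma le_normXT_rot_sq (h₀ : 0 < r₀) (hr : ContDiff ℝ 1 (unc vr)) (hz : ContDiff ℝ 1 (unc vz))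
    (hX : Continuous (vort vr vz)) :
    ENNReal.ofReal ((∫ x, |vort vr vz x| ^ (20 / 7 : ℝ) * x.1.1 ∂box r₀ (2 * r₀) a t)
      ^ (7 / 10 : ℝ)) ≤ normXT (20 / 7) r₀ (2 * r₀) a t (rot vr vz) ^ 2 := by
  have h0 : 0 ≤ ∫ x, |vort vr vz x| ^ (20 / 7 : ℝ) * x.1.1 ∂box r₀ (2 * r₀) a t :=
    integral_box_weight_nonneg h₀ fun x => by positivity
  rw [normXT_eq h₀ (q := 20 / 7) (by simp) (by norm_num) hX
      (fun r _ z _ τ _ => rot_eq hr hz r z τ),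
    ← ENNReal.ofReal_pow (by positivity), ← Real.rpow_natCast _ 2, ← Real.rpow_mul (by positivity)]
  norm_num
  exact ENNReal.ofReal_le_ofReal (Real.rpow_le_rpow h0 (le_two_pi_mul h0) (by norm_num))

end Conclusion

end AxiNS

end

/-! ### Assembly of the final estimate -/

theorem lemma4p5 (ν R a : ℝ) (hν : 0 < ν) (hR : 0 < R) (ha : 0 < a)
    (Z : ℝ → ℝ) (hZ : AxiNS.IsProfile Z) :
    ∃ (c : ℝ) (k : ℝ → ℝ), 0 < c ∧ Monotone k ∧ (∀ σ, 0 < k σ) ∧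
      ∀ (T r₀ ε : ℝ), 0 < T → 0 < r₀ → 2 * r₀ < R → 0 < ε → ε < r₀ →
      ∀ (vr vφ vz p fr fφ fz ψ : AxiNS.Field),
        AxiNS.IsSolution ν R a T ε vr vφ vz p fr fφ fz →
        AxiNS.IsStreamFunction R a T ε vr vz ψ →
        AxiNS.normX 2 ε R a (AxiNS.chiOverR (AxiNS.cutoff Z r₀) vr vz) 0 < ∞ →
        AxiNS.normXT 2 ε R a T (AxiNS.forceOverR (AxiNS.cutoff Z r₀) fr fz) < ∞ →
        AxiNS.normXT (20 / 11) ε R a T (AxiNS.overSqrtR (AxiNS.cutoff Z r₀) fφ) < ∞ →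
        AxiNS.normX 4 ε R a (AxiNS.overSqrtR (AxiNS.cutoff Z r₀) vφ) 0 < ∞ →
      ∀ (d₅ d₆ : ℝ), 0 ≤ d₅ → 0 ≤ d₆ →
        AxiNS.vecNormV ε R a T vr vφ vz ^ 2 ≤ ENNReal.ofReal (d₅ ^ 2) →
        AxiNS.normXT ∞ ε R a T (AxiNS.swirl vφ) ≤ ENNReal.ofReal d₆ →
        AxiNS.normXT ∞ ε (2 * r₀) a T (AxiNS.swirl vφ)
          ≤ ENNReal.ofReal ((5 / 8 : ℝ) ^ (1 / 4 : ℝ) * ν) →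
      ∀ t, 0 < t → t ≤ T →
        AxiNS.normV ε R a t (AxiNS.chiOverR (AxiNS.cutoff Z r₀) vr vz) ^ 2
          ≤ ENNReal.ofReal (k (1 / r₀) * d₅)
              * AxiNS.normXT (20 / 7) r₀ (2 * r₀) a t (AxiNS.rot vr vz) ^ 2
            + ENNReal.ofReal c
              * AxiNS.Asq (k (1 / r₀)) d₅ d₆ R a t ε (AxiNS.cutoff Z r₀) vr vφ vz fr fφ fz := by
  obtain ⟨C, hcut⟩ := hZ.exists_isCutoff
  obtain ⟨M, hM, hmain⟩ := AxiNS.vorticity_bound hν ha R C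
  have hπ := Real.pi_gt_three
  have hM0 : 0 < M := by linarith
  have hc1 : 1 ≤ 8 * Real.pi * M := by nlinarith
  -- `(1 + σ)^4` is the growth in `σ = 1 / r₀` from `vorticity_bound`; `max σ 0` only makes the
  -- function positive and monotone for negative arguments.
  refine ⟨8 * Real.pi * M, fun σ => 8 * Real.pi * M * (1 + max σ 0) ^ 4, by linarith, ?_, ?_, ?_⟩
  · intro σ σ' h
    have : max σ 0 ≤ max σ' 0 := max_le_max_right _ h
    have : 0 ≤ max σ 0 := le_max_right _ _
    dsimp only
    gcongr
  · intro σ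
    have : 0 ≤ max σ 0 := le_max_right _ _
    positivity
  intro T r₀ ε _ hr₀ h2R hε hεr₀ vr vφ vz p fr fφ fz ψ hs hψ _ _ _ _ d₅ d₆ hd₅ hd₆ hV hu hu' t ht htT
  have hr : ContDiff ℝ 1 (AxiNS.unc vr) := hs.smooth_r.contDiff_unc.of_le (by norm_num)
  have hφ : ContDiff ℝ 1 (AxiNS.unc vφ) := hs.smooth_φ.contDiff_unc.of_le (by norm_num)
  have hz : ContDiff ℝ 1 (AxiNS.unc vz) := hs.smooth_z.contDiff_unc.of_le (by norm_num)
  have hζ := hcut r₀ hr₀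
  have hflow := (hs.isFlow hψ ha hε (by linarith)).mono htT
  have hX : ContDiff ℝ 1 (AxiNS.vort vr vz) := hflow.smooth_X.of_le (by norm_num)
  have hI : ∀ τ ∈ Ioo 0 t, τ ∈ Ioo 0 T := fun τ hτ => ⟨hτ.1, hτ.2.trans_le htT⟩
  have hsub : ∀ r ∈ Ioo ε (2 * r₀), ∀ z ∈ Ioo (-a) a, ∀ τ ∈ Ioo 0 t,
      (r * AxiNS.unc vφ ((r, z), τ)) ^ 2 ≤ 4 / 5 * ν ^ 2 := fun r hr' z hz' τ hτ => by
    have h1 := AxiNS.swirl_abs_le hε hφ (by positivity) hu' r hr' z hz' τ (hI τ hτ)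
    -- `√(5/8) ≤ 4/5`, because `5/8 ≤ 16/25`.
    have h2 : ((5 / 8 : ℝ) ^ (1 / 4 : ℝ)) ^ 2 ≤ 4 / 5 := by
      refine le_of_sq_le_sq ?_ (by norm_num)
      rw [← pow_mul, ← Real.rpow_natCast, ← Real.rpow_mul (by norm_num)]
      norm_num
    calc _ = |r * AxiNS.unc vφ ((r, z), τ)| ^ 2 := (sq_abs _).symm
      _ ≤ ((5 / 8 : ℝ) ^ (1 / 4 : ℝ) * ν) ^ 2 := pow_le_pow_left₀ (abs_nonneg _) h1 2
      _ ≤ _ := by rw [mul_pow]; exact mul_le_mul_of_nonneg_right h2 (sq_nonneg ν)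
  have hdis := (AxiNS.integral_box_mono_time htT (by
      have k1 := hr.continuous
      have k2 := hφ.continuous
      have kq := AxiNS.continuous_recip hε
      have kD : ∀ e {g : (ℝ × ℝ) × ℝ → ℝ}, ContDiff ℝ 1 g → Continuous (AxiNS.Dir e g) :=
        fun e g hg => (AxiNS.contDiff_Dir (n := 1) (m := 0) e hg (by norm_num)).continuous
      have j1 := kD ((1, 0), 0) hr
      have j2 := kD ((0, 1), 0) hr
      have j3 := kD ((1, 0), 0) hφ
      have j4 := kD ((1, 0), 0) hz
      fun_prop) (fun r hr' z _ τ _ => mul_nonneg (by positivity) (hε.trans hr'.1).le)).trans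
    (AxiNS.dissipation_le hε hr hφ hz hV)
  have key := hmain hflow hζ hε hεr₀ h2R ht.le hd₅ hd₆
    (ae_restrict_of_ae_restrict_of_subset (Ioo_subset_Ioo_right htT)
      (AxiNS.ae_energy_le hε hr hφ hz hV)) hdis
    (fun r hr' z hz' τ hτ => AxiNS.swirl_abs_le hε hφ hd₆ hu r hr' z hz' τ (hI τ hτ)) hsub
  have e1 := AxiNS.le_normX_chiOverR_sq (s := 0) (R := R) (a := a) hε hr hz hX.continuous
    hζ.continuous
  have e2 := AxiNS.le_normXT_forceOverR_sq hε hflow.cont_F hζ.continuous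
    (fun r hr' z hz' τ hτ => hs.rot_force_eq hε hr' hz' (hI τ hτ))
  have e3 := AxiNS.le_normXT_overSqrtR_pow hε hflow.cont_f hζ.continuous
    (fun r hr' z hz' τ hτ => hs.swirlForce_eq hε hr' hz' (hI τ hτ))
  have e4 := AxiNS.le_normX_overSqrtR_pow (s := 0) (R := R) (a := a) hε hφ.continuous hζ.continuous
  have e5 := AxiNS.le_normXT_rot_sq (t := t) (a := a) hr₀ hr hz hX.continuous
  have p1 : 0 ≤ ∫ x, (AxiNS.vort vr vz (x, 0) * (AxiNS.cutoff Z r₀ x.1 ^ 2 * AxiNS.recip ε x.1)) ^ 2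
      * x.1 ∂AxiNS.rect ε R a := AxiNS.integral_rect_weight_nonneg hε fun x => sq_nonneg _
  have p2 : 0 ≤ ∫ x, (AxiNS.vortForce ν ε vr vφ vz x * (AxiNS.cutoff Z r₀ x.1.1 ^ 2
      * AxiNS.recip ε x.1.1)) ^ 2 * x.1.1 ∂AxiNS.box ε R a t :=
    AxiNS.integral_box_weight_nonneg hε fun x => sq_nonneg _
  have p3 : 0 ≤ ((∫ x, |AxiNS.swirlForce ν ε vr vφ vz x * (AxiNS.cutoff Z r₀ x.1.1
      * √(AxiNS.recip ε x.1.1))| ^ (20 / 11 : ℝ) * x.1.1 ∂AxiNS.box ε R a t)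
        ^ (11 / 20 : ℝ)) ^ 4 :=
    pow_nonneg (Real.rpow_nonneg (AxiNS.integral_box_weight_nonneg hε fun x => by positivity) _) 4
  have p4 : 0 ≤ ∫ x, (AxiNS.unc vφ (x, 0) ^ 2 * (AxiNS.cutoff Z r₀ x.1 ^ 2
      * AxiNS.recip ε x.1)) ^ 2 * x.1 ∂AxiNS.rect ε R a :=
    AxiNS.integral_rect_weight_nonneg hε fun x => sq_nonneg _
  have p5 : 0 ≤ (∫ x, |AxiNS.vort vr vz x| ^ (20 / 7 : ℝ) * x.1.1
      ∂AxiNS.box r₀ (2 * r₀) a t) ^ (7 / 10 : ℝ) :=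
    Real.rpow_nonneg (AxiNS.integral_box_weight_nonneg hr₀ fun x => by positivity) _
  have q1 : ∀ s, 0 ≤ ∫ x, (AxiNS.vort vr vz (x, s) * (AxiNS.cutoff Z r₀ x.1 ^ 2
      * AxiNS.recip ε x.1)) ^ 2 * x.1 ∂AxiNS.rect ε R a := fun s =>
    AxiNS.integral_rect_weight_nonneg hε fun x => sq_nonneg _
  have hσ0 : 0 ≤ 1 / r₀ := by positivity
  refine (AxiNS.normV_chiOverR_sq_le hε hr hz hX hζ ?_ (fun s hs' =>
      (le_add_of_nonneg_right ?_).trans (key s ⟨hs'.1.le, hs'.2.le⟩))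
    ((le_add_of_nonneg_left (q1 t)).trans (key t ⟨ht.le, le_rfl⟩))).trans ?_
  · positivity
  · exact AxiNS.integral_box_weight_nonneg hε fun x => by positivity
  refine le_trans ?_ (add_le_add (mul_le_mul_right e5 _) (mul_le_mul_right (add_le_add (add_le_add
    (add_le_add (add_le_add_right e1 _) e2) e3) e4) _))
  simp only [max_eq_left hσ0]
  rw [← ENNReal.ofReal_mul (by positivity), ← ENNReal.ofReal_add (by positivity) p1,
    ← ENNReal.ofReal_add (by positivity) p2, ← ENNReal.ofReal_add (by positivity) p3,
    ← ENNReal.ofReal_add (by positivity) p4, ← ENNReal.ofReal_mul (by positivity),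
    ← ENNReal.ofReal_add (by positivity) (by positivity)]
  refine ENNReal.ofReal_le_ofReal ?_
  -- In the claim the `d₅²` term carries the product of `c` and `k (1 / r₀)`, one factor `8πM` more
  -- than the estimate gives; this is harmless since `8πM ≥ 1`.
  have := mul_le_mul_of_nonneg_right hc1
    (show 0 ≤ 8 * Real.pi * M * (1 + 1 / r₀) ^ 4 * d₅ ^ 2 * (1 + (1 + d₆) * d₆ ^ 2) by positivity)
  linarith only [this]
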